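/- Let $\tau\in\mathbb C$ with $\operatorname{Im}\tau>0$, and write $p^{\lambda}=e^{\mathrm i\pi\tau\lambda}$ (so $p=e^{\mathrm i\pi\tau}$), $$(a;q)_\infty=\prod_{j=0}^\infty(1-aq^j),\qquad \theta(x;q)=(x;q)_\infty(q/x;q)_\infty,\qquad \theta(x_1,\dots,x_m;q)=\prod_{i=1}^m\theta(x_i;q)$$ for $0<|q|<1$. Let $\left(\frac{k}{3}\right)\in\{-1,0,1\}$ be the Legendre symbol, and for a $2n\times 2n$ matrix put $$\operatorname{pfaff}_{1\le i,j\le 2n}(a_{ij})=\frac1{2^nn!}\sum_{s\in S_{2n}}\operatorname{sgn}(s)\prod_{j=1}^n a_{s(2j-1)\,s(2j)}.$$ For $n\ge 1$ and $z=(z_1,\dots,z_{2n})\in\mathbb C^{2n}$, put $x_j=e^{\mathrm i\pi z_j}$, $r_{ij}=x_i/x_j$, $$A(r)=\theta(r^2,-r^2,pr^2;p^2),\qquad B(r)=\theta(r^2,pr^2,-pr^2;p^2),$$ and for $\sigma\in\{0,1,2,3,4,6\}$ define $P_n^{(\sigma)}(z_1,\dots,z_{2n})=P_n^{(\sigma)}(z_1,\dots,z_{2n};\tau)$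 by \begin{align*} P_n^{(0)}&=\prod_{1\le i<j\le 2n}\theta(p^{1/3}r_{ij}^2;p^{2/3})\ \operatorname{pfaff}\left(\frac{A(r_{ij})}{r_{ij}^{2}\,\theta(p^{1/3}r_{ij}^2;p^{2/3})}\right),\\ P_n^{(1)}&=\prod_{1\le i<j\le 2n}r_{ij}^{-3}\theta(-r_{ij}^6;p^{6})\ \operatorname{pfaff}\left(\frac{r_{ij}A(r_{ij})}{\theta(-r_{ij}^6;p^{6})}\right),\\ P_n^{(2)}&=\prod_{1\le i<j\le 2n}\theta(p^3r_{ij}^6;p^{6})\ \operatorname{pfaff}\left(\frac{B(r_{ij})}{r_{ij}\,\theta(p^3r_{ij}^6;p^{6})}\right),\\ P_n^{(3)}&=\prod_{1\le i<j\le 2n}r_{ij}^{-1}\theta(-r_{ij}^2;p^{2/3})\ \operatorname{pfaff}\left(\frac{A(r_{ij})}{r_{ij}\,\theta(-r_{ij}^2;p^{2/3})}\right),\\ P_n^{(4)}&=\prod_{1\le i<j\le 2n}\theta(p^3r_{ij}^6;p^{6})\ \operatorname{pfaff}\left(\frac{A(r_{ij})}{r_{ij}^2\,\theta(p^3r_{ij}^6;p^{6})}\right),\\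 P_n^{(6)}&=\prod_{1\le i<j\le 2n}\theta(p^{1/3}r_{ij}^2;p^{2/3})\ \operatorname{pfaff}\left(\frac{B(r_{ij})}{r_{ij}\,\theta(p^{1/3}r_{ij}^2;p^{2/3})}\right), \end{align*} where each pfaffian is over $1\le i,j\le 2n$. Let \begin{align*} C_0&=-\frac{(p^4;p^4)_\infty}{(p^2;p^2)_\infty^2(p^{4/3};p^{4/3})_\infty},& C_1&=\frac{(p;p)_\infty}{(p^2;p^2)_\infty^2(p^3;p^3)_\infty},\\ C_2&=\frac{(-p;-p)_\infty}{(p^2;p^2)_\infty^2(-p^3;-p^3)_\infty},& C_3&=\frac{(p;p)_\infty}{(p^2;p^2)_\infty^2(p^{1/3};p^{1/3})_\infty},\\ C_4&=-\frac{(p^4;p^4)_\infty}{(p^2;p^2)_\infty^2(p^{12};p^{12})_\infty},& C_6&=-\frac{(-p;-p)_\infty}{(p^2;p^2)_\infty^2(-p^{1/3};-p^{1/3})_\infty}, \end{align*} \begin{align*} D_0&=D_6=\pi(p^{1/3};p^{2/3})_\infty^2,& D_1&=2\pi(-p^6;p^6)_\infty^2,\\ D_2&=D_4=\pi(p^3;p^6)_\infty^2,&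 D_3&=2\pi(-p^{2/3};p^{2/3})_\infty^2 . \end{align*} Let $T_0,T_1,\dots$ be Glaisher's $T$-numbers, given by $\frac{\sin(2z)}{2\cos(3z)}=\sum_{n=0}^\infty\frac{T_nz^{2n+1}}{(2n+1)!}$ near $z=0$, and for $j\ge 0$ let \begin{align*} L_j^{(0)}&=\sum_{k=1}^\infty\frac{1-p^{4k/3}}{1+p^{2k}}\,p^{(k-1)/3}(2k)^{2j+1},\\ L_j^{(1)}&=(-1)^{j+1}T_j+\sum_{k=1}^\infty\left(\frac{k+1}3\right)\frac{(-1)^{k}p^{2k-1}}{1-p^{2k-1}}(2k-1)^{2j+1},\\ L_j^{(2)}&=\sum_{k=1}^\infty\left(\frac{k+1}3\right)\frac{p^{k-1}}{1+p^{2k-1}}(2k-1)^{2j+1},\\ L_j^{(3)}&=\sum_{k=1}^\infty(-1)^k\frac{1-p^{(2k-1)/3}}{1-p^{2k-1}}\,p^{(2k-2)/3}(2k-1)^{2j+1},\\ L_j^{(4)}&=\sum_{k=1}^\infty\left(\frac{k}3\right)\frac{p^{k-1}}{1+p^{2k}}(2k)^{2j+1},\\ L_j^{(6)}&=\sum_{k=1}^\infty\frac{1-p^{(4k-2)/3}}{1+p^{2k-1}}\,p^{(k-1)/3}(2k-1)^{2j+1}.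 \end{align*} Theorem. For every $n\ge1$ and $\sigma\in\{0,1,2,3,4,6\}$, all the series defining $L_j^{(\sigma)}$, $j\ge0$, converge (absolutely), and $$\lim_{z_1,\dots,z_{2n}\to 0}\frac{P_n^{(\sigma)}(z_1,\dots,z_{2n})}{\prod_{1\le i<j\le 2n}(z_i-z_j)}=\frac{(2\mathrm i C_\sigma)^nD_\sigma^{n(2n-1)}}{\prod_{j=1}^{2n}(j-1)!}\,\det_{1\le i,j\le n}\left(L^{(\sigma)}_{i+j-2}\right),$$ where $(z_1,\dots,z_{2n})$ tends to the origin of $\mathbb C^{2n}$ through points with pairwise distinct coordinates. -/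

import Mathlib

open Filter Topology

noncomputable section

/-- `nomePow τ l = p ^ l = exp (π i τ l)`, where `p = exp (π i τ)`. -/
def nomePow (τ l : ℂ) : ℂ := Complex.exp (Complex.I * Real.pi * τ * l)

/-- The infinite product `(a; q)_∞ = ∏_{j ≥ 0} (1 - a q ^ j)`. -/
def qPoch (a q : ℂ) : ℂ := ∏' j : ℕ, (1 - a * q ^ j)

/-- The product defining `(a; q)_∞` converges when `|q| < 1`. -/
theorem multipliable_qPoch (a q : ℂ) (hq : ‖q‖ < 1) :
    Multipliable fun j : ℕ => 1 - a * q ^ j := by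
  have h : Summable fun j : ℕ => ‖-(a * q ^ j)‖ := by
    simpa [norm_mul, norm_pow] using
      (summable_geometric_of_lt_one (norm_nonneg q) hq).mul_left ‖a‖
  simpa [sub_eq_add_neg] using multipliable_one_add_of_summable h

/-- The theta function `θ(x; q) = (x; q)_∞ (q / x; q)_∞`. -/
def qTheta (x q : ℂ) : ℂ := qPoch x q * qPoch (q / x) q

/-- The pfaffian of a `2n × 2n` matrix,
`(1 / (2 ^ n n!)) ∑_{s ∈ S_{2n}} sgn s ∏_{j = 1}^{n} A_{s(2j-1), s(2j)}`
(here the rows and columns are numbered from `0`). -/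
def pfaffian {n : ℕ} (A : Matrix (Fin (2 * n)) (Fin (2 * n)) ℂ) : ℂ :=
  1 / (2 ^ n * (n.factorial : ℂ)) *
    ∑ s : Equiv.Perm (Fin (2 * n)), ((Equiv.Perm.sign s : ℤ) : ℂ) *
      ∏ j : Fin n, A (s ⟨2 * j.1, by omega⟩) (s ⟨2 * j.1 + 1, by omega⟩)

/-- The six labels `0, 1, 2, 3, 4, 6`. -/
inductive PfLabel : Type
  | zero | one | two | three | four | six

/-- The factor attached to a pair `i < j` in the product in front of the pfaffian,
as a function of `x = x_i` and `y = x_j`. -/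
def prodFactor (σ : PfLabel) (τ x y : ℂ) : ℂ :=
  match σ with
  | .zero => qTheta (nomePow τ (1 / 3) * (x ^ 2 / y ^ 2)) (nomePow τ (2 / 3))
  | .one => y ^ 3 / x ^ 3 * qTheta (-(x ^ 6 / y ^ 6)) (nomePow τ 6)
  | .two => qTheta (nomePow τ 3 * (x ^ 6 / y ^ 6)) (nomePow τ 6)
  | .three => y / x * qTheta (-(x ^ 2 / y ^ 2)) (nomePow τ (2 / 3))
  | .four => qTheta (nomePow τ 3 * (x ^ 6 / y ^ 6)) (nomePow τ 6)
  | .six => qTheta (nomePow τ (1 / 3) * (x ^ 2 / y ^ 2)) (nomePow τ (2 / 3))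

/-- The numerator `θ(x²/y², -x²/y², p x²/y²; p²)`. -/
def thetaNumA (τ x y : ℂ) : ℂ :=
  qTheta (x ^ 2 / y ^ 2) (nomePow τ 2) * qTheta (-(x ^ 2 / y ^ 2)) (nomePow τ 2) *
    qTheta (nomePow τ 1 * (x ^ 2 / y ^ 2)) (nomePow τ 2)

/-- The numerator `θ(x²/y², p x²/y², -p x²/y²; p²)`. -/
def thetaNumB (τ x y : ℂ) : ℂ :=
  qTheta (x ^ 2 / y ^ 2) (nomePow τ 2) * qTheta (nomePow τ 1 * (x ^ 2 / y ^ 2)) (nomePow τ 2) *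
    qTheta (-(nomePow τ 1 * (x ^ 2 / y ^ 2))) (nomePow τ 2)

/-- The entry of the pfaffian, as a function of `x = x_i` and `y = x_j`. -/
def pfEntry (σ : PfLabel) (τ x y : ℂ) : ℂ :=
  match σ with
  | .zero => y ^ 2 * thetaNumA τ x y /
      (x ^ 2 * qTheta (nomePow τ (1 / 3) * (x ^ 2 / y ^ 2)) (nomePow τ (2 / 3)))
  | .one => x * thetaNumA τ x y / (y * qTheta (-(x ^ 6 / y ^ 6)) (nomePow τ 6))
  | .two => y * thetaNumB τ x y / (x * qTheta (nomePow τ 3 * (x ^ 6 / y ^ 6)) (nomePow τ 6))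
  | .three => y * thetaNumA τ x y / (x * qTheta (-(x ^ 2 / y ^ 2)) (nomePow τ (2 / 3)))
  | .four => y ^ 2 * thetaNumA τ x y /
      (x ^ 2 * qTheta (nomePow τ 3 * (x ^ 6 / y ^ 6)) (nomePow τ 6))
  | .six => y * thetaNumB τ x y /
      (x * qTheta (nomePow τ (1 / 3) * (x ^ 2 / y ^ 2)) (nomePow τ (2 / 3)))

/-- The variable `x = exp (π i z)`. -/
def expVar (z : ℂ) : ℂ := Complex.exp (Complex.I * Real.pi * z)

/-- The elliptic pfaffian `P_n^{(σ)}(z_1, …, z_{2n}; τ)`. -/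
def ellipticPfaffian (σ : PfLabel) (n : ℕ) (τ : ℂ) (z : Fin (2 * n) → ℂ) : ℂ :=
  (∏ i : Fin (2 * n), ∏ j ∈ Finset.Ioi i, prodFactor σ τ (expVar (z i)) (expVar (z j))) *
    pfaffian (Matrix.of fun i j : Fin (2 * n) => pfEntry σ τ (expVar (z i)) (expVar (z j)))

/-- The Vandermonde product `∏_{i < j} (z_i - z_j)`. -/
def vandermondeProd {m : ℕ} (z : Fin m → ℂ) : ℂ :=
  ∏ i : Fin m, ∏ j ∈ Finset.Ioi i, (z i - z j)

/-- The constants `C_σ`. -/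
def constC (σ : PfLabel) (τ : ℂ) : ℂ :=
  let p : ℂ → ℂ := nomePow τ
  match σ with
  | .zero => -(qPoch (p 4) (p 4) / (qPoch (p 2) (p 2) ^ 2 * qPoch (p (4 / 3)) (p (4 / 3))))
  | .one => qPoch (p 1) (p 1) / (qPoch (p 2) (p 2) ^ 2 * qPoch (p 3) (p 3))
  | .two => qPoch (-p 1) (-p 1) / (qPoch (p 2) (p 2) ^ 2 * qPoch (-p 3) (-p 3))
  | .three => qPoch (p 1) (p 1) / (qPoch (p 2) (p 2) ^ 2 * qPoch (p (1 / 3)) (p (1 / 3)))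
  | .four => -(qPoch (p 4) (p 4) / (qPoch (p 2) (p 2) ^ 2 * qPoch (p 12) (p 12)))
  | .six => -(qPoch (-p 1) (-p 1) /
      (qPoch (p 2) (p 2) ^ 2 * qPoch (-p (1 / 3)) (-p (1 / 3))))

/-- The constants `D_σ`. -/
def constD (σ : PfLabel) (τ : ℂ) : ℂ :=
  let p : ℂ → ℂ := nomePow τ
  match σ with
  | .zero => Real.pi * qPoch (p (1 / 3)) (p (2 / 3)) ^ 2
  | .one => 2 * Real.pi * qPoch (-p 6) (p 6) ^ 2
  | .two => Real.pi * qPoch (p 3) (p 6) ^ 2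
  | .three => 2 * Real.pi * qPoch (-p (2 / 3)) (p (2 / 3)) ^ 2
  | .four => Real.pi * qPoch (p 3) (p 6) ^ 2
  | .six => Real.pi * qPoch (p (1 / 3)) (p (2 / 3)) ^ 2

/-- Glaisher's `T`-numbers `1, 23, 1681, …`, defined by the Taylor expansion
`sin (2 z) / (2 cos (3 z)) = ∑_{n ≥ 0} T_n z ^ (2 n + 1) / (2 n + 1)!` at `z = 0`. -/
def glaisherT (n : ℕ) : ℂ :=
  iteratedDeriv (2 * n + 1) (fun z : ℂ => Complex.sin (2 * z) / (2 * Complex.cos (3 * z))) 0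

/-- The `k`-th term (`k ≥ 1`) of the Lambert series in `L_j^{(σ)}`. -/
def lambertTerm (σ : PfLabel) (τ : ℂ) (j k : ℕ) : ℂ :=
  let p : ℂ → ℂ := nomePow τ
  match σ with
  | .zero => (1 - p (4 * k / 3)) / (1 + p (2 * k)) * p ((k - 1) / 3) * (2 * k) ^ (2 * j + 1)
  | .one => (legendreSym 3 (k + 1) : ℂ) * ((-1) ^ k * p (2 * k - 1) / (1 - p (2 * k - 1))) *
      (2 * k - 1) ^ (2 * j + 1)
  | .two => (legendreSym 3 (k + 1) : ℂ) * (p (k - 1) / (1 + p (2 * k - 1))) *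
      (2 * k - 1) ^ (2 * j + 1)
  | .three => (-1) ^ k * ((1 - p ((2 * k - 1) / 3)) / (1 - p (2 * k - 1))) *
      p ((2 * k - 2) / 3) * (2 * k - 1) ^ (2 * j + 1)
  | .four => (legendreSym 3 k : ℂ) * (p (k - 1) / (1 + p (2 * k))) * (2 * k) ^ (2 * j + 1)
  | .six => (1 - p ((4 * k - 2) / 3)) / (1 + p (2 * k - 1)) * p ((k - 1) / 3) *
      (2 * k - 1) ^ (2 * j + 1)

/-- `L_j^{(σ)}`: the sum over `k ≥ 1` of the Lambert terms, plus `(-1) ^ (j + 1) T_j` when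
`σ = 1`. -/
def lambertL (σ : PfLabel) (τ : ℂ) (j : ℕ) : ℂ :=
  (match σ with
    | .one => (-1) ^ (j + 1) * glaisherT j
    | _ => 0) + ∑' k : ℕ, lambertTerm σ τ j (k + 1)

/-- The Hankel determinant `H_n^{(σ)} = det_{1 ≤ i, j ≤ n} (L_{i+j-2}^{(σ)})`
(here `i` and `j` are numbered from `0`). -/
def hankelH (σ : PfLabel) (n : ℕ) (τ : ℂ) : ℂ :=
  Matrix.det (Matrix.of fun i j : Fin n => lambertL σ τ (i.1 + j.1))

end

/-!
Write `p = g ^ 3` and `X = x_i / x_j = exp (π i (z_i - z_j))`. Both the entry of the pfaffian and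
the factor in front of it depend on `z_i - z_j` only, and the entry is an odd function `f` of this
difference, analytic at `0`. The theorem thus splits into a fact about pfaffians of matrices
`f (z_i - z_j)` and the computation of the Taylor coefficients of `f` for each label.

*Coalescing points.* Conjugating `f (z_i - z_j)` by the triangular matrix of divided differences at
the nodes `z_0, …, z_a` multiplies the pfaffian by the determinant of that matrix, which is the
inverse of the Vandermonde product up to sign. The entries of the conjugated matrix converge as all
nodes tend to `0`, to `(-1) ^ c` times `f^(a + c)(0) / (a! c!)`. As `f` is odd, the limit matrix is
congruent to the standard symplectic form through a Hankel matrix of the odd derivatives of `f`,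
and its pfaffian is a Hankel determinant (`tendsto_pfaffian_div_vandermondeProd`).

*Lambert series.* As functions of `x = X ^ 2`, the entry is `F x / Den x` up to a power of `X`, with
`F` a product of three theta functions and `Den` a single one. For a suitable series
`S x = ∑ ν_k x ^ k / (1 ∓ g ^ (6 k - 3 ε))`, both `F` and `Den * S` have the quasi-periodicity under
`x ↦ g ^ 6 x` and the oddness under `x ↦ x⁻¹` of an odd theta function of degree three; here it is
used that the correction terms in the functional equations of `S` are annihilated by `Den`. In terms
of Laurent coefficients these properties leave a single free coefficient
(`IsOddTheta.proportional`), so `F = C * Den * S`. The constant `C` is read off at a zero `x₀` of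
`Den` on the boundary of the annulus of convergence, where `S` has a simple pole with known
principal part (`theta_eq_const_mul_lambert`, `lambert_identity`). It is `F x₀` divided by a
multiple of `(q; q)_∞ ^ 2`, with `q` the base of `Den`, and factorizations of `(h; h)_∞` turn it
into `C_σ`.

*Taylor coefficients.* The coefficients of `S` are odd under `k ↦ ε - k`, so `X ^ (-ε) * S` is a
series of sines of `(2 k - ε) π w`. Expanding the sines and interchanging the summations gives the
`L_j` (`tsum_laurent_expVar`, `hasSum_sine_series`). Label `1` is exceptional: the unit circle,
which carries `w = 0`, is itself the boundary of the annulus of convergence. There the leading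
part of `S` is summed to a rational function, which is the generating function of Glaisher's
numbers (`glaisherFn_eq_expVar`), the remaining Lambert series converges in an annulus about the
unit circle, and the identity theorem extends the expansion from the upper half of a disc about
`0` to the whole disc (`lambert_one`, `hasLambertExpansion_one`).

Finally, the product in front of the pfaffian tends to `(D_σ / π) ^ (n (2 n - 1))`, and the powers
of `π` are those which come out of the Hankel determinant.
-/

/-! ### Pfaffians and congruence -/

/-- The bijection `(j, e) ↦ 2 j + e` which groups the indices `0, …, 2n - 1` into consecutive
pairs. -/
def pairEquiv (n : ℕ) : Fin n × Fin 2 ≃ Fin (2 * n) where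
  toFun p := ⟨2 * p.1.1 + p.2.1, by omega⟩
  invFun i := (⟨i.1 / 2, by omega⟩, ⟨i.1 % 2, by omega⟩)
  left_inv p := by
    ext
    · simp only
      omega
    · simp only
      omega
  right_inv i := by
    ext
    simp only
    omega

/-- The unnormalized pfaffian `∑ sgn s ∏ A (s (j, 0)) (s (j, 1))` of a matrix whose index set is
presented as `n` consecutive pairs. -/
def pairPf {n : ℕ} (A : Matrix (Fin n × Fin 2) (Fin n × Fin 2) ℂ) : ℂ :=
  ∑ s : Equiv.Perm (Fin n × Fin 2), ((Equiv.Perm.sign s : ℤ) : ℂ) *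
    ∏ j : Fin n, A (s (j, 0)) (s (j, 1))

theorem pfaffian_eq_pairPf {n : ℕ} (A : Matrix (Fin (2 * n)) (Fin (2 * n)) ℂ) :
    pfaffian A = 1 / (2 ^ n * (n.factorial : ℂ)) *
      pairPf (A.submatrix (pairEquiv n) (pairEquiv n)) := by
  unfold pfaffian pairPf
  congr 1
  refine Fintype.sum_equiv (pairEquiv n).symm.permCongr _ _ fun s => ?_
  rw [Equiv.Perm.sign_permCongr]
  congr 1
  refine Finset.prod_congr rfl fun j _ => ?_
  simp only [Matrix.submatrix_apply, Equiv.permCongr_apply, Equiv.symm_symm,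
    Equiv.apply_symm_apply]
  congr 2

/-- The identity `pf (B A Bᵀ) = det B * pf A`. Expanding the left side gives a sum over all maps `g`
of the index set of minors of `B` with columns chosen by `g`; those with `g` not injective
vanish. -/
theorem pairPf_conj {n : ℕ} (B A : Matrix (Fin n × Fin 2) (Fin n × Fin 2) ℂ) :
    pairPf (B * A * B.transpose) = B.det * pairPf A := by
  have h1 : ∀ a b, (B * A * B.transpose) a b =
      ∑ p : Fin 2 → Fin n × Fin 2, B a (p 0) * B b (p 1) * A (p 0) (p 1) := by
    intro a b
    have h0 := Fintype.sum_equiv (finTwoArrowEquiv (Fin n × Fin 2))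
      (fun p : Fin 2 → Fin n × Fin 2 => B a (p 0) * B b (p 1) * A (p 0) (p 1))
      (fun q => B a q.1 * B b q.2 * A q.1 q.2) (fun p => rfl)
    rw [h0, Fintype.sum_prod_type, Finset.sum_comm]
    simp only [Matrix.mul_apply, Matrix.transpose_apply, Finset.sum_mul]
    exact Finset.sum_congr rfl fun i _ => Finset.sum_congr rfl fun j _ => by ring
  have h2 : pairPf (B * A * B.transpose) = ∑ g : Fin n × Fin 2 → Fin n × Fin 2,
      (B.submatrix id g).det * ∏ j : Fin n, A (g (j, 0)) (g (j, 1)) := by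
    unfold pairPf
    simp only [h1]
    have h3 : ∀ s : Equiv.Perm (Fin n × Fin 2),
        ((Equiv.Perm.sign s : ℤ) : ℂ) * ∏ j : Fin n, ∑ p : Fin 2 → Fin n × Fin 2,
          B (s (j, 0)) (p 0) * B (s (j, 1)) (p 1) * A (p 0) (p 1) =
        ∑ g : Fin n × Fin 2 → Fin n × Fin 2, ((Equiv.Perm.sign s : ℤ) : ℂ) *
          ((∏ i, B (s i) (g i)) * ∏ j : Fin n, A (g (j, 0)) (g (j, 1))) := by
      intro s
      rw [Finset.prod_univ_sum, Finset.mul_sum, Fintype.piFinset_univ]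
      refine Fintype.sum_equiv (Equiv.curry _ _ _).symm _ _ fun g => ?_
      rw [Fintype.prod_prod_type, ← Finset.prod_mul_distrib]
      simp [Fin.prod_univ_two, Function.uncurry]
    simp only [h3]
    rw [Finset.sum_comm]
    refine Finset.sum_congr rfl fun g _ => ?_
    rw [Matrix.det_apply', Finset.sum_mul]
    refine Finset.sum_congr rfl fun s _ => ?_
    simp [mul_assoc]
  rw [h2]
  unfold pairPf
  rw [Finset.mul_sum]
  symm
  refine Finset.sum_of_injOn (fun s : Equiv.Perm (Fin n × Fin 2) => (s : _ → _))
    (fun s _ t _ h => Equiv.coe_fn_injective h) (fun _ _ => Finset.mem_coe.2 (Finset.mem_univ _))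
    ?_ ?_
  · intro g _ hg
    have hinj : ¬ Function.Injective g := by
      intro hinj
      refine hg ⟨Equiv.ofBijective g (Finite.injective_iff_bijective.1 hinj), by simp, rfl⟩
    rw [Function.not_injective_iff] at hinj
    obtain ⟨a, b, hab, hne⟩ := hinj
    rw [Matrix.det_zero_of_column_eq hne (fun k => by simp [hab]), zero_mul]
  · intro s _
    rw [Matrix.det_permute']
    ring

theorem pfaffian_conj {n : ℕ} (B A : Matrix (Fin (2 * n)) (Fin (2 * n)) ℂ) :
    pfaffian (B * A * B.transpose) = B.det * pfaffian A := by
  rw [pfaffian_eq_pairPf, pfaffian_eq_pairPf,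
    ← Matrix.submatrix_mul_equiv _ _ _ (pairEquiv n) _,
    ← Matrix.submatrix_mul_equiv _ _ _ (pairEquiv n) _, ← Matrix.transpose_submatrix, pairPf_conj,
    Matrix.det_submatrix_equiv_self]
  ring

/-- The standard symplectic form on `n` pairs. -/
def stdSymplectic (n : ℕ) : Matrix (Fin n × Fin 2) (Fin n × Fin 2) ℂ :=
  Matrix.of fun a b => if a.1 = b.1 then ((b.2.1 : ℂ) - (a.2.1 : ℂ)) else 0

/-- The non-vanishing terms of the pfaffian of the standard symplectic form belong to the
permutations which permute the `n` pairs and possibly flip each of them, and each contributes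
`1`. -/
theorem pairPf_stdSymplectic (n : ℕ) :
    pairPf (stdSymplectic n) = 2 ^ n * (n.factorial : ℂ) := by
  have hcard : (2 ^ n * (n.factorial : ℂ)) =
      ∑ _q : Equiv.Perm (Fin n) × (Fin n → Equiv.Perm (Fin 2)), (1 : ℂ) := by
    simp [Fintype.card_perm, mul_comm]
  have hdec : ∀ a b : Fin 2, a ≠ b → ∃ e : Equiv.Perm (Fin 2), e 0 = a ∧ e 1 = b := by decide
  have hsgn : ∀ e : Equiv.Perm (Fin 2),
      ((Equiv.Perm.sign e : ℤ) : ℂ) * (((e 1).1 : ℂ) - ((e 0).1 : ℂ)) = 1 := by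
    intro e
    have : (Equiv.Perm.sign e : ℤ) * (((e 1).1 : ℤ) - ((e 0).1 : ℤ)) = 1 := by
      revert e
      decide
    exact_mod_cast this
  let Φ : Equiv.Perm (Fin n) × (Fin n → Equiv.Perm (Fin 2)) → Equiv.Perm (Fin n × Fin 2) :=
    fun q => (Equiv.prodCongrRight q.2).trans (Equiv.prodCongrLeft fun _ => q.1)
  have hΦ : ∀ q j e, Φ q (j, e) = (q.1 j, q.2 j e) := fun q j e => rfl
  rw [hcard]
  unfold pairPf
  symm
  refine Finset.sum_of_injOn Φ ?_ (fun _ _ => Finset.mem_coe.2 (Finset.mem_univ _)) ?_ ?_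
  · rintro ⟨π, ε⟩ _ ⟨π', ε'⟩ _ h
    have h' : ∀ j e, (π j, ε j e) = (π' j, ε' j e) := fun j e => by
      have := congrArg (fun s : Equiv.Perm (Fin n × Fin 2) => s (j, e)) h
      simpa [hΦ] using this
    have e1 : π = π' := Equiv.ext fun j => (Prod.ext_iff.1 (h' j 0)).1
    have e2 : ε = ε' := funext fun j => Equiv.ext fun e => (Prod.ext_iff.1 (h' j e)).2
    rw [e1, e2]
  · intro s _ hs
    by_contra hne
    apply hs
    have hj : ∀ j, stdSymplectic n (s (j, 0)) (s (j, 1)) ≠ 0 := fun j h0 =>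
      hne (by rw [Finset.prod_eq_zero (Finset.mem_univ j) h0, mul_zero])
    have h1 : ∀ j, (s (j, 0)).1 = (s (j, 1)).1 := fun j => by
      by_contra h
      exact hj j (by simp [stdSymplectic, h])
    have h2 : ∀ j, (s (j, 0)).2 ≠ (s (j, 1)).2 := fun j h => by
      exact hj j (by simp [stdSymplectic, h])
    choose ε hε0 hε1 using fun j => hdec _ _ (h2 j)
    have hfin : ∀ a b c : Fin 2, a ≠ b → c = a ∨ c = b := by decide
    have hinj : Function.Injective fun j => (s (j, 0)).1 := by
      intro j j' h
      simp only at h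
      rcases hfin _ _ (s (j', 0)).2 (h2 j) with h' | h'
      · have : s (j', 0) = s (j, 0) := Prod.ext h.symm h'
        exact ((Prod.ext_iff.1 (s.injective this)).1).symm
      · have : s (j', 0) = s (j, 1) := Prod.ext (h.symm.trans (h1 j)) h'
        exact ((Prod.ext_iff.1 (s.injective this)).1).symm
    refine ⟨(Equiv.ofBijective _ (Finite.injective_iff_bijective.1 hinj), ε), by simp, ?_⟩
    refine Equiv.ext fun p => ?_
    obtain ⟨j, e⟩ := p
    rw [hΦ]
    fin_cases e
    · exact Prod.ext rfl (hε0 j)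
    · exact Prod.ext (h1 j) (hε1 j)
  · rintro ⟨π, ε⟩ _
    have hs : Equiv.Perm.sign (Φ (π, ε)) = ∏ j, Equiv.Perm.sign (ε j) := by
      simp only [Φ, Equiv.Perm.sign_trans, Equiv.Perm.sign_prodCongrRight,
        Equiv.Perm.sign_prodCongrLeft]
      simp
    rw [hs]
    simp only [hΦ, stdSymplectic, Matrix.of_apply, if_true]
    push_cast
    rw [← Finset.prod_mul_distrib, Finset.prod_congr rfl fun j _ => hsgn (ε j)]
    simp

/-- A matrix `(-1)^b φ (a + b)` with `φ` supported on odd integers is congruent to the standard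
symplectic form through a block diagonal matrix, whose determinant is a Hankel determinant. -/
theorem pfaffian_alternating_hankel (n : ℕ) (φ : ℕ → ℂ) (hφ : ∀ m, φ (2 * m) = 0) :
    pfaffian (Matrix.of fun a b : Fin (2 * n) => (-1) ^ b.1 * φ (a.1 + b.1)) =
      (-1) ^ n * (Matrix.of fun i j : Fin n => φ (2 * (i.1 + j.1) + 1)).det := by
  set X : Matrix (Fin n) (Fin n) ℂ := Matrix.of fun i j => φ (2 * (i.1 + j.1) + 1) with hX
  have hXt : ∀ i j, X i j = φ (2 * (i.1 + j.1) + 1) := fun i j => rfl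
  have key : (Matrix.of fun a b : Fin (2 * n) => (-1) ^ b.1 * φ (a.1 + b.1)).submatrix
      (pairEquiv n) (pairEquiv n) =
      Matrix.blockDiagonal (fun e : Fin 2 => if e = 0 then 1 else -X) * stdSymplectic n *
        (Matrix.blockDiagonal (fun e : Fin 2 => if e = 0 then 1 else -X)).transpose := by
    ext ⟨i, a⟩ ⟨j, b⟩
    simp only [Matrix.mul_apply, Fintype.sum_prod_type, Fin.sum_univ_two, Matrix.submatrix_apply,
      Matrix.of_apply, Matrix.transpose_apply, Matrix.blockDiagonal_apply, stdSymplectic]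
    fin_cases a <;> fin_cases b
    · have := hφ (i.1 + j.1)
      rw [mul_add] at this
      simp [pairEquiv, this]
    · have e : 2 * i.1 + (2 * j.1 + 1) = 2 * (j.1 + i.1) + 1 := by ring
      simp [pairEquiv, Matrix.one_apply, Finset.sum_ite_eq, hXt, e, pow_succ, pow_mul]
    · have e : 2 * i.1 + 1 + 2 * j.1 = 2 * (i.1 + j.1) + 1 := by ring
      simp [pairEquiv, Matrix.one_apply, Finset.sum_ite_eq, hXt, e, pow_mul]
    · have := hφ (i.1 + j.1 + 1)
      have e : 2 * i.1 + 1 + (2 * j.1 + 1) = 2 * (i.1 + j.1 + 1) := by ring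
      simp [pairEquiv, e, this]
  rw [pfaffian_eq_pairPf, key, pairPf_conj, pairPf_stdSymplectic, Matrix.det_blockDiagonal]
  have hdet : ∏ e : Fin 2, (if e = 0 then (1 : Matrix (Fin n) (Fin n) ℂ) else -X).det =
      (-1) ^ n * X.det := by
    simp [Fin.prod_univ_two, Matrix.det_neg]
  have h0 : (n.factorial : ℂ) ≠ 0 := by exact_mod_cast n.factorial_ne_zero
  rw [hdet]
  field_simp

theorem continuous_pfaffian (n : ℕ) :
    Continuous (pfaffian : Matrix (Fin (2 * n)) (Fin (2 * n)) ℂ → ℂ) := by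
  unfold pfaffian
  fun_prop

/-! ### Divided differences and the limit of a pfaffian at coalescing points -/

open Lagrange in
/-- The divided difference of the monomial `x ^ k` at the nodes `z i`, `i ∈ s`. -/
noncomputable def divDiffPow {ι : Type*} [DecidableEq ι] (s : Finset ι) (z : ι → ℂ) (k : ℕ) :
    ℂ :=
  ∑ i ∈ s, nodalWeight s z i * z i ^ k

section DivDiff

variable {ι : Type*} [DecidableEq ι] {s : Finset ι} {z : ι → ℂ}

/-- The divided difference is the leading coefficient of the interpolation polynomial, which is
`x ^ k` itself as long as `k` is less than the number of nodes. -/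
theorem divDiffPow_eq_coeff (hz : Set.InjOn z s) {k : ℕ} (hk : k < s.card) :
    divDiffPow s z k = (Polynomial.X ^ k : Polynomial ℂ).coeff (s.card - 1) := by
  rw [Lagrange.coeff_eq_sum hz (by
    rw [Polynomial.degree_X_pow]
    exact_mod_cast hk)]
  unfold divDiffPow Lagrange.nodalWeight
  refine Finset.sum_congr rfl fun i _ => ?_
  rw [Polynomial.eval_pow, Polynomial.eval_X, Finset.prod_inv_distrib, div_eq_mul_inv, mul_comm]

theorem divDiffPow_of_lt (hz : Set.InjOn z s) {k : ℕ} (hk : k + 1 < s.card) :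
    divDiffPow s z k = 0 := by
  rw [divDiffPow_eq_coeff hz (by omega), Polynomial.coeff_X_pow, if_neg (by omega)]

theorem divDiffPow_of_eq (hz : Set.InjOn z s) {k : ℕ} (hk : k + 1 = s.card) :
    divDiffPow s z k = 1 := by
  rw [divDiffPow_eq_coeff hz (by omega), Polynomial.coeff_X_pow, if_pos (by omega)]

/-- The recursion of divided differences for `x ^ (k + 1) = x ^ k (x - z a) + z a x ^ k`. -/
theorem divDiffPow_insert_succ {a : ι} (ha : a ∉ s) (hz : Set.InjOn z (insert a s : Finset ι))
    (k : ℕ) : divDiffPow (insert a s) z (k + 1) =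
      z a * divDiffPow (insert a s) z k + divDiffPow s z k := by
  have h1 : ∀ i ∈ s, Lagrange.nodalWeight (insert a s) z i * (z i - z a) =
      Lagrange.nodalWeight s z i := by
    intro i hi
    have hia : a ≠ i := fun h => ha (h ▸ hi)
    have hne : z i - z a ≠ 0 := sub_ne_zero.2 fun h =>
      hia (hz (by simp) (by simp [hi]) h.symm)
    unfold Lagrange.nodalWeight
    rw [Finset.erase_insert_of_ne hia, Finset.prod_insert (by simp [ha])]
    field_simp
  have h2 : divDiffPow s z k =
      ∑ i ∈ insert a s, Lagrange.nodalWeight (insert a s) z i * (z i - z a) * z i ^ k := by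
    rw [Finset.sum_insert ha, sub_self, mul_zero, zero_mul, zero_add]
    exact Finset.sum_congr rfl fun i hi => by rw [h1 i hi]
  rw [h2]
  unfold divDiffPow
  rw [Finset.mul_sum, ← Finset.sum_add_distrib]
  exact Finset.sum_congr rfl fun i _ => by ring

/-- The divided difference of `x ^ k` is a complete homogeneous symmetric polynomial of degree
`k + 1 - card s` in the nodes; the factor `2 ^ k` bounds its number of terms. -/
theorem norm_divDiffPow_le {ε : ℝ} (hε0 : 0 ≤ ε) (hz : Set.InjOn z s) (hε : ∀ i ∈ s, ‖z i‖ ≤ ε)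
    (k : ℕ) : ‖divDiffPow s z k‖ ≤ 2 ^ k * ε ^ (k + 1 - s.card) := by
  induction s using Finset.induction_on generalizing k with
  | empty =>
    simp only [divDiffPow, Finset.sum_empty, norm_zero]
    positivity
  | insert a s ha ih =>
    have hs := ih (hz.mono (by simp)) fun i hi => hε i (by simp [hi])
    rw [Finset.card_insert_of_notMem ha]
    induction k with
    | zero =>
      by_cases h : s = ∅
      · subst h
        simp [divDiffPow, Lagrange.nodalWeight]
      · have : 0 < s.card := Finset.card_pos.2 (Finset.nonempty_of_ne_empty h)
        rw [divDiffPow_of_lt hz (by rw [Finset.card_insert_of_notMem ha]; omega), norm_zero]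
        positivity
    | succ k ihk =>
      rw [divDiffPow_insert_succ ha hz]
      have hza : ‖z a‖ ≤ ε := hε a (by simp)
      rcases lt_or_ge k s.card with h | h
      · rw [divDiffPow_of_lt hz (by rw [Finset.card_insert_of_notMem ha]; omega), mul_zero,
          zero_add]
        refine (hs k).trans ?_
        rw [Nat.add_sub_add_right, pow_succ]
        have : 0 ≤ 2 ^ k * ε ^ (k + 1 - s.card) := by positivity
        nlinarith
      · calc ‖z a * divDiffPow (insert a s) z k + divDiffPow s z k‖
            ≤ ‖z a‖ * ‖divDiffPow (insert a s) z k‖ + ‖divDiffPow s z k‖ :=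
              (norm_add_le _ _).trans (by rw [norm_mul])
          _ ≤ ε * (2 ^ k * ε ^ (k + 1 - (s.card + 1))) + 2 ^ k * ε ^ (k + 1 - s.card) := by
              gcongr
              exact hs k
          _ = 2 ^ (k + 1) * ε ^ (k + 1 + 1 - (s.card + 1)) := by
              obtain ⟨d, rfl⟩ := Nat.exists_eq_add_of_le h
              rw [show s.card + d + 1 - (s.card + 1) = d by omega,
                show s.card + d + 1 - s.card = d + 1 by omega,
                show s.card + d + 1 + 1 - (s.card + 1) = d + 1 by omega]
              ring

end DivDiff

/-- The sum over `l` of `C(k, l) (-1)^(k-l)` times the divided differences of `x ^ l` and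
`y ^ (k - l)`: the two-variable divided difference of `(x - y) ^ k`. -/
noncomputable def divDiffSubPow {m : ℕ} (z : Fin m → ℂ) (a b : Fin m) (k : ℕ) : ℂ :=
  ∑ l ∈ Finset.range (k + 1), divDiffPow (Finset.Iic a) z l *
    ((-1) ^ (k - l) * divDiffPow (Finset.Iic b) z (k - l)) * (k.choose l : ℂ)

section

variable {m : ℕ} {z : Fin m → ℂ}

theorem divDiffSubPow_of_lt (hz : Function.Injective z) (a b : Fin m) {k : ℕ}
    (hk : k < a.1 + b.1) : divDiffSubPow z a b k = 0 := by
  refine Finset.sum_eq_zero fun l hl => ?_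
  rw [Finset.mem_range] at hl
  rcases lt_or_ge l a.1 with h | h
  · rw [divDiffPow_of_lt hz.injOn (by rw [Fin.card_Iic]; omega)]
    ring
  · rw [divDiffPow_of_lt (k := k - l) hz.injOn (by rw [Fin.card_Iic]; omega)]
    ring

/-- In the critical degree only the term `l = a` survives, and both divided differences are `1`. -/
theorem divDiffSubPow_of_eq (hz : Function.Injective z) (a b : Fin m) :
    divDiffSubPow z a b (a.1 + b.1) = (-1) ^ b.1 * ((a.1 + b.1).choose a.1 : ℂ) := by
  unfold divDiffSubPow
  rw [Finset.sum_eq_single a.1]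
  · rw [divDiffPow_of_eq hz.injOn (by rw [Fin.card_Iic]),
      divDiffPow_of_eq (k := a.1 + b.1 - a.1) hz.injOn (by rw [Fin.card_Iic]; omega),
      Nat.add_sub_cancel_left]
    ring
  · intro l hl hne
    rw [Finset.mem_range] at hl
    rcases lt_or_ge l a.1 with h | h
    · rw [divDiffPow_of_lt hz.injOn (by rw [Fin.card_Iic]; omega)]
      ring
    · rw [divDiffPow_of_lt (k := a.1 + b.1 - l) hz.injOn (by rw [Fin.card_Iic]; omega)]
      ring
  · intro h
    exact absurd (Finset.mem_range.2 (by omega)) h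

/-- Homogeneity in the nodes: the two divided differences have total degree `k - (a + b)`. -/
theorem norm_divDiffSubPow_le (hz : Function.Injective z) (a b : Fin m) (k : ℕ) :
    ‖divDiffSubPow z a b k‖ ≤ 4 ^ k * ‖z‖ ^ (k - (a.1 + b.1)) := by
  have h1 : ∀ l ∈ Finset.range (k + 1), ‖divDiffPow (Finset.Iic a) z l *
      ((-1) ^ (k - l) * divDiffPow (Finset.Iic b) z (k - l)) * (k.choose l : ℂ)‖ ≤
      2 ^ k * ‖z‖ ^ (k - (a.1 + b.1)) * (k.choose l : ℝ) := by
    intro l hl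
    rw [Finset.mem_range] at hl
    have ha := norm_divDiffPow_le (norm_nonneg z) hz.injOn (s := Finset.Iic a)
      fun i _ => norm_le_pi_norm z i
    have hb := norm_divDiffPow_le (norm_nonneg z) hz.injOn (s := Finset.Iic b)
      fun i _ => norm_le_pi_norm z i
    rw [norm_mul, norm_mul, norm_mul, norm_pow, norm_neg, norm_one, one_pow, one_mul,
      Complex.norm_natCast]
    refine mul_le_mul_of_nonneg_right ?_ (by positivity)
    rcases lt_or_ge l a.1 with h | h
    · rw [divDiffPow_of_lt hz.injOn (by rw [Fin.card_Iic]; omega), norm_zero, zero_mul]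
      positivity
    · rcases lt_or_ge (k - l) b.1 with h' | h'
      · rw [divDiffPow_of_lt (k := k - l) hz.injOn (by rw [Fin.card_Iic]; omega), norm_zero,
          mul_zero]
        positivity
      · refine (mul_le_mul (ha l) (hb (k - l)) (norm_nonneg _) (by positivity)).trans (le_of_eq ?_)
        rw [Fin.card_Iic, Fin.card_Iic]
        rw [show k - (a.1 + b.1) = (l + 1 - (a.1 + 1)) + (k - l + 1 - (b.1 + 1)) by omega,
          pow_add]
        have : (2 : ℝ) ^ k = 2 ^ l * 2 ^ (k - l) := by
          rw [← pow_add]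
          congr 1
          omega
        rw [this]
        ring
  refine (norm_sum_le _ _).trans ((Finset.sum_le_sum h1).trans (le_of_eq ?_))
  rw [← Finset.mul_sum]
  have : (∑ l ∈ Finset.range (k + 1), (k.choose l : ℝ)) = 2 ^ k := by
    exact_mod_cast Nat.sum_range_choose k
  rw [this, show (4 : ℝ) = 2 * 2 by norm_num, mul_pow]
  ring

end

/-- The lower triangular matrix whose rows are the divided difference functionals at the nodes
`z 0, …, z a`. -/
noncomputable def newtonMatrix {m : ℕ} (z : Fin m → ℂ) : Matrix (Fin m) (Fin m) ℂ :=
  Matrix.of fun a i => if i ≤ a then Lagrange.nodalWeight (Finset.Iic a) z i else 0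

theorem det_newtonMatrix {m : ℕ} (z : Fin m → ℂ) :
    (newtonMatrix z).det = (∏ a : Fin m, ∏ l ∈ Finset.Iio a, (z a - z l))⁻¹ := by
  rw [Matrix.det_of_isLowerTriangular, ← Finset.prod_inv_distrib]
  · refine Finset.prod_congr rfl fun a _ => ?_
    simp only [newtonMatrix, Matrix.of_apply, le_refl, if_true, Lagrange.nodalWeight,
      Finset.Iic_erase, Finset.prod_inv_distrib]
  · intro i j hij
    have : i < j := hij
    simp [newtonMatrix, not_le.2 this]

/-- Reversing all `n (2 n - 1)` differences changes the sign by `(-1) ^ n`. -/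
theorem vandermondeProd_eq (n : ℕ) (z : Fin (2 * n) → ℂ) :
    vandermondeProd z = (-1) ^ n * ∏ a, ∏ l ∈ Finset.Iio a, (z a - z l) := by
  have h1 : ∏ a : Fin (2 * n), ∏ l ∈ Finset.Iio a, (z a - z l) =
      ∏ i : Fin (2 * n), ∏ j ∈ Finset.Ioi i, (z j - z i) := by
    refine Finset.prod_comm' fun a l => ?_
    simp
  have h2 : ∏ i : Fin (2 * n), ∏ _j ∈ Finset.Ioi i, (-1 : ℂ) = (-1) ^ n := by
    simp only [Finset.prod_const, Fin.card_Ioi]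
    rw [← (pairEquiv n).prod_comp, Fintype.prod_prod_type]
    have : ∀ j : Fin n, ∏ e : Fin 2, (-1 : ℂ) ^ (2 * n - 1 - (pairEquiv n (j, e)).1) = -1 := by
      intro j
      have hj := j.2
      rw [Fin.prod_univ_two, ← pow_add]
      refine Odd.neg_one_pow ⟨2 * n - 2 * j.1 - 2, ?_⟩
      simp only [pairEquiv, Equiv.coe_fn_mk, Fin.val_zero, Fin.val_one]
      omega
    simp [this]
  rw [h1, ← h2, ← Finset.prod_mul_distrib]
  refine Finset.prod_congr rfl fun i _ => ?_
  rw [← Finset.prod_mul_distrib]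
  exact Finset.prod_congr rfl fun j _ => by ring

/-- Applying divided differences in both variables to a matrix `f (z i - z j)`. -/
theorem hasSum_newtonMatrix_conj {m : ℕ} {f : ℂ → ℂ} {b : ℕ → ℂ} {z : Fin m → ℂ}
    (hf : ∀ i j, HasSum (fun k => b k * (z i - z j) ^ k) (f (z i - z j))) (a c : Fin m) :
    HasSum (fun k => b k * divDiffSubPow z a c k)
      ((newtonMatrix z * (Matrix.of fun i j => f (z i - z j)) *
        (newtonMatrix z).transpose) a c) := by
  have h1 : (newtonMatrix z * (Matrix.of fun i j => f (z i - z j)) *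
      (newtonMatrix z).transpose) a c =
      ∑ j, ∑ i, newtonMatrix z a i * newtonMatrix z c j * f (z i - z j) := by
    simp only [Matrix.mul_apply, Matrix.transpose_apply, Finset.sum_mul, Matrix.of_apply]
    exact Finset.sum_congr rfl fun i _ => Finset.sum_congr rfl fun j _ => by ring
  have hH : ∀ (a : Fin m) (k : ℕ),
      divDiffPow (Finset.Iic a) z k = ∑ i, newtonMatrix z a i * z i ^ k := by
    intro a k
    unfold divDiffPow newtonMatrix
    simp only [Matrix.of_apply, ite_mul, zero_mul]
    rw [← Finset.sum_filter]
    congr 1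
    ext
    simp
  have h2 : ∀ k, b k * divDiffSubPow z a c k =
      ∑ j, ∑ i, newtonMatrix z a i * newtonMatrix z c j * (b k * (z i - z j) ^ k) := by
    intro k
    have h3 : ∀ i j, newtonMatrix z a i * newtonMatrix z c j * (b k * (z i - z j) ^ k) =
        ∑ l ∈ Finset.range (k + 1), b k * ((newtonMatrix z a i * z i ^ l) *
          ((-1) ^ (k - l) * (newtonMatrix z c j * z j ^ (k - l))) * (k.choose l : ℂ)) := by
      intro i j
      rw [sub_eq_add_neg, add_pow, Finset.mul_sum, Finset.mul_sum]
      refine Finset.sum_congr rfl fun l _ => ?_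
      rw [neg_pow (z j)]
      ring
    simp only [h3]
    unfold divDiffSubPow
    rw [Finset.mul_sum, Finset.sum_congr rfl fun j _ => Finset.sum_comm, Finset.sum_comm]
    refine Finset.sum_congr rfl fun l _ => ?_
    rw [hH, hH]
    simp only [Finset.mul_sum, Finset.sum_mul]
  rw [h1]
  simp only [h2]
  exact hasSum_sum fun j _ => hasSum_sum fun i _ => (hf i j).mul_left _

/-- As the nodes coalesce only the term of degree `a + c` survives, by dominated convergence. -/
theorem tendsto_tsum_divDiffSubPow {m : ℕ} {b : ℕ → ℂ} {R : ℝ} (hR : 0 < R)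
    (hb : Summable fun k => ‖b k‖ * R ^ k) (a c : Fin m) :
    Tendsto (fun z : Fin m → ℂ => ∑' k, b k * divDiffSubPow z a c k)
      (𝓝[{z : Fin m → ℂ | Function.Injective z}] 0)
      (𝓝 (b (a.1 + c.1) * ((-1) ^ c.1 * ((a.1 + c.1).choose a.1 : ℂ)))) := by
  set N := a.1 + c.1 with hN
  -- The radius `R / 4` absorbs the factor `4 ^ k` of `norm_divDiffSubPow_le`.
  set ε : ℝ := R / 4 with hε
  have hε0 : 0 < ε := by positivity
  have hlim : b N * ((-1) ^ c.1 * (N.choose a.1 : ℂ)) =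
      ∑' k : ℕ, if k = N then b N * ((-1) ^ c.1 * (N.choose a.1 : ℂ)) else 0 := by
    rw [tsum_ite_eq]
  have hinj : ∀ᶠ z in 𝓝[{z : Fin m → ℂ | Function.Injective z}] (0 : Fin m → ℂ),
      Function.Injective z :=
    self_mem_nhdsWithin
  have hsmall : ∀ᶠ z in 𝓝[{z : Fin m → ℂ | Function.Injective z}] (0 : Fin m → ℂ), ‖z‖ ≤ ε := by
    refine nhdsWithin_le_nhds ?_
    filter_upwards [Metric.ball_mem_nhds (0 : Fin m → ℂ) hε0] with z hz
    exact (mem_ball_zero_iff.1 hz).le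
  rw [hlim]
  refine tendsto_tsum_of_dominated_convergence (bound := fun k => ‖b k‖ * R ^ k * (ε ^ N)⁻¹)
    (hb.mul_right _) ?_ ?_
  · intro k
    by_cases hk : k = N
    · subst hk
      rw [if_pos rfl]
      refine tendsto_const_nhds.congr' ?_
      filter_upwards [hinj] with z hz
      rw [divDiffSubPow_of_eq hz]
    · rw [if_neg hk]
      rcases lt_or_gt_of_ne hk with h | h
      · refine tendsto_const_nhds.congr' ?_
        filter_upwards [hinj] with z hz
        rw [divDiffSubPow_of_lt hz _ _ h, mul_zero]
      · have h0 : Tendsto (fun z : Fin m → ℂ => ‖b k‖ * (4 ^ k * ‖z‖ ^ (k - N)))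
            (𝓝[{z : Fin m → ℂ | Function.Injective z}] 0) (𝓝 0) := by
          have : Continuous fun z : Fin m → ℂ => ‖b k‖ * (4 ^ k * ‖z‖ ^ (k - N)) := by fun_prop
          have h1 := this.tendsto 0
          simp only [norm_zero, zero_pow (show k - N ≠ 0 by omega), mul_zero] at h1
          exact h1.mono_left nhdsWithin_le_nhds
        refine squeeze_zero_norm' ?_ h0
        filter_upwards [hinj] with z hz
        rw [norm_mul]
        exact mul_le_mul_of_nonneg_left (norm_divDiffSubPow_le hz a c k) (norm_nonneg _)
  · filter_upwards [hinj, hsmall] with z hz hzε k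
    rcases lt_or_ge k N with h | h
    · rw [divDiffSubPow_of_lt hz _ _ h, mul_zero, norm_zero]
      positivity
    · rw [norm_mul, mul_assoc]
      refine mul_le_mul_of_nonneg_left ((norm_divDiffSubPow_le hz a c k).trans ?_) (norm_nonneg _)
      calc 4 ^ k * ‖z‖ ^ (k - N) ≤ 4 ^ k * ε ^ (k - N) := by gcongr
        _ = R ^ k * (ε ^ N)⁻¹ := by
          obtain ⟨d, rfl⟩ := Nat.exists_eq_add_of_le h
          rw [Nat.add_sub_cancel_left, show R = 4 * ε by rw [hε]; ring, mul_pow, pow_add ε]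
          field_simp

/-- If `f` is odd and analytic at `0`, then `pfaff (f (z i - z j)) / ∏ (z i - z j)` tends, as all
points coalesce at `0`, to the Hankel determinant of the odd derivatives of `f` at `0`, divided by
`∏ a!`. -/
theorem tendsto_pfaffian_div_vandermondeProd (n : ℕ) {f : ℂ → ℂ} {b : ℕ → ℂ} {R : ℝ} (hR : 0 < R)
    (hf : ∀ w, ‖w‖ < R → HasSum (fun k => b k * w ^ k) (f w)) (hb : ∀ k, b (2 * k) = 0) :
    Tendsto (fun z : Fin (2 * n) → ℂ =>
        pfaffian (Matrix.of fun i j => f (z i - z j)) / vandermondeProd z)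
      (𝓝[{z : Fin (2 * n) → ℂ | Function.Injective z}] 0)
      (𝓝 ((∏ a : Fin (2 * n), (a.1.factorial : ℂ))⁻¹ * (Matrix.of fun i j : Fin n =>
        ((2 * (i.1 + j.1) + 1).factorial : ℂ) * b (2 * (i.1 + j.1) + 1)).det)) := by
  set M : (Fin (2 * n) → ℂ) → Matrix (Fin (2 * n)) (Fin (2 * n)) ℂ := fun z =>
    newtonMatrix z * (Matrix.of fun i j => f (z i - z j)) * (newtonMatrix z).transpose with hM
  set M₀ : Matrix (Fin (2 * n)) (Fin (2 * n)) ℂ := Matrix.of fun a c =>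
    b (a.1 + c.1) * ((-1) ^ c.1 * ((a.1 + c.1).choose a.1 : ℂ)) with hM₀
  have hsmall : ∀ᶠ z in 𝓝[{z : Fin (2 * n) → ℂ | Function.Injective z}] 0,
      ∀ i j, ‖z i - z j‖ < R := by
    refine nhdsWithin_le_nhds ?_
    filter_upwards [Metric.ball_mem_nhds (0 : Fin (2 * n) → ℂ) (half_pos hR)] with z hz i j
    have hz' := mem_ball_zero_iff.1 hz
    have h1 := norm_le_pi_norm z i
    have h2 := norm_le_pi_norm z j
    linarith [norm_sub_le (z i) (z j)]
  have hMlim : Tendsto M (𝓝[{z : Fin (2 * n) → ℂ | Function.Injective z}] 0) (𝓝 M₀) := by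
    refine tendsto_pi_nhds.2 fun a => tendsto_pi_nhds.2 fun c => ?_
    have hs : Summable fun k => ‖b k‖ * (R / 2) ^ k := by
      have := (hf ((R / 2 : ℝ) : ℂ) (by
        rw [Complex.norm_real, Real.norm_eq_abs, abs_of_pos (half_pos hR)]
        linarith)).summable.norm
      simpa [abs_of_pos hR] using this
    refine (tendsto_tsum_divDiffSubPow (half_pos hR) hs a c).congr' ?_
    filter_upwards [hsmall] with z hz
    exact (hasSum_newtonMatrix_conj (fun i j => hf _ (hz i j)) a c).tsum_eq
  have hpf := ((continuous_pfaffian n).tendsto M₀).comp hMlim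
  have hval : pfaffian M₀ = (-1) ^ n * ((∏ a : Fin (2 * n), (a.1.factorial : ℂ))⁻¹ *
      (Matrix.of fun i j : Fin n =>
        ((2 * (i.1 + j.1) + 1).factorial : ℂ) * b (2 * (i.1 + j.1) + 1)).det) := by
    have h1 : M₀ = Matrix.diagonal (fun a : Fin (2 * n) => (a.1.factorial : ℂ)⁻¹) *
        (Matrix.of fun a c : Fin (2 * n) => (-1) ^ c.1 *
          (fun k => (k.factorial : ℂ) * b k) (a.1 + c.1)) *
        (Matrix.diagonal (fun a : Fin (2 * n) => (a.1.factorial : ℂ)⁻¹)).transpose := by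
      ext a c
      rw [Matrix.diagonal_transpose, Matrix.mul_diagonal, Matrix.diagonal_mul]
      simp only [hM₀, Matrix.of_apply]
      have ha : (a.1.factorial : ℂ) ≠ 0 := by exact_mod_cast a.1.factorial_ne_zero
      have hc : (c.1.factorial : ℂ) ≠ 0 := by exact_mod_cast c.1.factorial_ne_zero
      have hch : (((a.1 + c.1).choose a.1 : ℕ) : ℂ) * a.1.factorial * c.1.factorial =
          (a.1 + c.1).factorial := by
        rw [Nat.choose_symm_add]
        exact_mod_cast Nat.add_choose_mul_factorial_mul_factorial a.1 c.1
      rw [← hch]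
      field_simp
    rw [h1, pfaffian_conj, pfaffian_alternating_hankel n (fun k => (k.factorial : ℂ) * b k)
        (fun k => by simp [hb]),
      Matrix.det_diagonal, Finset.prod_inv_distrib]
    ring
  rw [hval] at hpf
  have hpf' := hpf.const_mul ((-1 : ℂ) ^ n)
  have hsq : ((-1 : ℂ) ^ n) * (-1) ^ n = 1 := by
    rw [← mul_pow]
    simp
  rw [← mul_assoc, hsq, one_mul] at hpf'
  refine hpf'.congr fun z => ?_
  simp only [Function.comp, hM]
  rw [pfaffian_conj, det_newtonMatrix, vandermondeProd_eq, div_eq_mul_inv, mul_inv]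
  have : ((-1 : ℂ) ^ n)⁻¹ = (-1) ^ n := inv_eq_of_mul_eq_one_left hsq
  rw [this]
  ring

/-! ### Infinite products -/

theorem qPoch_mul_prod {q : ℂ} (hq : ‖q‖ < 1) (a : ℂ) (N : ℕ) :
    qPoch a q = (∏ j ∈ Finset.range N, (1 - a * q ^ j)) * qPoch (a * q ^ N) q := by
  unfold qPoch
  have e : ∀ j : ℕ, 1 - a * q ^ N * q ^ j = 1 - a * q ^ (j + N) := fun j => by
    rw [pow_add]
    ring
  have h : Multipliable fun j : ℕ => 1 - a * q ^ (j + N) :=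
    (multipliable_qPoch (a * q ^ N) q hq).congr e
  rw [← Multipliable.prod_mul_tprod_nat_mul' (f := fun j => 1 - a * q ^ j) (k := N) h,
    tprod_congr e]

theorem qPoch_eq_mul {q : ℂ} (hq : ‖q‖ < 1) (a : ℂ) :
    qPoch a q = (1 - a) * qPoch (a * q) q := by
  simpa using qPoch_mul_prod hq a 1

theorem qPoch_ne_zero {a q : ℂ} (hq : ‖q‖ < 1) (ha : ∀ j : ℕ, a * q ^ j ≠ 1) :
    qPoch a q ≠ 0 := by
  unfold qPoch
  simp only [sub_eq_add_neg]
  refine tprod_one_add_ne_zero_of_summable (f := fun j : ℕ => -(a * q ^ j)) ?_ ?_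
  · intro j h
    exact ha j (by linear_combination -h)
  · simpa [norm_mul, norm_pow] using
      (summable_geometric_of_lt_one (norm_nonneg q) hq).mul_left ‖a‖

theorem qPoch_ne_zero_of_norm_lt {a q : ℂ} (hq : ‖q‖ < 1) (ha : ‖a‖ < 1) : qPoch a q ≠ 0 := by
  refine qPoch_ne_zero hq fun j h => ?_
  have h1 : ‖a * q ^ j‖ < 1 := by
    rw [norm_mul, norm_pow]
    exact mul_lt_one_of_nonneg_of_lt_one_left (norm_nonneg _) ha
      (pow_le_one₀ (norm_nonneg _) hq.le)
  rw [h, norm_one] at h1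
  exact lt_irrefl _ h1

theorem differentiable_qPoch {q : ℂ} (hq : ‖q‖ < 1) : Differentiable ℂ fun a => qPoch a q := by
  have h : MultipliableLocallyUniformlyOn (fun (n : ℕ) (a : ℂ) => 1 - a * q ^ n) Set.univ := by
    use fun a => ∏' n : ℕ, (1 - a * q ^ n)
    simp_rw [sub_eq_add_neg]
    apply hasProdLocallyUniformlyOn_of_forall_compact isOpen_univ
    intro K _ hcK
    obtain ⟨r, hr⟩ := hcK.isBounded.exists_norm_le
    refine ((summable_geometric_of_lt_one (norm_nonneg q)
      hq).mul_left r).hasProdUniformlyOn_nat_one_add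
      hcK (.of_forall fun n x hx ↦ ?_) (fun _ ↦ by fun_prop)
    rw [norm_neg, norm_mul, norm_pow]
    exact mul_le_mul_of_nonneg_right (hr x hx) (by positivity)
  rw [← differentiableOn_univ]
  exact h.hasProdLocallyUniformlyOn.differentiableOn
    (.of_forall fun _ ↦ by simpa [Finset.prod_fn] using
      DifferentiableOn.finsetProd (fun _ _ ↦ by fun_prop)) isOpen_univ

/-- Splitting the factors of `(a; q)_∞` according to the residue of the exponent modulo `m`. -/
theorem qPoch_dissect {q : ℂ} (hq : ‖q‖ < 1) (a : ℂ) (m : ℕ) [NeZero m] :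
    qPoch a q = ∏ i : Fin m, qPoch (a * q ^ i.1) (q ^ m) := by
  have hqm : ‖q ^ m‖ < 1 := by
    rw [norm_pow]
    exact pow_lt_one₀ (norm_nonneg _) hq (NeZero.ne m)
  have h1 := multipliable_qPoch a q hq
  have h2 : HasProd (fun p : ℕ × Fin m => 1 - a * q ^ p.2.1 * (q ^ m) ^ p.1) (qPoch a q) := by
    rw [← (Nat.divModEquiv m).hasProd_iff]
    convert! h1.hasProd using 2 with n
    simp only [Function.comp, Nat.divModEquiv_apply, Fin.val_ofNat, mul_assoc, ← pow_mul, ← pow_add]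
    rw [Nat.mod_add_div]
  have h3 : HasProd (fun k : ℕ => ∏ i : Fin m, (1 - a * q ^ i.1 * (q ^ m) ^ k)) (qPoch a q) :=
    h2.prod_fiberwise fun k => hasProd_fintype _
  have h4 : HasProd (fun k : ℕ => ∏ i : Fin m, (1 - a * q ^ i.1 * (q ^ m) ^ k))
      (∏ i : Fin m, qPoch (a * q ^ i.1) (q ^ m)) :=
    hasProd_prod fun i _ => (multipliable_qPoch (a * q ^ i.1) (q ^ m) hqm).hasProd
  exact h3.unique h4

theorem qPoch_dissect_two {q : ℂ} (hq : ‖q‖ < 1) (a : ℂ) :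
    qPoch a q = qPoch a (q ^ 2) * qPoch (a * q) (q ^ 2) := by
  simpa [Fin.prod_univ_two] using qPoch_dissect hq a 2

theorem qPoch_dissect_three {q : ℂ} (hq : ‖q‖ < 1) (a : ℂ) :
    qPoch a q = qPoch a (q ^ 3) * qPoch (a * q) (q ^ 3) * qPoch (a * q ^ 2) (q ^ 3) := by
  simpa [Fin.prod_univ_three] using qPoch_dissect hq a 3

theorem qPoch_mul_neg {q : ℂ} (hq : ‖q‖ < 1) (a : ℂ) :
    qPoch a q * qPoch (-a) q = qPoch (a ^ 2) (q ^ 2) := by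
  unfold qPoch
  rw [← (multipliable_qPoch a q hq).tprod_mul (multipliable_qPoch (-a) q hq)]
  exact tprod_congr fun j => by ring

theorem qPoch_mul_cube_roots {q ω : ℂ} (hq : ‖q‖ < 1) (hω : 1 + ω + ω ^ 2 = 0) (a : ℂ) :
    qPoch a q * (qPoch (ω * a) q * qPoch (ω ^ 2 * a) q) = qPoch (a ^ 3) (q ^ 3) := by
  unfold qPoch
  rw [← (multipliable_qPoch (ω * a) q hq).tprod_mul (multipliable_qPoch (ω ^ 2 * a) q hq),
    ← (multipliable_qPoch a q hq).tprod_mul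
      ((multipliable_qPoch (ω * a) q hq).mul (multipliable_qPoch (ω ^ 2 * a) q hq))]
  refine tprod_congr fun j => ?_
  have h3 : ω ^ 3 = 1 := by linear_combination (ω - 1) * hω
  have h4 : ω ^ 2 = -1 - ω := by linear_combination hω
  have : (q ^ 3) ^ j = (q ^ j) ^ 3 := by rw [← pow_mul, ← pow_mul, mul_comm]
  rw [this]
  linear_combination (-(a * q ^ j) + (a * q ^ j) ^ 2 * ω) * hω +
    (- (a * q ^ j) ^ 3) * h3

/-! ### Laurent series -/

/-- The product of two Laurent series as a double series, indexed by the exponent of the product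
and that of the second factor. -/
theorem hasSum_laurent_mul_aux {a b : ℤ → ℂ} {x F G : ℂ} (hx : x ≠ 0)
    (ha : HasSum (fun k : ℤ => a k * x ^ k) F) (hb : HasSum (fun k : ℤ => b k * x ^ k) G) :
    HasSum (fun p : ℤ × ℤ => (a (p.1 - p.2) * b p.2) * x ^ p.1) (F * G) := by
  have hs := summable_mul_of_summable_norm (f := fun k : ℤ => a k * x ^ k)
    (g := fun k : ℤ => b k * x ^ k) ha.summable.norm hb.summable.norm
  have h1 := HasSum.mul (f := fun k : ℤ => a k * x ^ k) (g := fun k : ℤ => b k * x ^ k) ha hb hs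
  let e : ℤ × ℤ ≃ ℤ × ℤ :=
    { toFun := fun p => (p.1 - p.2, p.2)
      invFun := fun p => (p.1 + p.2, p.2)
      left_inv := fun p => by simp
      right_inv := fun p => by simp }
  refine (e.hasSum_iff.2 h1).congr_fun fun p => ?_
  show (a (p.1 - p.2) * b p.2) * x ^ p.1 = (a (p.1 - p.2) * x ^ (p.1 - p.2)) * (b p.2 * x ^ p.2)
  have : x ^ p.1 = x ^ (p.1 - p.2) * x ^ p.2 := by
    rw [← zpow_add₀ hx, sub_add_cancel]
  rw [this]
  ring

/-- The product of two absolutely convergent Laurent series is the Laurent series whose coefficients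
are given by convolution. -/
theorem hasSum_laurent_mul {a b : ℤ → ℂ} {x F G : ℂ} (hx : x ≠ 0)
    (ha : HasSum (fun k : ℤ => a k * x ^ k) F) (hb : HasSum (fun k : ℤ => b k * x ^ k) G) :
    (∀ m : ℤ, Summable fun k : ℤ => a (m - k) * b k) ∧
      HasSum (fun m : ℤ => (∑' k : ℤ, a (m - k) * b k) * x ^ m) (F * G) := by
  have h2 := hasSum_laurent_mul_aux hx ha hb
  have h3 : ∀ m : ℤ, Summable fun k : ℤ => a (m - k) * b k := by
    intro m
    have h4 : Summable fun k : ℤ => a (m - k) * b k * x ^ m := h2.summable.prod_factor m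
    exact (summable_mul_right_iff (zpow_ne_zero m hx)).1 h4
  have h5 : ∀ m : ℤ, HasSum (fun k : ℤ => a (m - k) * b k * x ^ m)
      ((∑' k : ℤ, a (m - k) * b k) * x ^ m) := fun m => (h3 m).hasSum.mul_right _
  exact ⟨h3, h2.prod_fiberwise h5⟩

/-! ### The series of the theta function -/

/-- The coefficients of Euler's expansion of `(x; q)_∞`, extended by zero to negative indices. -/
noncomputable def eulerCoeff (q : ℂ) : ℤ → ℂ
  | Int.ofNat n => ∏ j ∈ Finset.range n, (-q ^ j / (1 - q ^ (j + 1)))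
  | Int.negSucc _ => 0

section Theta

variable {q : ℂ}

theorem one_sub_pow_succ_ne_zero (hq : ‖q‖ < 1) (n : ℕ) : 1 - q ^ (n + 1) ≠ 0 := by
  intro h
  have h1 : ‖q ^ (n + 1)‖ < 1 := by
    rw [norm_pow]
    exact pow_lt_one₀ (norm_nonneg _) hq (Nat.succ_ne_zero n)
  rw [← sub_eq_zero.1 h, norm_one] at h1
  exact lt_irrefl _ h1

/-- The functional equation `(x; q)_∞ = (1 - x) (q x; q)_∞` in terms of coefficients. -/
theorem eulerCoeff_rec (hq0 : q ≠ 0) (hq : ‖q‖ < 1) (n : ℤ) :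
    (1 - q ^ (n + 1)) * eulerCoeff q (n + 1) = -q ^ n * eulerCoeff q n := by
  match n with
  | Int.ofNat n =>
    have h := one_sub_pow_succ_ne_zero hq n
    have e : (Int.ofNat n + 1 : ℤ) = Int.ofNat (n + 1) := rfl
    rw [e]
    simp only [eulerCoeff, Finset.prod_range_succ]
    simp only [Int.ofNat_eq_natCast, zpow_natCast]
    field_simp
  | Int.negSucc 0 =>
    have e : (Int.negSucc 0 + 1 : ℤ) = 0 := rfl
    rw [e]
    simp [eulerCoeff]
  | Int.negSucc (n + 1) =>
    have e : (Int.negSucc (n + 1) + 1 : ℤ) = Int.negSucc n := rfl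
    rw [e]
    simp [eulerCoeff]

theorem summable_eulerCoeff (hq0 : q ≠ 0) (hq : ‖q‖ < 1) (x : ℂ) :
    Summable fun n : ℕ => eulerCoeff q n * x ^ n := by
  by_cases hx : x = 0
  · refine summable_of_ne_finset_zero (s := {0}) fun n hn => ?_
    rw [hx, zero_pow (by simpa using hn), mul_zero]
  have hne : ∀ n : ℕ, eulerCoeff q n ≠ 0 := by
    intro n
    show (∏ j ∈ Finset.range n, (-q ^ j / (1 - q ^ (j + 1)))) ≠ 0
    exact Finset.prod_ne_zero_iff.2 fun j _ =>
      div_ne_zero (neg_ne_zero.2 (pow_ne_zero _ hq0)) (one_sub_pow_succ_ne_zero hq j)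
  refine summable_of_ratio_test_tendsto_lt_one (l := 0) one_pos
    (.of_forall fun n => mul_ne_zero (hne n) (pow_ne_zero _ hx)) ?_
  have h1 : ∀ n : ℕ, ‖eulerCoeff q (n + 1 : ℕ) * x ^ (n + 1)‖ / ‖eulerCoeff q n * x ^ n‖ =
      ‖q ^ n‖ / ‖1 - q ^ (n + 1)‖ * ‖x‖ := by
    intro n
    have h := one_sub_pow_succ_ne_zero hq n
    have hr := eulerCoeff_rec hq0 hq n
    have e : eulerCoeff q (n + 1 : ℕ) = -q ^ n / (1 - q ^ (n + 1)) * eulerCoeff q n := by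
      push_cast
      rw [div_mul_eq_mul_div, eq_div_iff h]
      rw [show (n : ℤ) + 1 = ((n + 1 : ℕ) : ℤ) by push_cast; rfl, zpow_natCast, zpow_natCast] at hr
      rw [← hr]
      push_cast
      ring
    rw [e, ← norm_div]
    have hnn := hne n
    rw [show -q ^ n / (1 - q ^ (n + 1)) * eulerCoeff q n * x ^ (n + 1) / (eulerCoeff q n * x ^ n) =
      -(q ^ n / (1 - q ^ (n + 1)) * x) by
        rw [div_mul_eq_mul_div, div_mul_eq_mul_div, div_div, div_mul_eq_mul_div, ← neg_div,
          div_eq_div_iff (mul_ne_zero h (mul_ne_zero hnn (pow_ne_zero _ hx))) h]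
        ring]
    rw [norm_neg, norm_mul, norm_div]
  simp only [h1]
  have hp : Tendsto (fun n : ℕ => q ^ n) atTop (𝓝 0) :=
    tendsto_pow_atTop_nhds_zero_of_norm_lt_one hq
  have hp' : Tendsto (fun n : ℕ => q ^ (n + 1)) atTop (𝓝 0) := hp.comp (tendsto_add_atTop_nat 1)
  have h2 : Tendsto (fun n : ℕ => ‖q ^ n‖ / ‖1 - q ^ (n + 1)‖ * ‖x‖) atTop
      (𝓝 (‖(0 : ℂ)‖ / ‖1 - (0 : ℂ)‖ * ‖x‖)) :=
    ((hp.norm.div (hp'.const_sub 1).norm (by simp)).mul_const _)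
  simpa using h2

/-- Euler's expansion `(x; q)_∞ = ∑ e_n x ^ n`. Both sides satisfy `G x = (1 - x) G (q x)`. -/
theorem hasSum_qPoch (hq0 : q ≠ 0) (hq : ‖q‖ < 1) (x : ℂ) :
    HasSum (fun n : ℕ => eulerCoeff q n * x ^ n) (qPoch x q) := by
  set G : ℂ → ℂ := fun x => ∑' n : ℕ, eulerCoeff q n * x ^ n with hG
  have hs := summable_eulerCoeff hq0 hq
  have hrec : ∀ x, G x = (1 - x) * G (x * q) := by
    intro x
    have e1 : G x = eulerCoeff q (0 : ℕ) + ∑' n : ℕ, eulerCoeff q (n + 1 : ℕ) * x ^ (n + 1) := by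
      simp only [hG]
      rw [(hs x).tsum_eq_zero_add]
      simp
    have e2 : G (x * q) =
        eulerCoeff q (0 : ℕ) + ∑' n : ℕ, eulerCoeff q (n + 1 : ℕ) * (x * q) ^ (n + 1) := by
      simp only [hG]
      rw [(hs (x * q)).tsum_eq_zero_add]
      simp
    have e3 : x * G (x * q) = ∑' n : ℕ, x * (eulerCoeff q n * (x * q) ^ n) := by
      rw [tsum_mul_left]
    have e4 : ∑' n : ℕ, eulerCoeff q (n + 1 : ℕ) * x ^ (n + 1) =
        ∑' n : ℕ, eulerCoeff q (n + 1 : ℕ) * (x * q) ^ (n + 1) -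
          ∑' n : ℕ, x * (eulerCoeff q n * (x * q) ^ n) := by
      rw [← (((summable_nat_add_iff 1).2 (hs (x * q)))).tsum_sub ((hs (x * q)).mul_left x)]
      refine tsum_congr fun n => ?_
      have hr := eulerCoeff_rec hq0 hq n
      rw [show (n : ℤ) + 1 = ((n + 1 : ℕ) : ℤ) by push_cast; rfl, zpow_natCast, zpow_natCast] at hr
      rw [mul_pow, mul_pow]
      linear_combination x ^ (n + 1) * hr
    rw [sub_mul, one_mul, e3, e2, e1, e4]
    ring
  have hiter : ∀ N : ℕ, G x = (∏ j ∈ Finset.range N, (1 - x * q ^ j)) * G (x * q ^ N) := by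
    intro N
    induction N with
    | zero => simp
    | succ N ih =>
      rw [ih, hrec (x * q ^ N), Finset.prod_range_succ, pow_succ]
      ring_nf
  have hlim : Tendsto (fun N : ℕ => G (x * q ^ N)) atTop (𝓝 1) := by
    have h0 : (1 : ℂ) = ∑' n : ℕ, if n = 0 then (1 : ℂ) else 0 := by rw [tsum_ite_eq]
    rw [h0]
    refine tendsto_tsum_of_dominated_convergence (bound := fun n => ‖eulerCoeff q n * x ^ n‖)
      (hs x).norm ?_ ?_
    · intro n
      by_cases hn : n = 0
      · subst hn
        simp [eulerCoeff]
      · rw [if_neg hn]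
        have hp : Tendsto (fun N : ℕ => q ^ N) atTop (𝓝 0) :=
          tendsto_pow_atTop_nhds_zero_of_norm_lt_one hq
        have := ((hp.const_mul x).pow n).const_mul (eulerCoeff q n)
        simpa [zero_pow hn] using this
    · refine .of_forall fun N n => ?_
      rw [mul_pow, ← mul_assoc, norm_mul]
      refine mul_le_of_le_one_right (norm_nonneg _) ?_
      rw [norm_pow, norm_pow]
      exact pow_le_one₀ (by positivity) (pow_le_one₀ (norm_nonneg _) hq.le)
  have hprod : Tendsto (fun N : ℕ => ∏ j ∈ Finset.range N, (1 - x * q ^ j)) atTop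
      (𝓝 (qPoch x q)) := (multipliable_qPoch x q hq).hasProd.tendsto_prod_nat
  have h := hprod.mul hlim
  rw [mul_one] at h
  have hGx : G x = qPoch x q := by
    refine tendsto_nhds_unique ?_ h
    exact tendsto_const_nhds.congr hiter
  rw [← hGx]
  exact (hs x).hasSum

theorem hasSum_int_qPoch (hq0 : q ≠ 0) (hq : ‖q‖ < 1) (x : ℂ) :
    HasSum (fun k : ℤ => eulerCoeff q k * x ^ k) (qPoch x q) := by
  have hinj : Function.Injective (Nat.cast : ℕ → ℤ) := Nat.cast_injective
  rw [← hinj.hasSum_iff]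
  · simpa [Function.comp_def] using hasSum_qPoch hq0 hq x
  · intro k hk
    match k with
    | Int.ofNat n => exact absurd ⟨n, rfl⟩ hk
    | Int.negSucc n => simp [eulerCoeff]

/-- The Laurent expansion of the theta function, up to a constant factor, which plays no role in
the sequel. -/
theorem exists_hasSum_qTheta {h : ℂ} (h0 : h ≠ 0) (h1 : ‖h‖ < 1) : ∃ K : ℂ, ∀ x : ℂ, x ≠ 0 →
    HasSum (fun k : ℤ => K * ((-1) ^ k * h ^ (k * (k - 1))) * x ^ k) (qTheta x (h ^ 2)) := by
  set q := h ^ 2 with hqdef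
  have hq0 : q ≠ 0 := pow_ne_zero _ h0
  have hq : ‖q‖ < 1 := by
    rw [hqdef, norm_pow]
    exact pow_lt_one₀ (norm_nonneg _) h1 two_ne_zero
  have hb : ∀ y x : ℂ, x ≠ 0 →
      HasSum (fun k : ℤ => (eulerCoeff q (-k) * y ^ (-k)) * x ^ k) (qPoch (y / x) q) := by
    intro y x hx
    refine ((Equiv.neg ℤ).hasSum_iff.2 (hasSum_int_qPoch hq0 hq (y / x))).congr_fun fun k => ?_
    show eulerCoeff q (-k) * y ^ (-k) * x ^ k = eulerCoeff q (-k) * (y / x) ^ (-k)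
    rw [div_zpow, zpow_neg x, div_inv_eq_mul, mul_assoc]
  set c : ℤ → ℂ := fun m => ∑' k : ℤ, eulerCoeff q (m - k) * (eulerCoeff q (-k) * q ^ (-k)) with hc
  have hprod := fun (y x : ℂ) (hx : x ≠ 0) =>
    hasSum_laurent_mul hx (hasSum_int_qPoch hq0 hq x) (hb y x hx)
  have hsum : ∀ (y : ℂ) (m : ℤ),
      Summable fun l : ℤ => eulerCoeff q (m + l) * (eulerCoeff q l * y ^ l) := by
    intro y m
    have := (hprod y 1 one_ne_zero).1 m
    rw [← (Equiv.neg ℤ).summable_iff] at this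
    simpa [Function.comp_def] using this
  have hcl : ∀ m : ℤ, c m = ∑' l : ℤ, eulerCoeff q (m + l) * (eulerCoeff q l * q ^ l) := by
    intro m
    simp only [hc]
    rw [← (Equiv.neg ℤ).tsum_eq]
    simp
  -- By the recursion for `eulerCoeff`, the terms of `c (m + 1) + q ^ m * c m` are differences
  -- `v (l + 1) - v l`.
  have hrec : ∀ m : ℤ, c (m + 1) = -q ^ m * c m := by
    intro m
    set v : ℤ → ℂ := fun l => q ^ m * (eulerCoeff q (m + l) * (eulerCoeff q l * (q ^ 2) ^ l)) -
      q ^ m * (eulerCoeff q (m + l) * (eulerCoeff q l * q ^ l)) with hv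
    have hvs : Summable v := ((hsum (q ^ 2) m).mul_left _).sub ((hsum q m).mul_left _)
    have hterm : ∀ l : ℤ, eulerCoeff q (m + 1 + l) * (eulerCoeff q l * q ^ l) =
        -q ^ m * (eulerCoeff q (m + l) * (eulerCoeff q l * q ^ l)) + (v (l + 1) - v l) := by
      intro l
      have r1 := eulerCoeff_rec hq0 hq (m + l)
      have r2 := eulerCoeff_rec hq0 hq l
      simp only [hv]
      rw [show m + (l + 1) = m + l + 1 by ring, show m + 1 + l = m + l + 1 by ring]
      simp only [zpow_add₀ hq0, zpow_add₀ (pow_ne_zero 2 hq0), zpow_one] at r1 r2 ⊢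
      have e2 : (q ^ 2) ^ l = (q ^ l) ^ 2 := by
        rw [← zpow_natCast, ← zpow_natCast, ← zpow_mul, ← zpow_mul, mul_comm]
      rw [e2]
      linear_combination (eulerCoeff q l * q ^ l) * r1 +
        (q ^ m * q ^ l * q * eulerCoeff q (m + l + 1)) * r2
    have hshift : ∑' l : ℤ, v (l + 1) = ∑' l : ℤ, v l := (Equiv.addRight (1 : ℤ)).tsum_eq v
    have hvs' : Summable fun l : ℤ => v (l + 1) := (Equiv.addRight (1 : ℤ)).summable_iff.2 hvs
    rw [hcl, hcl, tsum_congr hterm, ((hsum q m).mul_left _).tsum_add (hvs'.sub hvs),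
      hvs'.tsum_sub hvs, hshift, sub_self, add_zero, tsum_mul_left]
  have hcform : ∀ m : ℤ, c m = c 0 * ((-1) ^ m * h ^ (m * (m - 1))) := by
    intro m
    induction m using Int.induction_on with
    | zero => simp
    | succ n ih =>
      rw [hrec, ih, hqdef, zpow_add₀ (by norm_num : (-1 : ℂ) ≠ 0), zpow_one, ← zpow_natCast h 2,
        ← zpow_mul, show ((n : ℤ) + 1) * (n + 1 - 1) = 2 * n + n * (n - 1) by ring,
        zpow_add₀ h0 (2 * n)]
      push_cast
      ring
    | pred n ih =>
      have h2 := hrec (-n - 1)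
      rw [sub_add_cancel, ih] at h2
      have hne : q ^ (-(n : ℤ) - 1) ≠ 0 := zpow_ne_zero _ hq0
      have h3 : c (-n - 1) = -(q ^ (-(n : ℤ) - 1))⁻¹ *
          (c 0 * ((-1) ^ (-(n : ℤ)) * h ^ (-(n : ℤ) * (-n - 1)))) := by
        rw [h2]
        field_simp
      rw [h3, hqdef, ← zpow_natCast h 2, ← zpow_mul, ← zpow_neg,
        show (-(n : ℤ) - 1) * (-n - 1 - 1) = -((2 : ℕ) * (-n - 1)) + -n * (-n - 1) by
          push_cast
          ring,
        zpow_add₀ h0, zpow_sub₀ (by norm_num : (-1 : ℂ) ≠ 0)]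
      simp only [zpow_one]
      ring
  refine ⟨c 0, fun x hx => ?_⟩
  have h := (hprod q x hx).2
  simp only [← hcform]
  exact h

end Theta

/-! ### Odd theta functions of degree three -/

/-- Laurent coefficients of an odd theta function of degree three with respect to `x ↦ g ^ 6 x`:
a function `F` with `F (g ^ 6 x) = g ^ (3 e - 9) x ^ (-3) F x` and `F x⁻¹ = -x ^ (-e) F x`. -/
structure IsOddTheta (g : ℂ) (e : ℤ) (c : ℤ → ℂ) : Prop where
  shift : ∀ m, c (m + 3) = g ^ (6 * m + 9 - 3 * e) * c m
  refl : ∀ m, c (e - m) = -c m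

/-- The shift reduces the coefficients to three residue classes modulo `3`, and the reflection
`m ↦ e - m` makes two of the three initial values multiples of `c 1`. -/
theorem IsOddTheta.eq_zero {g : ℂ} (hg : g ≠ 0) {e : ℤ} (he : e = 0 ∨ e = 1) {c : ℤ → ℂ}
    (hc : IsOddTheta g e c) (h1 : c 1 = 0) (m : ℤ) : c m = 0 := by
  have hup : ∀ m, c m = 0 → c (m + 3) = 0 := fun m h => by rw [hc.shift, h, mul_zero]
  have hdown : ∀ m, c (m + 3) = 0 → c m = 0 := fun m h => by
    rw [hc.shift] at h
    exact (mul_eq_zero.1 h).resolve_left (zpow_ne_zero _ hg)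
  have h02 : c 0 = 0 ∧ c 2 = 0 := by
    rcases he with rfl | rfl
    · have r0 := hc.refl 0
      have r1 := hc.refl 1
      have e0 : c 0 = 0 := by
        simp only [sub_zero] at r0
        linear_combination r0 / 2
      have s2 := hc.shift (-1)
      norm_num at r1 s2
      exact ⟨e0, by rw [s2, r1, h1, neg_zero, mul_zero]⟩
    · have r0 := hc.refl 1
      have r2 := hc.refl 2
      have s := hc.shift (-1)
      norm_num at r0 r2 s
      refine ⟨by rw [r0, h1, neg_zero], ?_⟩
      rw [r2] at s
      linear_combination s / 2
  have h3 : ∀ n : ℤ, c (3 * n) = 0 ∧ c (3 * n + 1) = 0 ∧ c (3 * n + 2) = 0 := by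
    intro n
    induction n using Int.induction_on with
    | zero => exact ⟨h02.1, h1, h02.2⟩
    | succ n ih =>
      obtain ⟨i0, i1, i2⟩ := ih
      refine ⟨?_, ?_, ?_⟩
      · rw [show (3 * (n + 1) : ℤ) = 3 * n + 3 by ring]
        exact hup _ i0
      · rw [show (3 * (n + 1) + 1 : ℤ) = 3 * n + 1 + 3 by ring]
        exact hup _ i1
      · rw [show (3 * (n + 1) + 2 : ℤ) = 3 * n + 2 + 3 by ring]
        exact hup _ i2
    | pred n ih =>
      obtain ⟨i0, i1, i2⟩ := ih
      refine ⟨hdown _ ?_, hdown _ ?_, hdown _ ?_⟩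
      · rw [show (3 * (-n - 1) + 3 : ℤ) = 3 * -n by ring]
        exact i0
      · rw [show (3 * (-n - 1) + 1 + 3 : ℤ) = 3 * -n + 1 by ring]
        exact i1
      · rw [show (3 * (-n - 1) + 2 + 3 : ℤ) = 3 * -n + 2 by ring]
        exact i2
  obtain ⟨n, hn⟩ : ∃ n : ℤ, m = 3 * n ∨ m = 3 * n + 1 ∨ m = 3 * n + 2 := ⟨m / 3, by omega⟩
  rcases hn with rfl | rfl | rfl
  · exact (h3 n).1
  · exact (h3 n).2.1
  · exact (h3 n).2.2

/-- Odd theta functions of degree three form a space of dimension at most one. -/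
theorem IsOddTheta.proportional {g : ℂ} (hg : g ≠ 0) {e : ℤ} (he : e = 0 ∨ e = 1) {c a : ℤ → ℂ}
    (hc : IsOddTheta g e c) (ha : IsOddTheta g e a) (m : ℤ) : a 1 * c m = c 1 * a m := by
  have h : IsOddTheta g e fun m => a 1 * c m - c 1 * a m :=
    ⟨fun m => by
      rw [hc.shift, ha.shift]
      ring, fun m => by
      rw [hc.refl, ha.refl]
      ring⟩
  exact sub_eq_zero.1 (h.eq_zero hg he (by ring) m)

theorem hasSum_comp_sub_left {f : ℤ → ℂ} {F : ℂ} (m : ℤ) (h : HasSum f F) :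
    HasSum (fun k => f (m - k)) F :=
  (Equiv.subLeft m).hasSum_iff.2 h

/-- The product of two theta series, of degrees two and one in `x`. -/
theorem isOddTheta_conv_num {g : ℂ} (hg : g ≠ 0) {e : ℤ} {u t : ℤ → ℂ} {α β : ℂ}
    (hu : ∀ k, u (k + 2) = -g ^ (6 * k + 6) * u k) (hur : ∀ k, u (-k) = α * u k)
    (ht : ∀ k, t (k + 1) = -g ^ (6 * k + 3 - 3 * e) * t k) (htr : ∀ k, t (e - k) = β * t k)
    (hαβ : α * β = -1) : IsOddTheta g e fun m => ∑' k : ℤ, u (m - k) * t k := by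
  refine ⟨fun m => ?_, fun m => ?_⟩
  · rw [← tsum_mul_left, ← (Equiv.addRight (1 : ℤ)).tsum_eq]
    refine tsum_congr fun k => ?_
    simp only [Equiv.coe_addRight]
    rw [show m + 3 - (k + 1) = m - k + 2 by ring, hu, ht,
      show 6 * m + 9 - 3 * e = (6 * (m - k) + 6) + (6 * k + 3 - 3 * e) by ring,
      zpow_add₀ hg (6 * (m - k) + 6)]
    ring
  · rw [← tsum_neg, ← (Equiv.subLeft e).tsum_eq]
    refine tsum_congr fun k => ?_
    simp only [Equiv.subLeft_apply]
    rw [show e - m - (e - k) = -(m - k) by ring, hur, htr]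
    linear_combination (u (m - k) * t k) * hαβ

/-- The product of a theta series `d` of degree three and a series `s` whose coefficients satisfy,
up to series annihilated by `d`, a first order recursion and a reflection. -/
theorem isOddTheta_conv_den {g : ℂ} (hg : g ≠ 0) {δ ε : ℤ} {u : ℂ} {d s n n' : ℤ → ℂ}
    (hd : ∀ k, d (k + 3) = u * g ^ (6 * k + 9 + 3 * δ) * d k) (hdr : ∀ k, d (-δ - k) = d k)
    (hs : ∀ k, s k = g ^ (6 * k - 3 * ε) * (u * s k + n k)) (hsr : ∀ k, s (ε - k) = -s k + n' k)
    (hu : u * u = 1)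
    (hsum : ∀ m, Summable fun k : ℤ => d (m - k) * s k)
    (hn : ∀ m, HasSum (fun k : ℤ => d (m - k) * n k) 0)
    (hn' : ∀ m, HasSum (fun k : ℤ => d (m - k) * n' k) 0) :
    IsOddTheta g (ε - δ) fun m => ∑' k : ℤ, d (m - k) * s k := by
  refine ⟨fun m => ?_, fun m => ?_⟩
  · have h1 : ∀ k, d (m + 3 - k) * s k = g ^ (6 * m + 9 - 3 * (ε - δ)) * (d (m - k) * s k) +
        u * g ^ (6 * m + 9 - 3 * (ε - δ)) * (d (m - k) * n k) := by
      intro k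
      rw [show m + 3 - k = m - k + 3 by ring, hd,
        show 6 * m + 9 - 3 * (ε - δ) = (6 * (m - k) + 9 + 3 * δ) + (6 * k - 3 * ε) by ring,
        zpow_add₀ hg (6 * (m - k) + 9 + 3 * δ)]
      linear_combination (u * g ^ (6 * (m - k) + 9 + 3 * δ) * d (m - k)) * hs k +
        (g ^ (6 * (m - k) + 9 + 3 * δ) * d (m - k) * g ^ (6 * k - 3 * ε) * s k) * hu
    rw [tsum_congr h1, ((hsum m).mul_left _).tsum_add ((hn m).summable.mul_left _), tsum_mul_left,
      tsum_mul_left, (hn m).tsum_eq, mul_zero, add_zero]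
  · rw [← (Equiv.subLeft ε).tsum_eq]
    have h1 : ∀ k, d (ε - δ - m - (ε - k)) * s (ε - k) = -(d (m - k) * s k) + d (m - k) * n' k := by
      intro k
      rw [hsr, show ε - δ - m - (ε - k) = -δ - (m - k) by ring, hdr]
      ring
    simp only [Equiv.subLeft_apply]
    rw [tsum_congr h1, (hsum m).neg.tsum_add (hn' m).summable, (hn' m).tsum_eq, tsum_neg, add_zero]

/-- The Laurent series `∑ d_k x ^ k` vanishes at `x = ρ⁻¹` if its terms cancel in pairs there. -/
theorem hasSum_annihilated {d : ℤ → ℂ} {ρ : ℂ} (hρ : ρ ≠ 0)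
    (hd : Summable fun k : ℤ => d k * ρ⁻¹ ^ k) (μ : ℤ)
    (h : ∀ k, d (μ - k) * ρ ^ (2 * k - μ) = -d k) (m : ℤ) :
    HasSum (fun k : ℤ => d (m - k) * ρ ^ k) 0 := by
  have h0 : ∑' k : ℤ, d k * ρ⁻¹ ^ k = 0 := by
    have h1 : ∑' k : ℤ, d k * ρ⁻¹ ^ k = -∑' k : ℤ, d k * ρ⁻¹ ^ k := by
      conv_lhs => rw [← (Equiv.subLeft μ).tsum_eq]
      rw [← tsum_neg]
      refine tsum_congr fun k => ?_
      simp only [Equiv.subLeft_apply]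
      rw [← neg_mul, ← h k, inv_zpow', inv_zpow', mul_assoc, ← zpow_add₀ hρ]
      congr 2
      ring
    linear_combination h1 / 2
  have h2 := (hasSum_comp_sub_left m hd.hasSum).mul_right (ρ ^ m)
  rw [h0, zero_mul] at h2
  refine h2.congr_fun fun k => ?_
  rw [inv_zpow', mul_assoc, ← zpow_add₀ hρ]
  congr 2
  ring

/-- Substituting `y x ^ c` for the variable of a Laurent series. -/
theorem hasSum_laurent_dilate {a : ℤ → ℂ} {x y F : ℂ} {c : ℤ} (hc : c ≠ 0)
    (h : HasSum (fun k : ℤ => a k * (y * x ^ c) ^ k) F) :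
    HasSum (fun k : ℤ => (if c ∣ k then a (k / c) * y ^ (k / c) else 0) * x ^ k) F := by
  have hinj : Function.Injective fun k : ℤ => c * k := fun k l h => mul_left_cancel₀ hc h
  rw [← hinj.hasSum_iff]
  · refine h.congr_fun fun k => ?_
    simp only [Function.comp, dvd_mul_right, if_true, Int.mul_ediv_cancel_left _ hc]
    rw [mul_zpow, zpow_mul, mul_assoc]
  · intro k hk
    have : ¬ c ∣ k := fun ⟨l, hl⟩ => hk ⟨l, hl.symm⟩
    simp [this]

theorem hasSum_laurent_mul_zpow {a : ℤ → ℂ} {x F : ℂ} (hx : x ≠ 0) (j : ℤ)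
    (h : HasSum (fun k : ℤ => a k * x ^ k) F) :
    HasSum (fun k : ℤ => a (k + j) * x ^ k) (x ^ (-j) * F) := by
  refine (((Equiv.addRight j).hasSum_iff.2 h).mul_left (x ^ (-j))).congr_fun fun k => ?_
  simp only [Function.comp, Equiv.coe_addRight]
  rw [zpow_add₀ hx, zpow_neg]
  field_simp

/-- Coefficients of order `α ^ k` for `k → ∞` and `β ^ (-k)` for `k → -∞` give convergence in the
annulus `β < |x| < α⁻¹`. -/
theorem summable_laurent {s : ℤ → ℂ} {x : ℂ} {M α β : ℝ} (hα0 : 0 < α) (hβ0 : 0 < β)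
    (hα : ∀ k : ℤ, 1 ≤ k → ‖s k‖ ≤ M * α ^ k) (hβ : ∀ k : ℤ, k ≤ 0 → ‖s k‖ ≤ M * β ^ (-k))
    (h1 : α * ‖x‖ < 1) (h2 : β < ‖x‖) : Summable fun k : ℤ => s k * x ^ k := by
  have hx : 0 < ‖x‖ := hβ0.trans h2
  refine Summable.of_nat_of_neg ((summable_nat_add_iff 1).1 ?_) ?_
  · refine Summable.of_norm_bounded ((summable_nat_add_iff 1).2
      ((summable_geometric_of_lt_one (by positivity) h1).mul_left M)) fun n => ?_
    have := hα (n + 1 : ℕ) (by push_cast; omega)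
    rw [zpow_natCast] at this
    rw [norm_mul, zpow_natCast, norm_pow, mul_pow, ← mul_assoc]
    exact mul_le_mul_of_nonneg_right this (by positivity)
  · refine Summable.of_norm_bounded ((summable_geometric_of_lt_one (r := β / ‖x‖) (by positivity)
      ((div_lt_one hx).2 h2)).mul_left M) fun n => ?_
    have := hβ (-n) (by omega)
    rw [neg_neg, zpow_natCast] at this
    rw [norm_mul, zpow_neg, zpow_natCast, norm_inv, norm_pow, div_pow, ← div_eq_mul_inv,
      ← mul_div_assoc]
    exact div_le_div_of_nonneg_right this (by positivity)

/-- A Laurent series which converges absolutely at `x₀` and at `u₀ x₀` is bounded on the segment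
between these points. -/
theorem norm_laurent_le {s : ℤ → ℂ} {x₀ : ℂ} {u₀ : ℝ} (hu₀ : 0 < u₀)
    (h0 : Summable fun k : ℤ => s k * x₀ ^ k)
    (h1 : Summable fun k : ℤ => s k * ((u₀ : ℂ) * x₀) ^ k) {u : ℝ} (hu : u₀ ≤ u) (hu' : u ≤ 1) :
    (Summable fun k : ℤ => s k * ((u : ℂ) * x₀) ^ k) ∧
    ‖∑' k : ℤ, s k * ((u : ℂ) * x₀) ^ k‖ ≤
      ∑' k : ℤ, (‖s k * x₀ ^ k‖ + ‖s k * ((u₀ : ℂ) * x₀) ^ k‖) := by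
  have hb : ∀ k : ℤ, ‖s k * ((u : ℂ) * x₀) ^ k‖ ≤
      ‖s k * x₀ ^ k‖ + ‖s k * ((u₀ : ℂ) * x₀) ^ k‖ := by
    intro k
    have hup : 0 < u := hu₀.trans_le hu
    have hk : u ^ k ≤ 1 + u₀ ^ k := by
      rcases le_or_gt 0 k with h | h
      · have : u ^ k ≤ 1 := zpow_le_one₀ hup hu' h
        linarith [zpow_pos hu₀ k]
      · obtain ⟨n, hn⟩ := Int.eq_ofNat_of_zero_le (show 0 ≤ -k by omega)
        have hk' : k = -(n : ℤ) := by omega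
        have : u ^ k ≤ u₀ ^ k := by
          rw [hk', zpow_neg, zpow_neg, zpow_natCast, zpow_natCast]
          gcongr
        linarith
    simp only [mul_zpow, norm_mul, norm_zpow, Complex.norm_real, Real.norm_eq_abs, abs_of_pos hup,
      abs_of_pos hu₀]
    have : 0 ≤ ‖s k‖ * ‖x₀‖ ^ k := by positivity
    nlinarith
  have hs := h0.norm.add h1.norm
  exact ⟨Summable.of_norm_bounded hs hb, tsum_of_norm_bounded hs.hasSum hb⟩

/-- Two odd theta functions of degree three, one of which is a product `Den * S` on a set `U`, are
proportional; the factor can be read off from their limits at a boundary point of `U`. -/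
theorem IsOddTheta.eq_const_mul {g : ℂ} (hg : g ≠ 0) {e : ℤ} (he : e = 0 ∨ e = 1) {a c : ℤ → ℂ}
    (ha : IsOddTheta g e a) (hc : IsOddTheta g e c) {F G : ℂ → ℂ} {U : Set ℂ}
    (hF : ∀ x ∈ U, HasSum (fun k : ℤ => a k * x ^ k) (F x))
    (hG : ∀ x ∈ U, HasSum (fun k : ℤ => c k * x ^ k) (G x))
    {l : Filter ℂ} [l.NeBot] (hl : ∀ᶠ x in l, x ∈ U) {R C : ℂ} (hR : R ≠ 0)
    (hGl : Tendsto G l (𝓝 R)) (hFl : Tendsto F l (𝓝 (C * R))) {x : ℂ} (hx : x ∈ U) :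
    F x = C * G x := by
  have h1 : ∀ x ∈ U, a 1 * G x = c 1 * F x := by
    intro x hx
    refine ((hG x hx).mul_left (a 1)).unique (((hF x hx).mul_left (c 1)).congr_fun fun k => ?_)
    linear_combination x ^ k * hc.proportional hg he ha k
  have h2 : a 1 * R = c 1 * (C * R) := by
    refine tendsto_nhds_unique (hGl.const_mul (a 1)) ((hFl.const_mul (c 1)).congr' ?_)
    filter_upwards [hl] with x hx
    exact (h1 x hx).symm
  have h3 : a 1 = c 1 * C := mul_right_cancel₀ hR (by linear_combination h2)
  have hc1 : c 1 ≠ 0 := by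
    intro h
    have h4 : ∀ x ∈ U, G x = 0 := fun x hx => by
      refine (hG x hx).unique ?_
      simp [hc.eq_zero hg he h]
    refine hR (tendsto_nhds_unique hGl ((tendsto_const_nhds (x := (0 : ℂ))).congr' ?_))
    filter_upwards [hl] with x hx
    exact (h4 x hx).symm
  have h4 := h1 x hx
  rw [h3] at h4
  exact mul_left_cancel₀ hc1 (by linear_combination -h4)

/-- The identity `F = C * Den * S` between an odd theta function `F` and the product of a theta
series `Den = ∑ d_k x ^ k` with a Lambert series `S = ∑ s_k x ^ k`. The principal part
`∑ ℓ_k x ^ k` of `S` at a pole `x₀` on the boundary of the annulus of convergence determines the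
constant: its product with `Den` extends to a function `P` which is continuous at `x₀`, and `P x₀`
is the limit of `Den * S` along the ray from `0` through `x₀`. -/
theorem theta_eq_const_mul_lambert {g : ℂ} (hg : g ≠ 0) {δ ε : ℤ}
    (he : ε - δ = 0 ∨ ε - δ = 1) {u : ℂ} {a d s n n' ℓ : ℤ → ℂ} {F Den P : ℂ → ℂ}
    (ha : IsOddTheta g (ε - δ) a) (hF : ∀ x, x ≠ 0 → HasSum (fun k : ℤ => a k * x ^ k) (F x))
    (hDen : ∀ x, x ≠ 0 → HasSum (fun k : ℤ => d k * x ^ k) (Den x))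
    (hd : ∀ k, d (k + 3) = u * g ^ (6 * k + 9 + 3 * δ) * d k) (hdr : ∀ k, d (-δ - k) = d k)
    (hs : ∀ k, s k = g ^ (6 * k - 3 * ε) * (u * s k + n k)) (hsr : ∀ k, s (ε - k) = -s k + n' k)
    (hu : u * u = 1)
    (hn : ∀ m, HasSum (fun k : ℤ => d (m - k) * n k) 0)
    (hn' : ∀ m, HasSum (fun k : ℤ => d (m - k) * n' k) 0)
    {x₀ : ℂ} (hx₀ : x₀ ≠ 0) {u₀ : ℝ} (hu₀ : 0 < u₀) (hu₀' : u₀ < 1)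
    (hℓ : ∀ v : ℝ, u₀ ≤ v → v < 1 → Summable fun k : ℤ => ℓ k * ((v : ℂ) * x₀) ^ k)
    (hr0 : Summable fun k : ℤ => (s k - ℓ k) * x₀ ^ k)
    (hr1 : Summable fun k : ℤ => (s k - ℓ k) * ((u₀ : ℂ) * x₀) ^ k)
    (hP : ∀ v : ℝ, u₀ ≤ v → v < 1 →
      Den ((v : ℂ) * x₀) * ∑' k : ℤ, ℓ k * ((v : ℂ) * x₀) ^ k = P ((v : ℂ) * x₀))
    (hPc : ContinuousAt P x₀) (hDc : ContinuousAt Den x₀) (hD0 : Den x₀ = 0)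
    (hFc : ContinuousAt F x₀) {C : ℂ} (hR : P x₀ ≠ 0) (hC : F x₀ = C * P x₀) {x : ℂ} (hx : x ≠ 0)
    (hsx : Summable fun k : ℤ => s k * x ^ k) :
    F x = C * (Den x * ∑' k : ℤ, s k * x ^ k) := by
  have hrv := fun (v : ℝ) (hv : u₀ ≤ v) (hv' : v < 1) => norm_laurent_le hu₀ hr0 hr1 hv hv'.le
  have hsv : ∀ v : ℝ, u₀ ≤ v → v < 1 → Summable fun k : ℤ => s k * ((v : ℂ) * x₀) ^ k := by
    intro v hv hv'
    refine ((hℓ v hv hv').add (hrv v hv hv').1).congr fun k => ?_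
    ring
  have hv0 : ∀ v : ℝ, u₀ ≤ v → (v : ℂ) * x₀ ≠ 0 := fun v hv =>
    mul_ne_zero (Complex.ofReal_ne_zero.2 (hu₀.trans_le hv).ne') hx₀
  set U : Set ℂ := {x | x ≠ 0 ∧ Summable fun k : ℤ => s k * x ^ k} with hU
  have hconv := fun (x : ℂ) (hx : x ∈ U) => hasSum_laurent_mul hx.1 (hDen x hx.1) hx.2.hasSum
  have hc := isOddTheta_conv_den hg hd hdr hs hsr hu
    (hconv _ ⟨hv0 u₀ le_rfl, hsv u₀ le_rfl hu₀'⟩).1 hn hn'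
  have hpath : Tendsto (fun v : ℝ => (v : ℂ) * x₀) (𝓝[<] 1) (𝓝 x₀) := by
    have h : Continuous fun v : ℝ => (v : ℂ) * x₀ := by fun_prop
    have := h.tendsto 1
    simp only [Complex.ofReal_one, one_mul] at this
    exact this.mono_left nhdsWithin_le_nhds
  have hmem : ∀ᶠ v : ℝ in 𝓝[<] 1, u₀ ≤ v ∧ v < 1 := by
    filter_upwards [Ico_mem_nhdsLT hu₀'] with v hv
    exact hv
  refine IsOddTheta.eq_const_mul hg he ha hc (F := F)
    (G := fun x => Den x * ∑' k : ℤ, s k * x ^ k) (U := U) (fun x hx => hF x hx.1)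
    (fun x hx => (hconv x hx).2) (l := (𝓝[<] (1 : ℝ)).map fun v : ℝ => (v : ℂ) * x₀) ?_ hR ?_ ?_
    ⟨hx, hsx⟩
  · rw [eventually_map]
    filter_upwards [hmem] with v hv
    exact ⟨hv0 v hv.1, hsv v hv.1 hv.2⟩
  · rw [tendsto_map'_iff]
    have h1 : Tendsto (fun v : ℝ => Den ((v : ℂ) * x₀) *
        ∑' k : ℤ, (s k - ℓ k) * ((v : ℂ) * x₀) ^ k) (𝓝[<] 1) (𝓝 0) := by
      refine Tendsto.zero_mul_isBoundedUnder_le ?_ ?_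
      · rw [← hD0]
        exact hDc.tendsto.comp hpath
      · refine isBoundedUnder_of_eventually_le
          (a := ∑' k : ℤ, (‖(s k - ℓ k) * x₀ ^ k‖ + ‖(s k - ℓ k) * ((u₀ : ℂ) * x₀) ^ k‖)) ?_
        filter_upwards [hmem] with v hv
        exact (hrv v hv.1 hv.2).2
    have h2 := (hPc.tendsto.comp hpath).add h1
    rw [add_zero] at h2
    refine h2.congr' ?_
    filter_upwards [hmem] with v hv
    simp only [Function.comp]
    rw [← hP v hv.1 hv.2, ← mul_add, ← (hℓ v hv.1 hv.2).tsum_add (hrv v hv.1 hv.2).1]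
    congr 1
    exact tsum_congr fun k => by ring
  · rw [tendsto_map'_iff, ← hC]
    exact hFc.tendsto.comp hpath

/-! ### The theta functions of the pfaffian entries -/

theorem qTheta_mul_neg {q : ℂ} (hq : ‖q‖ < 1) (x : ℂ) :
    qTheta x q * qTheta (-x) q = qTheta (x ^ 2) (q ^ 2) := by
  unfold qTheta
  rw [← qPoch_mul_neg hq x, ← div_pow, ← qPoch_mul_neg hq (q / x), div_neg]
  ring

theorem continuousAt_qTheta {q : ℂ} (hq : ‖q‖ < 1) {x : ℂ} (hx : x ≠ 0) :
    ContinuousAt (fun x => qTheta x q) x := by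
  unfold qTheta
  have h := (differentiable_qPoch hq).continuous
  refine (h.continuousAt).mul ?_
  exact ContinuousAt.comp (f := fun x => q / x) (g := fun a => qPoch a q) h.continuousAt
    (continuousAt_const.div continuousAt_id hx)

theorem zpow_expand {g : ℂ} (hg : g ≠ 0) (a : ℤ) {b c : ℤ} (h : a = b + c) :
    g ^ a = g ^ b * g ^ c := by
  rw [h, zpow_add₀ hg]

theorem neg_one_zpow_eq_of_even {a b : ℤ} (h : Even (a - b)) : (-1 : ℂ) ^ a = (-1) ^ b := by
  have : a = (a - b) + b := by ring
  rw [this, zpow_add₀ (by norm_num), h.neg_one_zpow, one_mul]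

theorem neg_one_zpow_eq_of_odd {a b : ℤ} (h : Odd (a - b)) : (-1 : ℂ) ^ a = -(-1) ^ b := by
  have : a = (a - b) + b := by ring
  rw [this, zpow_add₀ (by norm_num), h.neg_one_zpow]
  ring

theorem exists_hasSum_qTheta_dilate {h : ℂ} (h0 : h ≠ 0) (h1 : ‖h‖ < 1) {y : ℂ} (hy : y ≠ 0)
    {c : ℤ} (hc : c ≠ 0) : ∃ K : ℂ, ∀ x : ℂ, x ≠ 0 →
    HasSum (fun k : ℤ => (if c ∣ k then
      K * ((-1) ^ (k / c) * h ^ ((k / c) * (k / c - 1))) * y ^ (k / c) else 0) * x ^ k)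
      (qTheta (y * x ^ c) (h ^ 2)) := by
  obtain ⟨K, hK⟩ := exists_hasSum_qTheta h0 h1
  exact ⟨K, fun x hx => hasSum_laurent_dilate (a := fun k => K * ((-1) ^ k * h ^ (k * (k - 1)))) hc
    (hK _ (mul_ne_zero hy (zpow_ne_zero _ hx)))⟩

theorem norm_pow_lt_one' {g : ℂ} (hg1 : ‖g‖ < 1) {n : ℕ} (hn : n ≠ 0) : ‖g ^ n‖ < 1 := by
  rw [norm_pow]
  exact pow_lt_one₀ (norm_nonneg _) hg1 hn

/-- The Laurent series of the denominator of the labels `0` and `6`. -/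
theorem hasSum_qTheta_den_zero {g : ℂ} (hg : g ≠ 0) (hg1 : ‖g‖ < 1) : ∃ K : ℂ, ∀ x : ℂ, x ≠ 0 →
    HasSum (fun k : ℤ => K * ((-1) ^ k * g ^ (k * k)) * x ^ k) (qTheta (g * x) (g ^ 2)) := by
  obtain ⟨K, hK⟩ := exists_hasSum_qTheta hg hg1
  refine ⟨K, fun x hx => (hK (g * x) (mul_ne_zero hg hx)).congr_fun fun k => ?_⟩
  rw [mul_zpow, zpow_expand hg (k * k) (show k * k = k * (k - 1) + k by ring)]
  ring

/-- The Laurent series of the denominator of the labels `4` and `2`. -/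
theorem hasSum_qTheta_den_four {g : ℂ} (hg : g ≠ 0) (hg1 : ‖g‖ < 1) : ∃ K : ℂ, ∀ x : ℂ, x ≠ 0 →
    HasSum (fun k : ℤ => (if (3 : ℤ) ∣ k then K * ((-1) ^ k * g ^ (k * k)) else 0) * x ^ k)
      (qTheta (g ^ 9 * x ^ 3) (g ^ 18)) := by
  obtain ⟨K, hK⟩ := exists_hasSum_qTheta_dilate (pow_ne_zero 9 hg)
    (norm_pow_lt_one' hg1 (by norm_num)) (pow_ne_zero 9 hg) (c := 3) (by norm_num)
  refine ⟨K, fun x hx => ?_⟩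
  have h := hK x hx
  rw [← pow_mul, show x ^ (3 : ℤ) = x ^ 3 from zpow_ofNat x 3] at h
  refine h.congr_fun fun k => ?_
  congr 1
  refine if_ctx_congr Iff.rfl (fun hk => ?_) fun _ => rfl
  obtain ⟨j, rfl⟩ := hk
  rw [Int.mul_ediv_cancel_left _ (by norm_num), ← zpow_natCast g 9, ← zpow_mul, ← zpow_mul,
    neg_one_zpow_eq_of_even (a := 3 * j) (b := j) ⟨j, by ring⟩,
    zpow_expand hg (3 * j * (3 * j))
      (show 3 * j * (3 * j) = ((9 : ℕ) : ℤ) * (j * (j - 1)) + ((9 : ℕ) : ℤ) * j by push_cast; ring)]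
  ring

/-- The Laurent series of the denominator of the label `3`; the factor `x⁻¹` makes the exponents
of `g` fit a theta series of degree three. -/
theorem hasSum_qTheta_den_three {g : ℂ} (hg : g ≠ 0) (hg1 : ‖g‖ < 1) : ∃ K : ℂ, ∀ x : ℂ, x ≠ 0 →
    HasSum (fun k : ℤ => K * g ^ (k * k + k) * x ^ k) (x⁻¹ * qTheta (-x) (g ^ 2)) := by
  obtain ⟨K, hK⟩ := exists_hasSum_qTheta hg hg1
  refine ⟨K, fun x hx => ?_⟩
  have h : HasSum (fun k : ℤ => K * g ^ (k * (k - 1)) * x ^ k) (qTheta (-x) (g ^ 2)) := by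
    refine (hK (-x) (neg_ne_zero.2 hx)).congr_fun fun k => ?_
    rw [← neg_one_mul x, mul_zpow]
    have : (-1 : ℂ) ^ k * (-1) ^ k = 1 := by
      rw [← mul_zpow]
      simp
    linear_combination -(K * g ^ (k * (k - 1)) * x ^ k) * this
  have h2 := hasSum_laurent_mul_zpow (a := fun k => K * g ^ (k * (k - 1))) hx 1 h
  rw [zpow_neg_one] at h2
  refine h2.congr_fun fun k => ?_
  rw [show (k + 1) * (k + 1 - 1) = k * k + k by ring]

/-- The Laurent series of the denominator of the label `1`, whose exponents are `1` modulo `3`. The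
factor `x ^ (-2)` gives it the same coefficients as for the label `3` on this residue class. -/
theorem hasSum_qTheta_den_one {g : ℂ} (hg : g ≠ 0) (hg1 : ‖g‖ < 1) : ∃ K : ℂ, ∀ x : ℂ, x ≠ 0 →
    HasSum (fun k : ℤ => (if (3 : ℤ) ∣ k + 2 then K * g ^ (k * k + k) else 0) * x ^ k)
      ((x ^ 2)⁻¹ * qTheta (-x ^ 3) (g ^ 18)) := by
  obtain ⟨K, hK⟩ := exists_hasSum_qTheta_dilate (pow_ne_zero 9 hg)
    (norm_pow_lt_one' hg1 (by norm_num)) (y := -1) (by norm_num) (c := 3) (by norm_num)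
  refine ⟨K * g ^ (-2 : ℤ), fun x hx => ?_⟩
  have h := hasSum_laurent_mul_zpow hx 2 (hK x hx)
  rw [← pow_mul, show x ^ (3 : ℤ) = x ^ 3 from zpow_ofNat x 3, neg_one_mul, zpow_neg,
    show x ^ (2 : ℤ) = x ^ 2 from zpow_ofNat x 2] at h
  refine h.congr_fun fun k => ?_
  congr 1
  refine if_ctx_congr Iff.rfl (fun hk => ?_) fun _ => rfl
  obtain ⟨j, hj⟩ := hk
  obtain rfl : k = 3 * j - 2 := by omega
  have e : (-1 : ℂ) ^ j * (-1) ^ j = 1 := by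
    rw [← mul_zpow]
    simp
  rw [show 3 * j - 2 + 2 = 3 * j by ring, Int.mul_ediv_cancel_left _ (by norm_num),
    ← zpow_natCast g 9, ← zpow_mul,
    zpow_expand hg (((9 : ℕ) : ℤ) * (j * (j - 1)))
      (show ((9 : ℕ) : ℤ) * (j * (j - 1)) =
        -2 + ((3 * j - 2) * (3 * j - 2) + (3 * j - 2)) by push_cast; ring)]
  linear_combination -(K * g ^ (-2 : ℤ) *
    g ^ ((3 * j - 2) * (3 * j - 2) + (3 * j - 2))) * e

/-- The numerator `θ(x, -x, p x; p ^ 2)` with `p = g ^ 3`. -/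
noncomputable def thetaA (g x : ℂ) : ℂ :=
  qTheta x (g ^ 6) * qTheta (-x) (g ^ 6) * qTheta (g ^ 3 * x) (g ^ 6)

/-- The numerator `θ(x, p x, -p x; p ^ 2)` with `p = g ^ 3`. -/
noncomputable def thetaB (g x : ℂ) : ℂ :=
  qTheta x (g ^ 6) * qTheta (g ^ 3 * x) (g ^ 6) * qTheta (-(g ^ 3 * x)) (g ^ 6)

theorem thetaA_eq {g : ℂ} (hg1 : ‖g‖ < 1) (x : ℂ) :
    thetaA g x = qTheta (x ^ 2) (g ^ 12) * qTheta (g ^ 3 * x) (g ^ 6) := by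
  rw [thetaA, qTheta_mul_neg (norm_pow_lt_one' hg1 (by norm_num)), ← pow_mul]

theorem thetaB_eq {g : ℂ} (hg1 : ‖g‖ < 1) (x : ℂ) :
    thetaB g x = qTheta (g ^ 6 * x ^ 2) (g ^ 12) * qTheta x (g ^ 6) := by
  rw [thetaB, mul_assoc, qTheta_mul_neg (norm_pow_lt_one' hg1 (by norm_num)), ← pow_mul, mul_pow,
    ← pow_mul]
  ring

/-- The first factor of `thetaA_eq`, divided by `x`, is odd of degree two; the second is even of
degree one. -/
theorem exists_isOddTheta_thetaA {g : ℂ} (hg : g ≠ 0) (hg1 : ‖g‖ < 1) : ∃ a : ℤ → ℂ,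
    IsOddTheta g 0 a ∧ ∀ x : ℂ, x ≠ 0 → HasSum (fun k : ℤ => a k * x ^ k) (x⁻¹ * thetaA g x) := by
  obtain ⟨K, hK⟩ := exists_hasSum_qTheta_dilate (pow_ne_zero 6 hg)
    (norm_pow_lt_one' hg1 (by norm_num)) (y := 1) one_ne_zero (c := 2) (by norm_num)
  obtain ⟨L, hL⟩ := exists_hasSum_qTheta (pow_ne_zero 3 hg)
    (norm_pow_lt_one' hg1 (by norm_num))
  set u : ℤ → ℂ := fun k => if (2 : ℤ) ∣ k + 1 then K * ((-1) ^ ((k + 1) / 2) *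
    (g ^ 6) ^ (((k + 1) / 2) * ((k + 1) / 2 - 1))) * 1 ^ ((k + 1) / 2) else 0 with hu
  set t : ℤ → ℂ := fun k => L * ((-1) ^ k * g ^ (3 * (k * k))) with ht
  have hus : ∀ x : ℂ, x ≠ 0 →
      HasSum (fun k : ℤ => u k * x ^ k) (x⁻¹ * qTheta (x ^ 2) (g ^ 12)) := by
    intro x hx
    have h := hasSum_laurent_mul_zpow hx 1 (hK x hx)
    rw [← pow_mul, show x ^ (2 : ℤ) = x ^ 2 from zpow_ofNat x 2, one_mul, zpow_neg_one] at h
    exact h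
  have hts : ∀ x : ℂ, x ≠ 0 →
      HasSum (fun k : ℤ => t k * x ^ k) (qTheta (g ^ 3 * x) (g ^ 6)) := by
    intro x hx
    have h := hL (g ^ 3 * x) (mul_ne_zero (pow_ne_zero 3 hg) hx)
    rw [← pow_mul] at h
    refine h.congr_fun fun k => ?_
    simp only [ht]
    rw [mul_zpow, ← zpow_natCast g 3, ← zpow_mul, ← zpow_mul, zpow_expand hg (3 * (k * k))
      (show 3 * (k * k) = ((3 : ℕ) : ℤ) * (k * (k - 1)) + ((3 : ℕ) : ℤ) * k by push_cast; ring)]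
    ring
  refine ⟨_, isOddTheta_conv_num hg (u := u) (t := t) (e := 0) (α := -1) (β := 1) ?_ ?_ ?_ ?_
    (by norm_num), fun x hx => ?_⟩
  · intro k
    simp only [hu]
    by_cases hk : (2 : ℤ) ∣ k + 1
    · obtain ⟨j, hj⟩ := hk
      obtain rfl : k = 2 * j - 1 := by omega
      rw [if_pos ⟨j + 1, by ring⟩, if_pos ⟨j, by ring⟩,
        show (2 * j - 1 + 2 + 1) / 2 = j + 1 by omega, show (2 * j - 1 + 1) / 2 = j by omega,
        neg_one_zpow_eq_of_odd (a := j + 1) (b := j) (by simp), ← zpow_natCast g 6,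
        ← zpow_mul, ← zpow_mul, zpow_expand hg (((6 : ℕ) : ℤ) * ((j + 1) * (j + 1 - 1)))
        (show ((6 : ℕ) : ℤ) * ((j + 1) * (j + 1 - 1)) =
          (6 * (2 * j - 1) + 6) + ((6 : ℕ) : ℤ) * (j * (j - 1)) by push_cast; ring)]
      simp only [one_zpow]
      ring
    · rw [if_neg (by omega), if_neg hk, mul_zero]
  · intro k
    simp only [hu]
    by_cases hk : (2 : ℤ) ∣ k + 1
    · obtain ⟨j, hj⟩ := hk
      obtain rfl : k = 2 * j - 1 := by omega
      rw [if_pos ⟨1 - j, by ring⟩, if_pos ⟨j, by ring⟩,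
        show (-(2 * j - 1) + 1) / 2 = 1 - j by omega, show (2 * j - 1 + 1) / 2 = j by omega,
        neg_one_zpow_eq_of_odd (a := 1 - j) (b := j) ⟨-j, by ring⟩,
        show (1 - j) * (1 - j - 1) = j * (j - 1) by ring]
      simp only [one_zpow]
      ring
    · rw [if_neg (by omega), if_neg hk, mul_zero]
  · intro k
    simp only [ht]
    rw [neg_one_zpow_eq_of_odd (a := k + 1) (b := k) (by simp),
      zpow_expand hg (3 * ((k + 1) * (k + 1)))
        (show 3 * ((k + 1) * (k + 1)) = (6 * k + 3 - 3 * 0) + 3 * (k * k) by ring)]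
    ring
  · intro k
    simp only [ht]
    rw [neg_one_zpow_eq_of_even (a := 0 - k) (b := k) ⟨-k, by ring⟩,
      show (0 - k) * (0 - k) = k * k by ring, one_mul]
  · have h := (hasSum_laurent_mul hx (hus x hx) (hts x hx)).2
    rwa [mul_assoc, ← thetaA_eq hg1] at h

/-- The first factor of `thetaB_eq` is even of degree two; the second is odd of degree one, up to
the factor `x`. -/
theorem exists_isOddTheta_thetaB {g : ℂ} (hg : g ≠ 0) (hg1 : ‖g‖ < 1) : ∃ a : ℤ → ℂ,
    IsOddTheta g 1 a ∧ ∀ x : ℂ, x ≠ 0 → HasSum (fun k : ℤ => a k * x ^ k) (thetaB g x) := by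
  obtain ⟨K, hK⟩ := exists_hasSum_qTheta_dilate (pow_ne_zero 6 hg)
    (norm_pow_lt_one' hg1 (by norm_num)) (y := g ^ 6) (pow_ne_zero 6 hg) (c := 2) (by norm_num)
  obtain ⟨L, hL⟩ := exists_hasSum_qTheta (pow_ne_zero 3 hg)
    (norm_pow_lt_one' hg1 (by norm_num))
  set u : ℤ → ℂ := fun k => if (2 : ℤ) ∣ k then K * ((-1) ^ (k / 2) *
    (g ^ 6) ^ ((k / 2) * (k / 2 - 1))) * (g ^ 6) ^ (k / 2) else 0 with hu
  set t : ℤ → ℂ := fun k => L * ((-1) ^ k * (g ^ 3) ^ (k * (k - 1))) with ht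
  have hus : ∀ x : ℂ, x ≠ 0 →
      HasSum (fun k : ℤ => u k * x ^ k) (qTheta (g ^ 6 * x ^ 2) (g ^ 12)) := by
    intro x hx
    have h := hK x hx
    rw [← pow_mul, show x ^ (2 : ℤ) = x ^ 2 from zpow_ofNat x 2] at h
    exact h
  have hts : ∀ x : ℂ, x ≠ 0 → HasSum (fun k : ℤ => t k * x ^ k) (qTheta x (g ^ 6)) := by
    intro x hx
    have h := hL x hx
    rwa [← pow_mul] at h
  refine ⟨_, isOddTheta_conv_num hg (u := u) (t := t) (e := 1) (α := 1) (β := -1) ?_ ?_ ?_ ?_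
    (by norm_num), fun x hx => ?_⟩
  · intro k
    simp only [hu]
    by_cases hk : (2 : ℤ) ∣ k
    · obtain ⟨j, rfl⟩ := hk
      rw [if_pos ⟨j + 1, by ring⟩, if_pos ⟨j, by ring⟩,
        show (2 * j + 2) / 2 = j + 1 by omega, show (2 * j) / 2 = j by omega,
        neg_one_zpow_eq_of_odd (a := j + 1) (b := j) (by simp), ← zpow_natCast g 6,
        ← zpow_mul, ← zpow_mul, ← zpow_mul, ← zpow_mul,
        zpow_expand hg (((6 : ℕ) : ℤ) * ((j + 1) * (j + 1 - 1)))
        (show ((6 : ℕ) : ℤ) * ((j + 1) * (j + 1 - 1)) =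
          6 * (2 * j) + ((6 : ℕ) : ℤ) * (j * (j - 1)) by push_cast; ring),
        zpow_expand hg (((6 : ℕ) : ℤ) * (j + 1)) (show ((6 : ℕ) : ℤ) * (j + 1) =
          6 + ((6 : ℕ) : ℤ) * j by push_cast; ring), zpow_add₀ hg (6 * (2 * j))]
      ring
    · rw [if_neg (by omega), if_neg hk, mul_zero]
  · intro k
    simp only [hu]
    by_cases hk : (2 : ℤ) ∣ k
    · obtain ⟨j, rfl⟩ := hk
      rw [if_pos ⟨-j, by ring⟩, if_pos ⟨j, by ring⟩,
        show (-(2 * j)) / 2 = -j by omega, show (2 * j) / 2 = j by omega,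
        neg_one_zpow_eq_of_even (a := -j) (b := j) ⟨-j, by ring⟩,
        zpow_expand (pow_ne_zero 6 hg) (-j * (-j - 1))
          (show -j * (-j - 1) = j * (j - 1) + 2 * j by ring),
        zpow_expand (pow_ne_zero 6 hg) j (show j = 2 * j + -j by ring)]
      ring
    · rw [if_neg (by omega), if_neg hk, mul_zero]
  · intro k
    simp only [ht]
    rw [neg_one_zpow_eq_of_odd (a := k + 1) (b := k) (by simp), ← zpow_natCast g 3, ← zpow_mul,
      ← zpow_mul, zpow_expand hg (((3 : ℕ) : ℤ) * ((k + 1) * (k + 1 - 1)))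
        (show ((3 : ℕ) : ℤ) * ((k + 1) * (k + 1 - 1)) =
          (6 * k + 3 - 3 * 1) + ((3 : ℕ) : ℤ) * (k * (k - 1)) by push_cast; ring)]
    ring
  · intro k
    simp only [ht]
    rw [neg_one_zpow_eq_of_odd (a := 1 - k) (b := k) ⟨-k, by ring⟩,
      show (1 - k) * (1 - k - 1) = k * (k - 1) by ring]
    ring
  · have h := (hasSum_laurent_mul hx (hus x hx) (hts x hx)).2
    rwa [← thetaB_eq hg1] at h

/-! ### Lambert series -/

/-- The coefficients `ν_k / (1 - u g ^ (6 k - 3 ε))` of a Lambert series, where `u = ±1`. -/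
noncomputable def lambertCoeff (g u : ℂ) (ε : ℤ) (ν : ℤ → ℂ) (k : ℤ) : ℂ :=
  ν k / (1 - u * g ^ (6 * k - 3 * ε))

theorem one_sub_norm_le {g u : ℂ} (hg1 : ‖g‖ < 1) (hu : u = 1 ∨ u = -1) {m : ℤ} (hm : 1 ≤ m) :
    1 - ‖g‖ ≤ ‖1 - u * g ^ m‖ := by
  obtain ⟨n, rfl⟩ := Int.eq_ofNat_of_zero_le (show 0 ≤ m by omega)
  have hn : n ≠ 0 := by
    rintro rfl
    norm_num at hm
  have h1 : ‖u * g ^ ((n : ℕ) : ℤ)‖ ≤ ‖g‖ := by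
    have hu1 : ‖u‖ = 1 := by rcases hu with rfl | rfl <;> simp
    rw [norm_mul, hu1, one_mul, zpow_natCast, norm_pow]
    exact pow_le_of_le_one (norm_nonneg _) hg1.le hn
  have h2 := norm_sub_norm_le (1 : ℂ) (u * g ^ ((n : ℕ) : ℤ))
  rw [norm_one] at h2
  linarith

theorem one_sub_mul_zpow_ne_zero {g u : ℂ} (hg : g ≠ 0) (hg1 : ‖g‖ < 1) (hu : u = 1 ∨ u = -1)
    {m : ℤ} (hm : m ≠ 0 ∨ u = -1) : 1 - u * g ^ m ≠ 0 := by
  have huu : u * u = 1 := by rcases hu with rfl | rfl <;> norm_num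
  have hpos : ∀ m : ℤ, 1 ≤ m → 1 - u * g ^ m ≠ 0 := fun m hm h => by
    have := one_sub_norm_le hg1 hu hm
    rw [h, norm_zero] at this
    linarith
  rcases lt_trichotomy m 0 with h | h | h
  · intro h0
    refine hpos (-m) (by omega) ?_
    have h1 : g ^ m * g ^ (-m) = 1 := by
      rw [← zpow_add₀ hg]
      simp
    linear_combination (-u * g ^ (-m)) * h0 - (g ^ m * g ^ (-m)) * huu - h1
  · subst h
    rcases hm with hm | rfl
    · exact absurd rfl hm
    · norm_num
  · exact hpos m (by omega)

/-- The exponent `6 k - 3 ε` vanishes only for `ε = 0` and `k = 0`, where the denominator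
`1 - u g ^ (6 k - 3 ε)` of the Lambert series is `2` because `u = -1`. -/
theorem exponent_ne_zero {u : ℂ} {ε : ℤ} (hε : ε = 1 ∨ (ε = 0 ∧ u = -1)) (k : ℤ) :
    6 * k - 3 * ε ≠ 0 ∨ u = -1 := by
  rcases hε with rfl | ⟨_, h⟩
  · left
    omega
  · exact Or.inr h

/-- The recursion required by `isOddTheta_conv_den`, the correction term being
`g ^ (-(6 k - 3 ε)) ν_k`. -/
theorem lambertCoeff_shift {g u : ℂ} (hg : g ≠ 0) (hg1 : ‖g‖ < 1) (hu : u = 1 ∨ u = -1) {ε : ℤ}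
    (hε : ε = 1 ∨ (ε = 0 ∧ u = -1)) (ν : ℤ → ℂ) (k : ℤ) :
    lambertCoeff g u ε ν k = g ^ (6 * k - 3 * ε) *
      (u * lambertCoeff g u ε ν k + g ^ (-(6 * k - 3 * ε)) * ν k) := by
  have h := one_sub_mul_zpow_ne_zero hg hg1 hu (exponent_ne_zero hε k)
  have h1 : g ^ (6 * k - 3 * ε) * g ^ (-(6 * k - 3 * ε)) = 1 := by
    rw [← zpow_add₀ hg]
    simp
  unfold lambertCoeff
  field_simp
  linear_combination -h1 * ν k * (1 - u * g ^ (6 * k - 3 * ε))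

theorem lambertCoeff_reflect {g u : ℂ} (hg : g ≠ 0) (hg1 : ‖g‖ < 1) (hu : u = 1 ∨ u = -1) {ε : ℤ}
    (hε : ε = 1 ∨ (ε = 0 ∧ u = -1)) (ν : ℤ → ℂ) (k : ℤ) :
    lambertCoeff g u ε ν (ε - k) =
      -(u * ν (ε - k) * g ^ (6 * k - 3 * ε)) / (1 - u * g ^ (6 * k - 3 * ε)) := by
  have h := one_sub_mul_zpow_ne_zero hg hg1 hu (exponent_ne_zero hε k)
  have h' := one_sub_mul_zpow_ne_zero hg hg1 hu (exponent_ne_zero hε (ε - k))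
  have h1 : g ^ (6 * k - 3 * ε) * g ^ (6 * (ε - k) - 3 * ε) = 1 := by
    rw [← zpow_add₀ hg]
    ring_nf
    simp
  have huu : u * u = 1 := by rcases hu with rfl | rfl <;> norm_num
  unfold lambertCoeff
  rw [div_eq_div_iff h' h]
  linear_combination (-ν (ε - k) * u * u) * h1 - ν (ε - k) * huu

theorem hasSum_int_of_pos {f : ℤ → ℂ} {F : ℂ} (h : HasSum (fun n : ℕ => f (n + 1)) F) :
    HasSum (fun k : ℤ => if 1 ≤ k then f k else 0) F := by
  have hinj : Function.Injective fun n : ℕ => (n : ℤ) + 1 := fun a b h => by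
    simpa using h
  rw [← hinj.hasSum_iff]
  · refine h.congr_fun fun n => ?_
    simp
  · intro k hk
    rw [if_neg]
    intro h1
    exact hk ⟨(k - 1).toNat, by
      have : ((k - 1).toNat : ℤ) = k - 1 := Int.toNat_of_nonneg (by omega)
      simp only [this]
      ring⟩

/-- The coefficients of a Lambert series differ from the leading part `lam` of `ν` by terms of a
smaller exponential order, so that `∑ lam k * x ^ k` carries the pole on the outer boundary. -/
theorem norm_lambertCoeff_sub_le {g u : ℂ} (hg1 : ‖g‖ < 1) (hu : u = 1 ∨ u = -1) {ε : ℤ}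
    (hε : ε ≤ 1) {ν lam : ℤ → ℂ} {M α' : ℝ}
    (hrem : ∀ k : ℤ, 1 ≤ k →
      ‖ν k - lam k + u * lam k * g ^ (6 * k - 3 * ε)‖ ≤ M * α' ^ k) {k : ℤ} (hk : 1 ≤ k) :
    ‖lambertCoeff g u ε ν k - lam k‖ ≤ M / (1 - ‖g‖) * α' ^ k := by
  have hb := one_sub_norm_le hg1 hu (show 1 ≤ 6 * k - 3 * ε by omega)
  have hg' : 0 < 1 - ‖g‖ := by linarith
  have h0 : 1 - u * g ^ (6 * k - 3 * ε) ≠ 0 := fun h => by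
    rw [h, norm_zero] at hb
    linarith
  have e : lambertCoeff g u ε ν k - lam k =
      (ν k - lam k + u * lam k * g ^ (6 * k - 3 * ε)) / (1 - u * g ^ (6 * k - 3 * ε)) := by
    unfold lambertCoeff
    field_simp
    ring
  rw [e, norm_div, div_mul_eq_mul_div]
  exact div_le_div₀ ((norm_nonneg _).trans (hrem k hk)) (hrem k hk) hg' hb

theorem norm_ofReal_mul_of_pos {v : ℝ} (hv : 0 < v) (x : ℂ) : ‖(v : ℂ) * x‖ = v * ‖x‖ := by
  rw [norm_mul, Complex.norm_real, Real.norm_eq_abs, abs_of_pos hv]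

/-- The instance of `theta_eq_const_mul_lambert` for an odd Lambert series whose annulus of
convergence is `α < |x| < α⁻¹`. The sequence `lam` is the leading part of `ν` as `k → ∞`. -/
theorem lambert_identity {g : ℂ} (hg : g ≠ 0) (hg1 : ‖g‖ < 1) {δ ε : ℤ}
    (he : ε - δ = 0 ∨ ε - δ = 1) {u : ℂ} (hu : u = 1 ∨ u = -1)
    (hε : ε = 1 ∨ (ε = 0 ∧ u = -1)) {a d ν lam : ℤ → ℂ} {F Den P : ℂ → ℂ}
    (ha : IsOddTheta g (ε - δ) a) (hF : ∀ x, x ≠ 0 → HasSum (fun k : ℤ => a k * x ^ k) (F x))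
    (hDen : ∀ x, x ≠ 0 → HasSum (fun k : ℤ => d k * x ^ k) (Den x))
    (hd : ∀ k, d (k + 3) = u * g ^ (6 * k + 9 + 3 * δ) * d k) (hdr : ∀ k, d (-δ - k) = d k)
    (hν : ∀ k, u * ν (ε - k) * g ^ (6 * k - 3 * ε) = ν k)
    (hn : ∀ m, HasSum (fun k : ℤ => d (m - k) * (g ^ (-(6 * k - 3 * ε)) * ν k)) 0)
    {M α α' : ℝ} (hα'0 : 0 < α') (hα' : α' < α) (hα1 : α < 1)
    (hlam : ∀ k : ℤ, 1 ≤ k → ‖lam k‖ ≤ M * α ^ k)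
    (hrem : ∀ k : ℤ, 1 ≤ k →
      ‖ν k - lam k + u * lam k * g ^ (6 * k - 3 * ε)‖ ≤ M * α' ^ k)
    {x₀ : ℂ} (hx₀ : α * ‖x₀‖ = 1)
    (hP : ∀ x, x ≠ 0 → α * ‖x‖ < 1 →
      Den x * ∑' k : ℤ, (if 1 ≤ k then lam k * x ^ k else 0) = P x)
    (hPc : ContinuousAt P x₀) (hDc : ContinuousAt Den x₀) (hD0 : Den x₀ = 0)
    (hFc : ContinuousAt F x₀) {C : ℂ} (hR : P x₀ ≠ 0) (hC : F x₀ = C * P x₀) :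
    (∀ k : ℤ, lambertCoeff g u ε ν (ε - k) = -lambertCoeff g u ε ν k) ∧
    (∃ M' : ℝ, ∀ k : ℤ, 1 ≤ k → ‖lambertCoeff g u ε ν k‖ ≤ M' * α ^ k) ∧
    ∀ x : ℂ, α < ‖x‖ → α * ‖x‖ < 1 →
      (Summable fun k : ℤ => lambertCoeff g u ε ν k * x ^ k) ∧
      F x = C * (Den x * ∑' k : ℤ, lambertCoeff g u ε ν k * x ^ k) := by
  have hα0 : 0 < α := hα'0.trans hα'
  have huu : u * u = 1 := by rcases hu with rfl | rfl <;> norm_num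
  have hg' : 0 < 1 - ‖g‖ := by linarith
  have hε1 : ε ≤ 1 := by omega
  have hM : 0 ≤ M := by
    have h1 := (norm_nonneg _).trans (hlam 1 le_rfl)
    rw [zpow_one] at h1
    exact nonneg_of_mul_nonneg_left h1 hα0
  set s := lambertCoeff g u ε ν with hs
  have hrefl : ∀ k, s (ε - k) = -s k := by
    intro k
    rw [hs, lambertCoeff_reflect hg hg1 hu hε, hν, lambertCoeff, neg_div]
  have hx₀0 : x₀ ≠ 0 := by
    rintro rfl
    simp at hx₀
  have hx₀' : ‖x₀‖ = α⁻¹ := eq_inv_of_mul_eq_one_right hx₀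
  set N : ℝ := M / (1 - ‖g‖) + M with hN
  have hN0 : 0 ≤ M / (1 - ‖g‖) := by positivity
  have hsub : ∀ k : ℤ, 1 ≤ k → ‖s k - lam k‖ ≤ N * α' ^ k := fun k hk =>
    (norm_lambertCoeff_sub_le hg1 hu hε1 hrem hk).trans
      (mul_le_mul_of_nonneg_right (by linarith) (zpow_pos hα'0 k).le)
  have hsk : ∀ k : ℤ, 1 ≤ k → ‖s k‖ ≤ N * α ^ k := by
    intro k hk
    have h1 : ‖s k‖ ≤ ‖s k - lam k‖ + ‖lam k‖ := by
      simpa using norm_add_le (s k - lam k) (lam k)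
    have h2 := norm_lambertCoeff_sub_le hg1 hu hε1 hrem hk
    have h3 : α' ^ k ≤ α ^ k := zpow_le_zpow_left₀ (by omega) hα'0.le hα'.le
    have h4 := hlam k hk
    have h5 := mul_le_mul_of_nonneg_left h3 hN0
    rw [hN, add_mul]
    linarith
  have hsneg : ∀ k : ℤ, k ≤ 0 → ‖s k‖ ≤ N * α ^ (-k) := by
    intro k hk
    have e : ‖s k‖ = ‖s (ε - k)‖ := by rw [hrefl, norm_neg]
    by_cases h : 1 ≤ ε - k
    · rw [e]
      refine (hsk _ h).trans (mul_le_mul_of_nonneg_left ?_ (by positivity))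
      exact zpow_le_zpow_right_of_le_one₀ hα0 hα1.le (by omega)
    · have hk0 : ε - k = k := by omega
      have h2 := hrefl k
      rw [hk0] at h2
      have : s k = 0 := by linear_combination h2 / 2
      rw [this, norm_zero]
      have := zpow_pos hα0 (-k)
      positivity
  have hsum : ∀ x : ℂ, α < ‖x‖ → α * ‖x‖ < 1 → Summable fun k : ℤ => s k * x ^ k :=
    fun x h1 h2 => summable_laurent hα0 hα0 hsk hsneg h2 h1
  have hrsum : ∀ x : ℂ, α < ‖x‖ → α' * ‖x‖ < 1 →
      Summable fun k : ℤ => (s k - if 1 ≤ k then lam k else 0) * x ^ k := by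
    intro x h1 h2
    refine summable_laurent (s := fun k => s k - if 1 ≤ k then lam k else 0) (M := N) hα'0 hα0
      ?_ ?_ h2 h1
    · intro k hk
      simp only [if_pos hk]
      exact hsub k hk
    · intro k hk
      simp only [if_neg (show ¬ 1 ≤ k by omega), sub_zero]
      exact hsneg k hk
  have hinv : α < α⁻¹ := hα1.trans (one_lt_inv_iff₀.2 ⟨hα0, hα1⟩)
  refine ⟨hrefl, ⟨N, hsk⟩, fun x h1 h2 => ⟨hsum x h1 h2, ?_⟩⟩
  have hx : x ≠ 0 := norm_pos_iff.1 (hα0.trans h1)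
  refine theta_eq_const_mul_lambert hg he ha hF hDen hd hdr
    (lambertCoeff_shift hg hg1 hu hε ν) (n' := fun _ => 0)
    (fun k => by rw [add_zero]; exact hrefl k) huu hn
    (fun m => by simp) hx₀0
    (u₀ := α) hα0 hα1 (ℓ := fun k => if 1 ≤ k then lam k else 0) ?_ ?_ ?_ ?_ hPc hDc hD0
    hFc hR hC hx
    (hsum x h1 h2)
  · intro v hv hv'
    have hv0 : 0 < v := hα0.trans_le hv
    have hnorm : ‖(v : ℂ) * x₀‖ = v * α⁻¹ := by rw [norm_ofReal_mul_of_pos hv0, hx₀']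
    have hpos : 0 < ‖(v : ℂ) * x₀‖ := by
      rw [hnorm]
      positivity
    refine summable_laurent (s := fun k => if 1 ≤ k then lam k else 0) (M := M) hα0 (half_pos hpos)
      ?_ ?_ ?_ (half_lt_self hpos)
    · intro k hk
      simp only [if_pos hk]
      exact hlam k hk
    · intro k hk
      simp only [if_neg (show ¬ 1 ≤ k by omega), norm_zero]
      have := zpow_pos (half_pos hpos) (-k)
      positivity
    · rw [hnorm]
      field_simp
      exact hv'
  · exact hrsum x₀ (by rw [hx₀']; exact hinv) (by
      rw [hx₀', ← div_eq_mul_inv]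
      exact (div_lt_one hα0).2 hα')
  · have hnorm : ‖(α : ℂ) * x₀‖ = 1 := by rw [norm_ofReal_mul_of_pos hα0, hx₀]
    exact hrsum _ (by rw [hnorm]; exact hα1) (by rw [hnorm, mul_one]; exact hα'.trans hα1)
  · intro v hv hv'
    have hv0 : 0 < v := hα0.trans_le hv
    rw [← hP _ (mul_ne_zero (Complex.ofReal_ne_zero.2 hv0.ne') hx₀0) (by
      rw [norm_ofReal_mul_of_pos hv0, hx₀']
      field_simp
      exact hv')]
    congr 1
    refine tsum_congr fun k => ?_
    rw [ite_mul, zero_mul]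

/-! ### The Lambert series of the six pfaffian entries -/

/-- The Legendre symbol modulo `3`, with complex values. -/
noncomputable def chi (k : ℤ) : ℂ := ((legendreSym 3 k : ℤ) : ℂ)

theorem chi_add_three_mul (k j : ℤ) : chi (k + 3 * j) = chi k := by
  unfold chi
  rw [legendreSym.mod, legendreSym.mod 3 k]
  simp

theorem chi_zero : chi 0 = 0 := by
  simp [chi]

theorem chi_one : chi 1 = 1 := by
  simp [chi]

theorem chi_two : chi 2 = -1 := by
  have : legendreSym 3 2 = -1 := by norm_num
  simp [chi, this]

theorem chi_cases (k : ℤ) : (3 ∣ k ∧ chi k = 0) ∨ (3 ∣ k - 1 ∧ chi k = 1) ∨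
    (3 ∣ k - 2 ∧ chi k = -1) := by
  obtain ⟨j, hj⟩ : ∃ j : ℤ, k = 0 + 3 * j ∨ k = 1 + 3 * j ∨ k = 2 + 3 * j := ⟨k / 3, by omega⟩
  rcases hj with h | h | h
  · exact Or.inl ⟨⟨j, by omega⟩, by rw [h, chi_add_three_mul, chi_zero]⟩
  · exact Or.inr (Or.inl ⟨⟨j, by omega⟩, by rw [h, chi_add_three_mul, chi_one]⟩)
  · exact Or.inr (Or.inr ⟨⟨j, by omega⟩, by rw [h, chi_add_three_mul, chi_two]⟩)

theorem chi_congr {k l : ℤ} (h : 3 ∣ k - l) : chi k = chi l := by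
  obtain ⟨j, hj⟩ := h
  rw [show k = l + 3 * j by omega, chi_add_three_mul]

theorem chi_neg (k : ℤ) : chi (-k) = -chi k := by
  rcases chi_cases k with ⟨h, e⟩ | ⟨h, e⟩ | ⟨h, e⟩
  · rw [e, chi_congr (l := 0) (by omega), chi_zero, neg_zero]
  · rw [e, chi_congr (l := 2) (by omega), chi_two]
  · rw [e, chi_congr (l := 1) (by omega), chi_one, neg_neg]

theorem norm_chi_le (k : ℤ) : ‖chi k‖ ≤ 1 := by
  rcases chi_cases k with ⟨_, e⟩ | ⟨_, e⟩ | ⟨_, e⟩ <;> simp [e]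

theorem hasSum_periodic_three {c : ℕ → ℂ} (hc : ∀ n, c (n + 3) = c n) {y : ℂ} (hy : ‖y‖ < 1) :
    HasSum (fun n => c n * y ^ n) ((c 0 + c 1 * y + c 2 * y ^ 2) / (1 - y ^ 3)) := by
  have hb : ∀ n, ‖c n‖ ≤ ‖c 0‖ + ‖c 1‖ + ‖c 2‖ := by
    intro n
    induction n using Nat.strong_induction_on with
    | _ n ih =>
      match n with
      | 0 => linarith [norm_nonneg (c 1), norm_nonneg (c 2)]
      | 1 => linarith [norm_nonneg (c 0), norm_nonneg (c 2)]
      | 2 => linarith [norm_nonneg (c 0), norm_nonneg (c 1)]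
      | n + 3 =>
        rw [hc]
        exact ih n (by omega)
  have hs : Summable fun n => c n * y ^ n := by
    refine Summable.of_norm_bounded
      ((summable_geometric_of_lt_one (norm_nonneg y) hy).mul_left (‖c 0‖ + ‖c 1‖ + ‖c 2‖))
      fun n => ?_
    rw [norm_mul, norm_pow]
    exact mul_le_mul_of_nonneg_right (hb n) (by positivity)
  have h1 := hs.sum_add_tsum_nat_add 3
  have h2 : ∑' n, c (n + 3) * y ^ (n + 3) = y ^ 3 * ∑' n, c n * y ^ n := by
    rw [← tsum_mul_left]
    refine tsum_congr fun n => ?_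
    rw [hc]
    ring
  rw [h2] at h1
  simp only [Finset.sum_range_succ, Finset.sum_range_zero] at h1
  have h3 : 1 - y ^ 3 ≠ 0 := by
    have := one_sub_pow_succ_ne_zero hy 2
    simpa using this
  have h4 : ∑' n, c n * y ^ n = (c 0 + c 1 * y + c 2 * y ^ 2) / (1 - y ^ 3) := by
    rw [eq_div_iff h3]
    linear_combination -h1
  rw [← h4]
  exact hs.hasSum

/-- Combinations of two geometric sequences annihilated by `d` are annihilated by `d`. -/
theorem hasSum_mul_annihilated {d : ℤ → ℂ} {ρ₁ ρ₂ : ℂ} {m : ℤ}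
    (h1 : HasSum (fun k : ℤ => d (m - k) * ρ₁ ^ k) 0)
    (h2 : HasSum (fun k : ℤ => d (m - k) * ρ₂ ^ k) 0) (c₁ c₂ : ℂ) :
    HasSum (fun k : ℤ => d (m - k) * (c₁ * ρ₁ ^ k + c₂ * ρ₂ ^ k)) 0 := by
  have := (h1.mul_left c₁).add (h2.mul_left c₂)
  rw [mul_zero, mul_zero, add_zero] at this
  refine this.congr_fun fun k => ?_
  ring

theorem inv_ne_zero_and_norm {g : ℂ} (hg : g ≠ 0) : g⁻¹ ≠ 0 ∧ ‖g‖ * ‖g⁻¹‖ = 1 :=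
  ⟨inv_ne_zero hg, by rw [norm_inv]; exact mul_inv_cancel₀ (norm_ne_zero_iff.2 hg)⟩

theorem ContinuousAt.qPoch {q : ℂ} (hq : ‖q‖ < 1) {f : ℂ → ℂ} {x : ℂ} (hf : ContinuousAt f x) :
    ContinuousAt (fun x => qPoch (f x) q) x :=
  (differentiable_qPoch hq).continuous.continuousAt.comp_of_eq hf rfl

theorem ContinuousAt.qTheta {q : ℂ} (hq : ‖q‖ < 1) {f : ℂ → ℂ} {x : ℂ} (hf : ContinuousAt f x)
    (hx : f x ≠ 0) : ContinuousAt (fun x => qTheta (f x) q) x :=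
  (continuousAt_qTheta hq hx).comp_of_eq hf rfl

/-- The labels `0` (`ε = 0`) and `6` (`ε = 1`). The pole used to determine the constant is
`x₀ = g⁻¹`. -/
theorem lambert_zero_six {g : ℂ} (hg : g ≠ 0) (hg1 : ‖g‖ < 1) {ε : ℤ} (hε : ε = 0 ∨ ε = 1)
    {a : ℤ → ℂ} {F : ℂ → ℂ} (ha : IsOddTheta g ε a)
    (hF : ∀ x, x ≠ 0 → HasSum (fun k : ℤ => a k * x ^ k) (F x)) (hFc : ContinuousAt F g⁻¹) {C : ℂ}
    (hC : F g⁻¹ = C * (g⁻¹ * qPoch (g ^ 2) (g ^ 2) ^ 2)) {s : ℤ → ℂ}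
    (hs : s = lambertCoeff g (-1) ε fun k => g ^ (k - 1) - g ^ (5 * k - 1 - 2 * ε)) :
    (∀ k : ℤ, s (ε - k) = -s k) ∧ (∃ M : ℝ, ∀ k : ℤ, 1 ≤ k → ‖s k‖ ≤ M * ‖g‖ ^ k) ∧
    ∀ x : ℂ, ‖g‖ < ‖x‖ → ‖g‖ * ‖x‖ < 1 → (Summable fun k : ℤ => s k * x ^ k) ∧
      F x = C * (qTheta (g * x) (g ^ 2) * ∑' k : ℤ, s k * x ^ k) := by
  subst hs
  obtain ⟨K, hK⟩ := hasSum_qTheta_den_zero hg hg1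
  have hG : 0 < ‖g‖ := norm_pos_iff.2 hg
  have hq := norm_pow_lt_one' hg1 (two_ne_zero)
  have hnorm : ∀ m : ℤ, ‖g ^ m‖ = ‖g‖ ^ m := fun m => norm_zpow g m
  have hle : ∀ a b : ℤ, b ≤ a → ‖g‖ ^ a ≤ ‖g‖ ^ b := fun a b h =>
    zpow_le_zpow_right_of_le_one₀ hG hg1.le h
  -- The denominator vanishes at all odd powers of `g`.
  have hann : ∀ i : ℤ, Odd i → ∀ m, HasSum (fun k : ℤ => (fun k : ℤ => K * ((-1) ^ k * g ^ (k * k)))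
      (m - k) * (g ^ (-i)) ^ k) 0 := by
    intro i hi m
    refine hasSum_annihilated (d := fun k : ℤ => K * ((-1) ^ k * g ^ (k * k)))
      (zpow_ne_zero _ hg) (hK _ (inv_ne_zero (zpow_ne_zero _ hg))).summable
      (-i) (fun k => ?_) m
    rw [neg_one_zpow_eq_of_odd (a := -i - k) (b := k) (by
      obtain ⟨j, rfl⟩ := hi
      exact ⟨-j - k - 1, by ring⟩), ← zpow_mul,
      zpow_expand hg (k * k) (show k * k = (-i - k) * (-i - k) + -i * (2 * k - -i) by ring)]
    ring
  have hD : ∀ x : ℂ, qTheta (g * x) (g ^ 2) =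
      (1 - g * x) * (qPoch (g ^ 3 * x) (g ^ 2) * qPoch (g ^ 2 / (g * x)) (g ^ 2)) := by
    intro x
    unfold qTheta
    rw [qPoch_eq_mul hq (g * x), show g * x * g ^ 2 = g ^ 3 * x by ring, mul_assoc]
  obtain ⟨hx0, hx0n⟩ := inv_ne_zero_and_norm hg
  have hP0 : g⁻¹ * (qPoch (g ^ 3 * g⁻¹) (g ^ 2) * qPoch (g ^ 2 / (g * g⁻¹)) (g ^ 2)) =
      g⁻¹ * qPoch (g ^ 2) (g ^ 2) ^ 2 := by
    rw [mul_inv_cancel₀ hg, div_one, show g ^ 3 * g⁻¹ = g ^ 2 by field_simp]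
    ring
  refine lambert_identity (δ := 0) (a := a) (F := F) (u := -1)
    (d := fun k => K * ((-1) ^ k * g ^ (k * k))) (Den := fun x => qTheta (g * x) (g ^ 2))
    (ν := fun k => g ^ (k - 1) - g ^ (5 * k - 1 - 2 * ε)) hg hg1 (by omega) (Or.inr rfl)
    (by rcases hε with rfl | rfl <;> simp) (by rwa [sub_zero]) hF hK ?_ ?_ ?_ ?_
    (M := 2 * ‖g‖ ^ (-3 : ℤ)) (α := ‖g‖) (α' := ‖g‖ ^ (5 : ℤ)) (by positivity) ?_ hg1
    (lam := fun k => g ^ (k - 1)) ?_ ?_ (x₀ := g⁻¹) hx0n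
    (P := fun x => x * (qPoch (g ^ 3 * x) (g ^ 2) * qPoch (g ^ 2 / (g * x)) (g ^ 2)))
    ?_ ?_ ?_ ?_ hFc ?_ ?_
  · intro k
    rw [neg_one_zpow_eq_of_odd (a := k + 3) (b := k) ⟨1, by ring⟩,
      zpow_expand hg ((k + 3) * (k + 3))
        (show (k + 3) * (k + 3) = (6 * k + 9 + 3 * 0) + k * k by ring)]
    ring
  · intro k
    rw [neg_one_zpow_eq_of_even (a := -0 - k) (b := k) ⟨-k, by ring⟩,
      show (-0 - k) * (-0 - k) = k * k by ring]
  · intro k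
    rw [zpow_expand hg (k - 1) (show k - 1 = (5 * (ε - k) - 1 - 2 * ε) + (6 * k - 3 * ε) by ring),
      zpow_expand hg (5 * k - 1 - 2 * ε)
        (show 5 * k - 1 - 2 * ε = (ε - k - 1) + (6 * k - 3 * ε) by ring)]
    ring
  · intro m
    refine (hasSum_mul_annihilated (d := fun k : ℤ => K * ((-1) ^ k * g ^ (k * k)))
      (ρ₁ := g ^ (-5 : ℤ)) (ρ₂ := g ^ (-1 : ℤ)) (hann 5 (by decide) m) (hann 1 (by decide) m)
      (g ^ (3 * ε - 1)) (-g ^ (ε - 1))).congr_fun fun k => ?_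
    congr 1
    rw [← zpow_mul, ← zpow_mul, mul_sub, ← zpow_add₀ hg, ← zpow_add₀ hg,
      zpow_expand hg (-(6 * k - 3 * ε) + (k - 1)) (show _ = (3 * ε - 1) + -5 * k by ring),
      zpow_expand hg (-(6 * k - 3 * ε) + (5 * k - 1 - 2 * ε)) (show _ = (ε - 1) + -1 * k by ring)]
    ring
  · rw [zpow_ofNat]
    exact pow_lt_self_of_lt_one₀ hG hg1 (by norm_num)
  · intro k hk
    rw [hnorm, mul_assoc, ← zpow_add₀ hG.ne']
    have := hle (k - 1) (-3 + k) (by omega)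
    have := zpow_pos hG (-3 + k)
    linarith
  · intro k hk
    have e : g ^ (k - 1) - g ^ (5 * k - 1 - 2 * ε) - g ^ (k - 1) +
        -1 * g ^ (k - 1) * g ^ (6 * k - 3 * ε) =
        -(g ^ (5 * k - 1 - 2 * ε) + g ^ (7 * k - 1 - 3 * ε)) := by
      rw [zpow_expand hg (7 * k - 1 - 3 * ε)
        (show 7 * k - 1 - 3 * ε = (k - 1) + (6 * k - 3 * ε) by ring)]
      ring
    rw [e, norm_neg, ← zpow_mul, mul_assoc, ← zpow_add₀ hG.ne']
    refine (norm_add_le _ _).trans ?_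
    rw [hnorm, hnorm]
    have h1 := hle (5 * k - 1 - 2 * ε) (-3 + 5 * k) (by omega)
    have h2 := hle (7 * k - 1 - 3 * ε) (-3 + 5 * k) (by omega)
    linarith
  · intro x hx hxn
    have hy : ‖g * x‖ < 1 := by rwa [norm_mul]
    have hne : 1 - g * x ≠ 0 := by simpa using one_sub_pow_succ_ne_zero hy 0
    have h := hasSum_int_of_pos (f := fun k => g ^ (k - 1) * x ^ k) (F := x * (1 - g * x)⁻¹)
      (((hasSum_geometric_of_norm_lt_one hy).mul_left x).congr_fun fun n => by
        rw [add_sub_cancel_right, zpow_natCast, zpow_add₀ hx, zpow_natCast, zpow_one, mul_pow]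
        ring)
    rw [h.tsum_eq, hD]
    field_simp
  · exact continuousAt_id.mul ((ContinuousAt.qPoch hq (by fun_prop)).mul
      (ContinuousAt.qPoch hq (continuousAt_const.div (by fun_prop) (mul_ne_zero hg hx0))))
  · exact ContinuousAt.qTheta hq (by fun_prop) (mul_ne_zero hg hx0)
  · rw [hD, mul_inv_cancel₀ hg, sub_self, zero_mul]
  · rw [hP0]
    exact mul_ne_zero hx0 (pow_ne_zero _ (qPoch_ne_zero_of_norm_lt hq hq))
  · rw [hC, hP0]

/-- The generating function of the Legendre symbol modulo `3`, shifted by `ε`. -/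
theorem hasSum_chi_mul_pow (ε : ℤ) {y : ℂ} (hy : ‖y‖ < 1) :
    HasSum (fun n : ℕ => chi ((n + 1 : ℤ) + ε) * y ^ (n + 1))
      (y * (chi (1 + ε) + chi (2 + ε) * y + chi (3 + ε) * y ^ 2) / (1 - y ^ 3)) := by
  have h := (hasSum_periodic_three (c := fun n => chi ((n + 1 : ℤ) + ε)) (fun n => by
    refine chi_congr ?_
    push_cast
    exact ⟨1, by ring⟩) hy).mul_left y
  have e : y * ((chi (((0 : ℕ) + 1 : ℤ) + ε) + chi (((1 : ℕ) + 1 : ℤ) + ε) * y +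
      chi (((2 : ℕ) + 1 : ℤ) + ε) * y ^ 2) / (1 - y ^ 3)) =
      y * (chi (1 + ε) + chi (2 + ε) * y + chi (3 + ε) * y ^ 2) / (1 - y ^ 3) := by
    rw [mul_div_assoc]
    norm_num
  rw [e] at h
  refine h.congr_fun fun n => ?_
  ring

theorem cube_root_facts {ω : ℂ} (hω : 1 + ω + ω ^ 2 = 0) : ω ^ 3 = 1 ∧ ω ≠ 0 ∧ ‖ω‖ = 1 ∧ ω ≠ 1 := by
  have h3 : ω ^ 3 = 1 := by linear_combination (ω - 1) * hω
  refine ⟨h3, ?_, ?_, ?_⟩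
  · rintro rfl
    norm_num at h3
  · exact Complex.norm_eq_one_of_pow_eq_one h3 (by norm_num)
  · rintro rfl
    norm_num at hω

theorem chi_sum_ne_zero {ω : ℂ} (hω : 1 + ω + ω ^ 2 = 0) {ε : ℤ} (hε : ε = 0 ∨ ε = 1) :
    ω * (chi (1 + ε) + chi (2 + ε) * ω + chi (3 + ε) * ω ^ 2) ≠ 0 := by
  obtain ⟨h3, h0, -, h1⟩ := cube_root_facts hω
  have e0 : chi 3 = 0 := by rw [chi_congr (l := 0) (by norm_num), chi_zero]
  have e1 : chi 4 = 1 := by rw [chi_congr (l := 1) (by norm_num), chi_one]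
  rcases hε with rfl | rfl
  · norm_num [chi_one, chi_two, e0]
    refine ⟨h0, fun h => h1 ?_⟩
    linear_combination -h
  · norm_num [chi_two, e0, e1]
    refine ⟨h0, fun h => h1 ?_⟩
    linear_combination h3 - ω * h

/-- The labels `4` (`ε = 0`) and `2` (`ε = 1`). The denominator is a function of `x ^ 3` and the
numerators `ν` depend on `k` modulo `3`, so on each residue class a single geometric sequence has to
be annihilated. The pole used to determine the constant is `x₀ = ω g ^ (-3)`, with `ω` a primitive
cube root of unity. -/
theorem lambert_four_two {g : ℂ} (hg : g ≠ 0) (hg1 : ‖g‖ < 1) {ω : ℂ} (hω : 1 + ω + ω ^ 2 = 0)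
    {ε : ℤ} (hε : ε = 0 ∨ ε = 1) {a : ℤ → ℂ} {F : ℂ → ℂ} (ha : IsOddTheta g ε a)
    (hF : ∀ x, x ≠ 0 → HasSum (fun k : ℤ => a k * x ^ k) (F x))
    (hFc : ContinuousAt F (ω / g ^ 3)) {C : ℂ}
    (hC : F (ω / g ^ 3) = C * ((g ^ 3)⁻¹ *
      (ω * (chi (1 + ε) + chi (2 + ε) * ω + chi (3 + ε) * ω ^ 2)) *
        qPoch (g ^ 18) (g ^ 18) ^ 2)) {s : ℤ → ℂ}
    (hs : s = lambertCoeff g (-1) ε fun k => chi (k + ε) * g ^ (3 * k - 3)) :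
    (∀ k : ℤ, s (ε - k) = -s k) ∧ (∃ M : ℝ, ∀ k : ℤ, 1 ≤ k → ‖s k‖ ≤ M * (‖g‖ ^ 3) ^ k) ∧
    ∀ x : ℂ, ‖g‖ ^ 3 < ‖x‖ → ‖g‖ ^ 3 * ‖x‖ < 1 → (Summable fun k : ℤ => s k * x ^ k) ∧
      F x = C * (qTheta (g ^ 9 * x ^ 3) (g ^ 18) * ∑' k : ℤ, s k * x ^ k) := by
  subst hs
  obtain ⟨K, hK⟩ := hasSum_qTheta_den_four hg hg1
  obtain ⟨hω3, hω0, hωn, hω1⟩ := cube_root_facts hω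
  have hG : 0 < ‖g‖ := norm_pos_iff.2 hg
  have hq := norm_pow_lt_one' hg1 (show 18 ≠ 0 by norm_num)
  have hg3 : g ^ 3 ≠ 0 := pow_ne_zero _ hg
  have hx0 : ω / g ^ 3 ≠ 0 := div_ne_zero hω0 hg3
  have hnorm : ∀ m : ℤ, ‖g ^ m‖ = ‖g‖ ^ m := fun m => norm_zpow g m
  have hle : ∀ a b : ℤ, b ≤ a → ‖g‖ ^ a ≤ ‖g‖ ^ b := fun a b h =>
    zpow_le_zpow_right_of_le_one₀ hG hg1.le h
  have hα : ∀ (n : ℕ) (k : ℤ), (‖g‖ ^ n) ^ k = ‖g‖ ^ (n * k) := fun n k => by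
    rw [← zpow_natCast, ← zpow_mul]
  have hY : ∀ x : ℂ, g ^ 9 * x ^ 3 = (g ^ 3 * x) ^ 3 := fun x => by ring
  have hν : ∀ k : ℤ, ‖chi (k + ε) * g ^ (3 * k - 3)‖ ≤ ‖g‖ ^ (3 * k - 3) := fun k => by
    rw [norm_mul, hnorm]
    exact mul_le_of_le_one_left (zpow_nonneg hG.le _) (norm_chi_le _)
  have hD : ∀ x : ℂ, qTheta (g ^ 9 * x ^ 3) (g ^ 18) = (1 - (g ^ 3 * x) ^ 3) *
      (qPoch (g ^ 27 * x ^ 3) (g ^ 18) * qPoch (g ^ 18 / (g ^ 9 * x ^ 3)) (g ^ 18)) := by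
    intro x
    unfold qTheta
    rw [qPoch_eq_mul hq (g ^ 9 * x ^ 3), show g ^ 9 * x ^ 3 * g ^ 18 = g ^ 27 * x ^ 3 by ring,
      hY, mul_assoc]
  have hy0 : g ^ 3 * (ω / g ^ 3) = ω := mul_div_cancel₀ _ hg3
  have h9 : g ^ 9 * (ω / g ^ 3) ^ 3 = 1 := by rw [hY, hy0, hω3]
  have hP0 : (g ^ 3)⁻¹ * ((g ^ 3 * (ω / g ^ 3)) * (chi (1 + ε) + chi (2 + ε) * (g ^ 3 * (ω / g ^ 3))
      + chi (3 + ε) * (g ^ 3 * (ω / g ^ 3)) ^ 2)) * (qPoch (g ^ 27 * (ω / g ^ 3) ^ 3) (g ^ 18) *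
        qPoch (g ^ 18 / (g ^ 9 * (ω / g ^ 3) ^ 3)) (g ^ 18)) =
      (g ^ 3)⁻¹ * (ω * (chi (1 + ε) + chi (2 + ε) * ω + chi (3 + ε) * ω ^ 2)) *
        qPoch (g ^ 18) (g ^ 18) ^ 2 := by
    rw [hy0, h9, div_one,
      show g ^ 27 * (ω / g ^ 3) ^ 3 = g ^ 18 * (g ^ 9 * (ω / g ^ 3) ^ 3) by ring,
      h9, mul_one]
    ring
  refine lambert_identity (δ := 0) (a := a) (F := F) (u := -1)
    (d := fun k => if (3 : ℤ) ∣ k then K * ((-1) ^ k * g ^ (k * k)) else 0)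
    (Den := fun x => qTheta (g ^ 9 * x ^ 3) (g ^ 18))
    (ν := fun k => chi (k + ε) * g ^ (3 * k - 3)) hg hg1 (by omega) (Or.inr rfl)
    (by rcases hε with rfl | rfl <;> simp) (by rwa [sub_zero]) hF hK ?_ ?_ ?_ ?_
    (M := ‖g‖ ^ (-6 : ℤ)) (α := ‖g‖ ^ 3) (α' := ‖g‖ ^ 9) (by positivity) ?_
    (pow_lt_one₀ hG.le hg1 (by norm_num))
    (lam := fun k => chi (k + ε) * g ^ (3 * k - 3)) ?_ ?_ (x₀ := ω / g ^ 3) ?_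
    (P := fun x => (g ^ 3)⁻¹ * ((g ^ 3 * x) * (chi (1 + ε) + chi (2 + ε) * (g ^ 3 * x) +
      chi (3 + ε) * (g ^ 3 * x) ^ 2)) *
      (qPoch (g ^ 27 * x ^ 3) (g ^ 18) * qPoch (g ^ 18 / (g ^ 9 * x ^ 3)) (g ^ 18)))
    ?_ ?_ ?_ ?_ hFc ?_ ?_
  · intro k
    by_cases h : (3 : ℤ) ∣ k
    swap
    · rw [if_neg h, if_neg (by omega), mul_zero]
    rw [if_pos h, if_pos (by omega), neg_one_zpow_eq_of_odd (a := k + 3) (b := k) ⟨1, by ring⟩,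
      zpow_expand hg ((k + 3) * (k + 3))
        (show (k + 3) * (k + 3) = (6 * k + 9 + 3 * 0) + k * k by ring)]
    ring
  · intro k
    refine if_ctx_congr ⟨fun h => by omega, fun h => by omega⟩ (fun _ => ?_) fun _ => rfl
    rw [neg_one_zpow_eq_of_even (a := -0 - k) (b := k) ⟨-k, by ring⟩,
      show (-0 - k) * (-0 - k) = k * k by ring]
  · intro k
    rw [show ε - k + ε = -(k + ε + 3 * (-ε)) by ring, chi_neg, chi_add_three_mul,
      zpow_expand hg (3 * k - 3) (show 3 * k - 3 = (3 * (ε - k) - 3) + (6 * k - 3 * ε) by ring)]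
    ring
  · intro m
    have h := (hasSum_annihilated
      (d := fun k : ℤ => if (3 : ℤ) ∣ k then K * ((-1) ^ k * g ^ (k * k)) else 0)
      (ρ := g ^ (-3 : ℤ)) (zpow_ne_zero _ hg)
      (hK _ (inv_ne_zero (zpow_ne_zero _ hg))).summable (-3) (fun k => by
        by_cases h : (3 : ℤ) ∣ k
        swap
        · rw [if_neg h, if_neg (by omega), zero_mul, neg_zero]
        rw [if_pos h, if_pos (by omega),
          neg_one_zpow_eq_of_odd (a := -3 - k) (b := k) ⟨-k - 2, by ring⟩, ← zpow_mul,
          zpow_expand hg (k * k)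
            (show k * k = (-3 - k) * (-3 - k) + -3 * (2 * k - -3) by ring)]
        ring) m).mul_left (chi (m + ε) * g ^ (3 * ε - 3))
    rw [mul_zero] at h
    refine h.congr_fun fun k => ?_
    -- On the support of `fun k => d (m - k)` the symbol `chi (k + ε)` is constant.
    by_cases hk : (3 : ℤ) ∣ m - k
    · simp only [if_pos hk]
      rw [← zpow_mul, chi_congr (k := k + ε) (l := m + ε) (by omega)]
      have e : g ^ (-(6 * k - 3 * ε)) * g ^ (3 * k - 3) = g ^ (3 * ε - 3) * g ^ (-3 * k) := by
        rw [← zpow_add₀ hg, ← zpow_add₀ hg]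
        congr 1
        ring
      linear_combination (K * ((-1) ^ (m - k) * g ^ ((m - k) * (m - k)))) * chi (m + ε) * e
    · simp only [if_neg hk, zero_mul, mul_zero]
  · exact pow_lt_pow_right_of_lt_one₀ hG hg1 (by norm_num)
  · intro k hk
    rw [hα, ← zpow_add₀ hG.ne']
    exact (hν k).trans (hle _ _ (by push_cast; omega))
  · intro k hk
    rw [sub_self, zero_add, hα, ← zpow_add₀ hG.ne', neg_one_mul, neg_mul, norm_neg, norm_mul, hnorm]
    refine (mul_le_mul_of_nonneg_right (hν k) (zpow_nonneg hG.le _)).trans ?_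
    rw [← zpow_add₀ hG.ne']
    exact hle _ _ (by push_cast; omega)
  · rw [norm_div, hωn, norm_pow]
    field_simp
  · intro x hx hxn
    have hy : ‖g ^ 3 * x‖ < 1 := by rwa [norm_mul, norm_pow]
    have hne : 1 - (g ^ 3 * x) ^ 3 ≠ 0 := one_sub_pow_succ_ne_zero hy 2
    have h := hasSum_int_of_pos (f := fun k => chi (k + ε) * g ^ (3 * k - 3) * x ^ k)
      (((hasSum_chi_mul_pow ε hy).mul_left (g ^ 3)⁻¹).congr_fun fun n => by
        have e : g ^ (3 * ((n : ℤ) + 1) - 3) = (g ^ 3)⁻¹ * (g ^ 3) ^ (n + 1) := by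
          rw [show 3 * ((n : ℤ) + 1) - 3 = ((3 * n : ℕ) : ℤ) by push_cast; ring, zpow_natCast,
            pow_mul, pow_succ _ n, mul_comm _ (g ^ 3), inv_mul_cancel_left₀ hg3]
        rw [e, show ((n : ℤ) + 1) = ((n + 1 : ℕ) : ℤ) by push_cast; rfl, zpow_natCast, mul_pow]
        ring)
    rw [h.tsum_eq, hD]
    generalize 1 - (g ^ 3 * x) ^ 3 = E at hne
    field_simp
  · have hc : ContinuousAt (fun x => g ^ 18 / (g ^ 9 * x ^ 3)) (ω / g ^ 3) :=
      continuousAt_const.div (by fun_prop) (by rw [h9]; exact one_ne_zero)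
    have hc2 : ContinuousAt (fun x : ℂ => (g ^ 3)⁻¹ * ((g ^ 3 * x) * (chi (1 + ε) +
      chi (2 + ε) * (g ^ 3 * x) + chi (3 + ε) * (g ^ 3 * x) ^ 2))) (ω / g ^ 3) := by fun_prop
    exact hc2.mul ((ContinuousAt.qPoch hq (by fun_prop)).mul (ContinuousAt.qPoch hq hc))
  · exact ContinuousAt.qTheta hq (by fun_prop) (by rw [h9]; exact one_ne_zero)
  · rw [hD, hy0, hω3, sub_self, zero_mul]
  · rw [hP0]
    exact mul_ne_zero (mul_ne_zero (inv_ne_zero hg3) (chi_sum_ne_zero hω hε))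
      (pow_ne_zero _ (qPoch_ne_zero_of_norm_lt hq hq))
  · rw [hC, hP0]

/-- The label `3`. The pole used to determine the constant is `x₀ = -g ^ (-2)`. -/
theorem lambert_three {g : ℂ} (hg : g ≠ 0) (hg1 : ‖g‖ < 1)
    {a : ℤ → ℂ} {F : ℂ → ℂ} (ha : IsOddTheta g 0 a)
    (hF : ∀ x, x ≠ 0 → HasSum (fun k : ℤ => a k * x ^ k) (F x))
    (hFc : ContinuousAt F (-(g ^ 2)⁻¹)) {C : ℂ}
    (hC : F (-(g ^ 2)⁻¹) = C * ((g ^ 2)⁻¹ * qPoch (g ^ 2) (g ^ 2) ^ 2)) {s : ℤ → ℂ}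
    (hs : s = lambertCoeff g 1 1 fun k => (-1) ^ k * (g ^ (2 * k - 2) - g ^ (4 * k - 3))) :
    (∀ k : ℤ, s (1 - k) = -s k) ∧ (∃ M : ℝ, ∀ k : ℤ, 1 ≤ k → ‖s k‖ ≤ M * (‖g‖ ^ 2) ^ k) ∧
    ∀ x : ℂ, ‖g‖ ^ 2 < ‖x‖ → ‖g‖ ^ 2 * ‖x‖ < 1 → (Summable fun k : ℤ => s k * x ^ k) ∧
      F x = C * (x⁻¹ * qTheta (-x) (g ^ 2) * ∑' k : ℤ, s k * x ^ k) := by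
  subst hs
  obtain ⟨K, hK⟩ := hasSum_qTheta_den_three hg hg1
  have hG : 0 < ‖g‖ := norm_pos_iff.2 hg
  have hq := norm_pow_lt_one' hg1 (show 2 ≠ 0 by norm_num)
  have hg2 : g ^ 2 ≠ 0 := pow_ne_zero _ hg
  have hx0 : -(g ^ 2)⁻¹ ≠ 0 := neg_ne_zero.2 (inv_ne_zero hg2)
  have hnorm : ∀ m : ℤ, ‖g ^ m‖ = ‖g‖ ^ m := fun m => norm_zpow g m
  have hsgn : ∀ (k : ℤ) (z : ℂ), ‖(-1) ^ k * z‖ = ‖z‖ := fun k z => by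
    rw [norm_mul, norm_zpow, norm_neg, norm_one, one_zpow, one_mul]
  have hle : ∀ a b : ℤ, b ≤ a → ‖g‖ ^ a ≤ ‖g‖ ^ b := fun a b h =>
    zpow_le_zpow_right_of_le_one₀ hG hg1.le h
  have hα : ∀ (n : ℕ) (k : ℤ), (‖g‖ ^ n) ^ k = ‖g‖ ^ (n * k) := fun n k => by
    rw [← zpow_natCast, ← zpow_mul]
  -- The denominator vanishes at `-g ^ (2 * i)`.
  have hann : ∀ i : ℤ, ∀ m, HasSum (fun k : ℤ => (fun k : ℤ => K * g ^ (k * k + k))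
      (m - k) * (-g ^ (-(2 * i))) ^ k) 0 := by
    intro i m
    refine hasSum_annihilated (d := fun k : ℤ => K * g ^ (k * k + k))
      (neg_ne_zero.2 (zpow_ne_zero _ hg))
      (hK _ (inv_ne_zero (neg_ne_zero.2 (zpow_ne_zero _ hg)))).summable
      (-(2 * i + 1)) (fun k => ?_) m
    rw [← neg_one_mul (g ^ (-(2 * i))), mul_zpow, ← zpow_mul,
      neg_one_zpow_eq_of_odd (a := 2 * k - -(2 * i + 1)) (b := 0) ⟨k + i, by ring⟩,
      zpow_expand hg (k * k + k) (show k * k + k = ((-(2 * i + 1) - k) * (-(2 * i + 1) - k) +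
        (-(2 * i + 1) - k)) + -(2 * i) * (2 * k - -(2 * i + 1)) by ring), zpow_zero]
    ring
  have hD : ∀ x : ℂ, x⁻¹ * qTheta (-x) (g ^ 2) =
      x⁻¹ * (1 + x) * (1 + g ^ 2 * x) *
        (qPoch (-(g ^ 4 * x)) (g ^ 2) * qPoch (g ^ 2 / (-x)) (g ^ 2)) := by
    intro x
    unfold qTheta
    rw [qPoch_eq_mul hq (-x), qPoch_eq_mul hq (-x * g ^ 2),
      show -x * g ^ 2 * g ^ 2 = -(g ^ 4 * x) by ring]
    ring
  have hP0 : -(1 + -(g ^ 2)⁻¹) * (qPoch (-(g ^ 4 * -(g ^ 2)⁻¹)) (g ^ 2) *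
      qPoch (g ^ 2 / (- -(g ^ 2)⁻¹)) (g ^ 2)) = (g ^ 2)⁻¹ * qPoch (g ^ 2) (g ^ 2) ^ 2 := by
    rw [show -(g ^ 4 * -(g ^ 2)⁻¹) = g ^ 2 by field_simp,
      show g ^ 2 / (- -(g ^ 2)⁻¹) = g ^ 2 * g ^ 2 by field_simp]
    have e := qPoch_eq_mul hq (g ^ 2)
    have e2 : -(1 + -(g ^ 2)⁻¹) = (g ^ 2)⁻¹ * (1 - g ^ 2) := by field_simp; ring
    rw [e2]
    linear_combination -((g ^ 2)⁻¹ * qPoch (g ^ 2) (g ^ 2)) * e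
  refine lambert_identity (δ := 1) (a := a) (F := F) (u := 1)
    (d := fun k => K * g ^ (k * k + k)) (Den := fun x => x⁻¹ * qTheta (-x) (g ^ 2))
    (ν := fun k => (-1) ^ k * (g ^ (2 * k - 2) - g ^ (4 * k - 3))) hg hg1 (by omega) (Or.inl rfl)
    (Or.inl rfl) (by rwa [sub_self]) hF hK ?_ ?_ ?_ ?_
    (M := 2 * ‖g‖ ^ (-5 : ℤ)) (α := ‖g‖ ^ 2) (α' := ‖g‖ ^ 4) (by positivity) ?_
    (pow_lt_one₀ hG.le hg1 (by norm_num))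
    (lam := fun k => (-1) ^ k * g ^ (2 * k - 2)) ?_ ?_ (x₀ := -(g ^ 2)⁻¹) ?_
    (P := fun x => -(1 + x) * (qPoch (-(g ^ 4 * x)) (g ^ 2) * qPoch (g ^ 2 / (-x)) (g ^ 2)))
    ?_ ?_ ?_ ?_ hFc ?_ ?_
  · intro k
    rw [zpow_expand hg ((k + 3) * (k + 3) + (k + 3))
      (show (k + 3) * (k + 3) + (k + 3) = (6 * k + 9 + 3 * 1) + (k * k + k) by ring)]
    ring
  · intro k
    rw [show (-1 - k) * (-1 - k) + (-1 - k) = k * k + k by ring]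
  · intro k
    rw [neg_one_zpow_eq_of_odd (a := 1 - k) (b := k) ⟨-k, by ring⟩,
      zpow_expand hg (2 * k - 2) (show 2 * k - 2 = (4 * (1 - k) - 3) + (6 * k - 3 * 1) by ring),
      zpow_expand hg (4 * k - 3) (show 4 * k - 3 = (2 * (1 - k) - 2) + (6 * k - 3 * 1) by ring)]
    ring
  · intro m
    refine (hasSum_mul_annihilated (d := fun k : ℤ => K * g ^ (k * k + k))
      (ρ₁ := -g ^ (-(2 * 2) : ℤ)) (ρ₂ := -g ^ (-(2 * 1) : ℤ)) (hann 2 m) (hann 1 m)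
      g (-1)).congr_fun fun k => ?_
    congr 1
    have e : ∀ j : ℤ, (-g ^ j) ^ k = (-1) ^ k * g ^ (j * k) := fun j => by
      rw [← neg_one_mul, mul_zpow, zpow_mul]
    rw [e, e,
      zpow_expand hg (2 * k - 2) (show 2 * k - 2 = (6 * k - 3 * 1) + 1 + -(2 * 2) * k by ring),
      zpow_expand hg (4 * k - 3) (show 4 * k - 3 = (6 * k - 3 * 1) + -(2 * 1) * k by ring),
      zpow_add₀ hg, zpow_one, zpow_neg]
    have := zpow_ne_zero (6 * k - 3 * 1) hg
    field_simp
    ring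
  · exact pow_lt_pow_right_of_lt_one₀ hG hg1 (by norm_num)
  · intro k hk
    rw [hsgn, hnorm, hα, mul_assoc, ← zpow_add₀ hG.ne']
    have := hle (2 * k - 2) (-5 + ((2 : ℕ) : ℤ) * k) (by push_cast; omega)
    have := zpow_pos hG (-5 + ((2 : ℕ) : ℤ) * k)
    linarith
  · intro k hk
    have e : (-1) ^ k * (g ^ (2 * k - 2) - g ^ (4 * k - 3)) - (-1) ^ k * g ^ (2 * k - 2) +
        1 * ((-1) ^ k * g ^ (2 * k - 2)) * g ^ (6 * k - 3 * 1) =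
        (-1) ^ k * (g ^ (8 * k - 5) - g ^ (4 * k - 3)) := by
      rw [zpow_expand hg (8 * k - 5) (show 8 * k - 5 = (2 * k - 2) + (6 * k - 3 * 1) by ring)]
      ring
    rw [e, hsgn, hα, mul_assoc, ← zpow_add₀ hG.ne']
    refine (norm_sub_le _ _).trans ?_
    rw [hnorm, hnorm]
    have h1 := hle (8 * k - 5) (-5 + ((4 : ℕ) : ℤ) * k) (by push_cast; omega)
    have h2 := hle (4 * k - 3) (-5 + ((4 : ℕ) : ℤ) * k) (by push_cast; omega)
    linarith
  · rw [norm_neg, norm_inv, norm_pow]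
    field_simp
  · intro x hx hxn
    have hy : ‖-(g ^ 2 * x)‖ < 1 := by rwa [norm_neg, norm_mul, norm_pow]
    have hne : 1 + g ^ 2 * x ≠ 0 := by simpa using one_sub_pow_succ_ne_zero hy 0
    have h := hasSum_int_of_pos (f := fun k => (-1) ^ k * g ^ (2 * k - 2) * x ^ k)
      (F := -x * (1 - -(g ^ 2 * x))⁻¹)
      (((hasSum_geometric_of_norm_lt_one hy).mul_left (-x)).congr_fun fun n => by
        rw [show 2 * ((n : ℤ) + 1) - 2 = ((2 * n : ℕ) : ℤ) by push_cast; ring,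
          show ((n : ℤ) + 1) = ((n + 1 : ℕ) : ℤ) by push_cast; rfl, zpow_natCast, zpow_natCast,
          zpow_natCast, neg_eq_neg_one_mul (g ^ 2 * x), mul_pow, mul_pow, ← pow_mul]
        ring)
    rw [h.tsum_eq, hD, sub_neg_eq_add]
    generalize 1 + g ^ 2 * x = E at hne
    field_simp
  · refine ContinuousAt.mul (by fun_prop) ((ContinuousAt.qPoch hq (by fun_prop)).mul
      (ContinuousAt.qPoch hq (continuousAt_const.div (by fun_prop) (neg_ne_zero.2 hx0))))
  · exact (continuousAt_inv₀ hx0).mul (ContinuousAt.qTheta hq (by fun_prop) (neg_ne_zero.2 hx0))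
  · rw [hD, show 1 + g ^ 2 * -(g ^ 2)⁻¹ = 0 by field_simp; ring]
    ring
  · rw [hP0]
    exact mul_ne_zero (inv_ne_zero hg2) (pow_ne_zero _ (qPoch_ne_zero_of_norm_lt hq hq))
  · rw [hC, hP0]

theorem chi_sum_one_eq {y : ℂ} :
    chi (1 + 1) + chi (2 + 1) * y + chi (3 + 1) * y ^ 2 = y ^ 2 - 1 := by
  have e0 : chi 3 = 0 := by rw [chi_congr (l := 0) (by norm_num), chi_zero]
  have e1 : chi 4 = 1 := by rw [chi_congr (l := 1) (by norm_num), chi_one]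
  norm_num [chi_two, e0, e1]
  ring

/-- The label `1`. In contrast with the other labels, the leading part `∑_{k ≥ 1} ν_k x ^ k` of the
series has its radius of convergence equal to `1`; it is summed in closed form. The pole used to
determine the constant is `x₀ = -ω`, with `ω` a primitive cube root of unity. -/
theorem lambert_one {g : ℂ} (hg : g ≠ 0) (hg1 : ‖g‖ < 1) {ω : ℂ} (hω : 1 + ω + ω ^ 2 = 0)
    {a : ℤ → ℂ} {F : ℂ → ℂ} (ha : IsOddTheta g 0 a)
    (hF : ∀ x, x ≠ 0 → HasSum (fun k : ℤ => a k * x ^ k) (F x))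
    (hFc : ContinuousAt F (-ω)) {C : ℂ}
    (hC : F (-ω) = C * ((ω - ω ^ 2) * qPoch (g ^ 18) (g ^ 18) ^ 2)) {ν r : ℤ → ℂ}
    (hν : ν = fun k => chi (k + 1) * (-1) ^ k)
    (hr : r = fun k => lambertCoeff g 1 1 ν k - if 1 ≤ k then ν k else 0) :
    (∀ k : ℤ, r (1 - k) = -r k) ∧ (∃ M : ℝ, ∀ k : ℤ, 1 ≤ k → ‖r k‖ ≤ M * (‖g‖ ^ 6) ^ k) ∧
    ∀ x : ℂ, ‖g‖ ^ 6 < ‖x‖ → ‖x‖ < 1 →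
      F x = C * ((x ^ 2)⁻¹ * qTheta (-x ^ 3) (g ^ 18) *
        (x * (1 - x ^ 2) / (1 + x ^ 3) + ∑' k : ℤ, r k * x ^ k)) := by
  obtain ⟨K, hK⟩ := hasSum_qTheta_den_one hg hg1
  obtain ⟨hω3, hω0, hωn, hω1⟩ := cube_root_facts hω
  have hG : 0 < ‖g‖ := norm_pos_iff.2 hg
  have hq := norm_pow_lt_one' hg1 (show 18 ≠ 0 by norm_num)
  have hx0 : -ω ≠ 0 := neg_ne_zero.2 hω0
  have hx0n : ‖-ω‖ = 1 := by rw [norm_neg, hωn]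
  have hG6 : 0 < ‖g‖ ^ 6 := by positivity
  have hG6' : ‖g‖ ^ 6 < 1 := pow_lt_one₀ hG.le hg1 (by norm_num)
  have hg' : 0 < 1 - ‖g‖ := by linarith
  have hsgn : ∀ k : ℤ, (-1 : ℂ) ^ k * (-1) ^ k = 1 := fun k => by
    rw [← mul_zpow]
    simp
  have hν1 : ∀ k, ‖ν k‖ ≤ 1 := fun k => by
    rw [hν]
    simp only [norm_mul, norm_zpow, norm_neg, norm_one, one_zpow, mul_one]
    exact norm_chi_le _
  have hνr : ∀ k, ν (1 - k) = ν k := fun k => by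
    rw [hν]
    simp only
    rw [neg_one_zpow_eq_of_odd (a := 1 - k) (b := k) ⟨-k, by ring⟩,
      show 1 - k + 1 = -(k + 1 + 3 * (-1)) by ring, chi_neg, chi_add_three_mul]
    ring
  have h10 : ∀ k : ℤ, 1 - 1 * g ^ (6 * k - 3 * 1) ≠ 0 := fun k =>
    one_sub_mul_zpow_ne_zero hg hg1 (Or.inl rfl) (Or.inl (by omega))
  set s := lambertCoeff g 1 1 ν with hs
  have hsr : ∀ k, s (1 - k) = -s k + ν k := by
    intro k
    rw [hs, lambertCoeff_reflect hg hg1 (Or.inl rfl) (Or.inl rfl), hνr, lambertCoeff]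
    have := h10 k
    generalize g ^ (6 * k - 3 * 1) = t at this ⊢
    rw [one_mul] at this ⊢
    field_simp
    ring
  have hrr : ∀ k, r (1 - k) = -r k := by
    intro k
    rw [hr]
    simp only
    rw [hsr]
    by_cases h : 1 ≤ k
    · rw [if_pos h, if_neg (by omega)]
      ring
    · rw [if_neg h, if_pos (by omega), hνr]
      ring
  set M := ‖g‖ ^ (-3 : ℤ) / (1 - ‖g‖) with hM
  have hM0 : 0 ≤ M := by positivity
  have hrk : ∀ k : ℤ, 1 ≤ k → ‖r k‖ ≤ M * (‖g‖ ^ 6) ^ k := by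
    intro k hk
    have e : r k = ν k * g ^ (6 * k - 3 * 1) / (1 - 1 * g ^ (6 * k - 3 * 1)) := by
      have := h10 k
      rw [hr]
      simp only [if_pos hk, hs, lambertCoeff]
      generalize g ^ (6 * k - 3 * 1) = t at this ⊢
      rw [one_mul] at this ⊢
      field_simp
      ring
    have e2 : (‖g‖ ^ 6) ^ k = ‖g‖ ^ (6 * k) := by
      rw [← zpow_natCast, ← zpow_mul]
      rfl
    rw [e, hM, norm_div, div_mul_eq_mul_div, e2, ← zpow_add₀ hG.ne', norm_mul, norm_zpow]
    refine div_le_div₀ (by positivity) ?_ hg' (one_sub_norm_le hg1 (Or.inl rfl) (by omega))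
    rw [show 6 * k - 3 * 1 = -3 + 6 * k by ring]
    exact mul_le_of_le_one_left (by positivity) (hν1 k)
  have hrneg : ∀ k : ℤ, k ≤ 0 → ‖r k‖ ≤ M * (‖g‖ ^ 6) ^ (-k) := by
    intro k hk
    rw [← norm_neg, ← hrr]
    refine (hrk _ (by omega)).trans (mul_le_mul_of_nonneg_left ?_ hM0)
    exact zpow_le_zpow_right_of_le_one₀ hG6 hG6'.le (by omega)
  have hrsum : ∀ x : ℂ, ‖g‖ ^ 6 < ‖x‖ → ‖g‖ ^ 6 * ‖x‖ < 1 → Summable fun k : ℤ => r k * x ^ k :=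
    fun x h1 h2 => summable_laurent hG6 hG6 hrk hrneg h2 h1
  have hℓ : ∀ x : ℂ, x ≠ 0 → ‖x‖ < 1 → HasSum (fun k : ℤ => (if 1 ≤ k then ν k else 0) * x ^ k)
      (x * (1 - x ^ 2) / (1 + x ^ 3)) := by
    intro x hx hx1
    have h := hasSum_chi_mul_pow 1 (y := -x) (by rwa [norm_neg])
    rw [chi_sum_one_eq, show -x * ((-x) ^ 2 - 1) / (1 - (-x) ^ 3) = x * (1 - x ^ 2) / (1 + x ^ 3) by
      congr 1 <;> ring] at h
    refine (hasSum_int_of_pos (f := fun k => ν k * x ^ k) (h.congr_fun fun n => ?_)).congr_fun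
      fun k => ?_
    · rw [hν]
      simp only
      rw [show ((n : ℤ) + 1) = ((n + 1 : ℕ) : ℤ) by push_cast; rfl, zpow_natCast, zpow_natCast,
        neg_eq_neg_one_mul x, mul_pow]
      ring
    · rw [ite_mul, zero_mul]
  -- The denominator vanishes at `-g ^ (2 * i)` if `3 ∣ i`.
  have hann : ∀ i : ℤ, 3 ∣ i → ∀ m, HasSum (fun k : ℤ =>
      (fun k : ℤ => if (3 : ℤ) ∣ k + 2 then K * g ^ (k * k + k) else 0)
        (m - k) * (-g ^ (-(2 * i))) ^ k) 0 := by
    intro i hi m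
    refine hasSum_annihilated
      (d := fun k : ℤ => if (3 : ℤ) ∣ k + 2 then K * g ^ (k * k + k) else 0)
      (neg_ne_zero.2 (zpow_ne_zero _ hg))
      (hK _ (inv_ne_zero (neg_ne_zero.2 (zpow_ne_zero _ hg)))).summable
      (-(2 * i + 1)) (fun k => ?_) m
    by_cases h : (3 : ℤ) ∣ k + 2
    swap
    · rw [if_neg h, if_neg (by omega), zero_mul, neg_zero]
    rw [if_pos h, if_pos (by omega), ← neg_one_mul (g ^ (-(2 * i))), mul_zpow, ← zpow_mul,
      neg_one_zpow_eq_of_odd (a := 2 * k - -(2 * i + 1)) (b := 0) ⟨k + i, by ring⟩,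
      zpow_expand hg (k * k + k) (show k * k + k = ((-(2 * i + 1) - k) * (-(2 * i + 1) - k) +
        (-(2 * i + 1) - k)) + -(2 * i) * (2 * k - -(2 * i + 1)) by ring), zpow_zero]
    ring
  -- On the support of `fun k => d (m - k)` the symbol `chi (k + 1)` has the constant value `chi m`.
  have hmask : ∀ (m k : ℤ) (z : ℂ),
      (if (3 : ℤ) ∣ m - k + 2 then K * g ^ ((m - k) * (m - k) + (m - k)) else 0) * (ν k * z) =
      chi m * ((if (3 : ℤ) ∣ m - k + 2 then K * g ^ ((m - k) * (m - k) + (m - k)) else 0) *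
        ((-1) ^ k * z)) := by
    intro m k z
    by_cases h : (3 : ℤ) ∣ m - k + 2
    · rw [hν]
      simp only
      rw [chi_congr (k := k + 1) (l := m) (by omega)]
      ring
    · rw [if_neg h]
      ring
  have hD : ∀ x : ℂ, (x ^ 2)⁻¹ * qTheta (-x ^ 3) (g ^ 18) = (x ^ 2)⁻¹ * ((1 + x ^ 3) *
      (qPoch (-(g ^ 18 * x ^ 3)) (g ^ 18) * qPoch (g ^ 18 / (-x ^ 3)) (g ^ 18))) := by
    intro x
    unfold qTheta
    rw [qPoch_eq_mul hq (-x ^ 3), show -x ^ 3 * g ^ 18 = -(g ^ 18 * x ^ 3) by ring]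
    ring
  have h3 : (-ω) ^ 3 = -1 := by linear_combination -hω3
  have hP0 : ((-ω) ^ 2)⁻¹ * ((-ω * (1 - (-ω) ^ 2)) * (qPoch (-(g ^ 18 * (-ω) ^ 3)) (g ^ 18) *
      qPoch (g ^ 18 / (-(-ω) ^ 3)) (g ^ 18))) = (ω - ω ^ 2) * qPoch (g ^ 18) (g ^ 18) ^ 2 := by
    rw [h3, neg_neg, div_one, mul_neg_one, neg_neg]
    have e : ((-ω) ^ 2)⁻¹ * (-ω * (1 - (-ω) ^ 2)) = ω - ω ^ 2 := by
      field_simp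
      linear_combination hω3
    linear_combination qPoch (g ^ 18) (g ^ 18) ^ 2 * e
  refine ⟨hrr, ⟨M, hrk⟩, fun x hx hx1 => ?_⟩
  have hxne : x ≠ 0 := norm_pos_iff.1 (hG6.trans hx)
  have hsx : HasSum (fun k : ℤ => s k * x ^ k)
      (x * (1 - x ^ 2) / (1 + x ^ 3) + ∑' k : ℤ, r k * x ^ k) := by
    refine ((hℓ x hxne hx1).add (hrsum x hx (by nlinarith)).hasSum).congr_fun fun k => ?_
    rw [hr]
    ring
  rw [← hsx.tsum_eq]
  refine theta_eq_const_mul_lambert (δ := 1) (ε := 1) (u := 1) (a := a) (F := F)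
    (d := fun k : ℤ => if (3 : ℤ) ∣ k + 2 then K * g ^ (k * k + k) else 0)
    (Den := fun x => (x ^ 2)⁻¹ * qTheta (-x ^ 3) (g ^ 18))
    (s := s) (n := fun k => g ^ (-(6 * k - 3 * 1)) * ν k) (n' := ν)
    (ℓ := fun k => if 1 ≤ k then ν k else 0) hg (Or.inl (sub_self 1)) (by rwa [sub_self]) hF hK
    ?_ ?_ (lambertCoeff_shift hg hg1 (Or.inl rfl) (Or.inl rfl) ν) hsr (one_mul 1) ?_ ?_ hx0
    (u₀ := ‖g‖) hG hg1 ?_ ?_ ?_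
    (P := fun x => (x ^ 2)⁻¹ * ((x * (1 - x ^ 2)) * (qPoch (-(g ^ 18 * x ^ 3)) (g ^ 18) *
      qPoch (g ^ 18 / (-x ^ 3)) (g ^ 18)))) ?_ ?_ ?_ ?_ hFc ?_ ?_ hxne hsx.summable
  · intro k
    by_cases h : (3 : ℤ) ∣ k + 2
    swap
    · rw [if_neg h, if_neg (by omega), mul_zero]
    rw [if_pos h, if_pos (by omega), zpow_expand hg ((k + 3) * (k + 3) + (k + 3))
      (show (k + 3) * (k + 3) + (k + 3) = (6 * k + 9 + 3 * 1) + (k * k + k) by ring)]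
    ring
  · intro k
    by_cases h : (3 : ℤ) ∣ k + 2
    swap
    · rw [if_neg h, if_neg (by omega)]
    rw [if_pos h, if_pos (by omega), show (-1 - k) * (-1 - k) + (-1 - k) = k * k + k by ring]
  · intro m
    have h := (hann 3 (by norm_num) m).mul_left (chi m * g ^ 3)
    rw [mul_zero] at h
    refine h.congr_fun fun k => ?_
    rw [mul_comm (g ^ (-(6 * k - 3 * 1))), hmask]
    have e : (-g ^ (-(2 * 3) : ℤ)) ^ k = (-1) ^ k * g ^ (-6 * k) := by
      rw [← neg_one_mul, mul_zpow, zpow_mul]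
      norm_num
    rw [e, zpow_expand hg (-(6 * k - 3 * 1)) (show -(6 * k - 3 * 1) = (3 : ℕ) + -6 * k by
      push_cast; ring), zpow_natCast]
    ring
  · intro m
    have h := (hann 0 (by norm_num) m).mul_left (chi m)
    rw [mul_zero (chi m)] at h
    refine h.congr_fun fun k => ?_
    have := hmask m k 1
    rw [mul_one, mul_one] at this
    rw [this]
    norm_num
  · intro v hv hv'
    have hv0 : 0 < v := hG.trans_le hv
    exact (hℓ _ (mul_ne_zero (Complex.ofReal_ne_zero.2 hv0.ne') hx0)
      (by rwa [norm_ofReal_mul_of_pos hv0, hx0n, mul_one])).summable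
  · rw [hr] at hrsum
    exact hrsum _ (by rwa [hx0n]) (by rwa [hx0n, mul_one])
  · have hnorm : ‖((‖g‖ : ℝ) : ℂ) * -ω‖ = ‖g‖ := by rw [norm_ofReal_mul_of_pos hG, hx0n, mul_one]
    rw [hr] at hrsum
    refine hrsum _ ?_ ?_
    · rw [hnorm]
      exact pow_lt_self_of_lt_one₀ hG hg1 (by norm_num)
    · rw [hnorm]
      nlinarith
  · intro v hv hv'
    have hv0 : 0 < v := hG.trans_le hv
    have hne : (v : ℂ) * -ω ≠ 0 := mul_ne_zero (Complex.ofReal_ne_zero.2 hv0.ne') hx0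
    have hlt : ‖(v : ℂ) * -ω‖ < 1 := by rwa [norm_ofReal_mul_of_pos hv0, hx0n, mul_one]
    rw [(hℓ _ hne hlt).tsum_eq]
    generalize (v : ℂ) * -ω = y at hne hlt
    have hne' : 1 + y ^ 3 ≠ 0 := by
      have := one_sub_pow_succ_ne_zero (q := -y) (by rwa [norm_neg]) 2
      rwa [show 1 - (-y) ^ (2 + 1) = 1 + y ^ 3 by ring] at this
    rw [hD]
    generalize 1 + y ^ 3 = E at hne'
    field_simp
  · have hc : ContinuousAt (fun x : ℂ => g ^ 18 / (-x ^ 3)) (-ω) :=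
      continuousAt_const.div (by fun_prop) (by rw [h3]; norm_num)
    exact ((continuousAt_id.pow 2).inv₀ (pow_ne_zero 2 hx0)).mul ((by fun_prop :
      ContinuousAt (fun x : ℂ => x * (1 - x ^ 2)) (-ω)).mul
      ((ContinuousAt.qPoch hq (by fun_prop)).mul (ContinuousAt.qPoch hq hc)))
  · exact ((continuousAt_id.pow 2).inv₀ (pow_ne_zero 2 hx0)).mul
      (ContinuousAt.qTheta hq (by fun_prop) (by rw [h3]; norm_num))
  · rw [hD, h3]
    ring
  · rw [hP0]
    refine mul_ne_zero ?_ (pow_ne_zero _ (qPoch_ne_zero_of_norm_lt hq hq))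
    intro h
    have : ω * (1 - ω) = 0 := by linear_combination h
    rcases mul_eq_zero.1 this with h | h
    · exact hω0 h
    · exact hω1 (by linear_combination -h)
  · rw [hC, hP0]

/-! ### Theta constants -/

/-- The product `(h; h)_∞`. -/
noncomputable def eulerQ (h : ℂ) : ℂ := qPoch h h

theorem eulerQ_ne_zero {h : ℂ} (h1 : ‖h‖ < 1) : eulerQ h ≠ 0 := qPoch_ne_zero_of_norm_lt h1 h1

theorem eulerQ_pow_ne_zero {h : ℂ} (h1 : ‖h‖ < 1) {n : ℕ} (hn : n ≠ 0) : eulerQ (h ^ n) ≠ 0 :=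
  eulerQ_ne_zero (norm_pow_lt_one' h1 hn)

theorem qTheta_inv {q x : ℂ} (hq : ‖q‖ < 1) (hx : x ≠ 0) :
    qTheta x⁻¹ q = -x⁻¹ * qTheta x q := by
  unfold qTheta
  rw [qPoch_eq_mul hq x⁻¹, qPoch_eq_mul hq x, div_inv_eq_mul, mul_comm q x, div_eq_mul_inv q x,
    mul_comm x⁻¹ q]
  field_simp
  ring

theorem qPoch_sq_mul_eulerQ {h : ℂ} (h1 : ‖h‖ < 1) :
    qPoch h (h ^ 2) * eulerQ (h ^ 2) = eulerQ h := by
  rw [eulerQ, eulerQ, qPoch_dissect_two h1 h, ← pow_two]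

/-- The factors of `(h; h)_∞` with exponent not divisible by `3` form `θ(h; h ^ 3)`. -/
theorem qTheta_pow_three_mul_eulerQ {h : ℂ} (h0 : h ≠ 0) (h1 : ‖h‖ < 1) :
    qTheta h (h ^ 3) * eulerQ (h ^ 3) = eulerQ h := by
  rw [qTheta, eulerQ, eulerQ, qPoch_dissect_three h1 h, show h ^ 3 / h = h * h by field_simp,
    ← pow_succ']

/-- The factors of `(h; h)_∞` with exponent prime to `6` form `θ(h; h ^ 6)`. -/
theorem qTheta_pow_six_mul_eulerQ {h : ℂ} (h0 : h ≠ 0) (h1 : ‖h‖ < 1) :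
    qTheta h (h ^ 6) * (eulerQ (h ^ 2) * eulerQ (h ^ 3)) = eulerQ h * eulerQ (h ^ 6) := by
  have hh2 := norm_pow_lt_one' h1 (show 2 ≠ 0 by norm_num)
  have hh3 := norm_pow_lt_one' h1 (show 3 ≠ 0 by norm_num)
  have e1 := qPoch_dissect_three hh2 (h ^ 2)
  have e2 := qPoch_dissect_two hh3 (h ^ 3)
  have e3 := qPoch_dissect_two h1 h
  have e4 := qPoch_dissect_three hh2 h
  simp only [← pow_mul, ← pow_add, ← pow_succ', ← pow_two] at e1 e2 e3 e4
  norm_num at e1 e2 e3 e4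
  rw [qTheta, eulerQ, eulerQ, eulerQ, eulerQ, show h ^ 6 / h = h ^ 5 by field_simp, e3, e4, e1, e2]
  ring

/-- Euler's product at `-h` in terms of those at powers of `h`. -/
theorem eulerQ_neg_mul {h : ℂ} (h1 : ‖h‖ < 1) :
    eulerQ (-h) * (eulerQ h * eulerQ (h ^ 4)) = eulerQ (h ^ 2) ^ 3 := by
  have hh2 := norm_pow_lt_one' h1 (show 2 ≠ 0 by norm_num)
  have e1 := qPoch_dissect_two (q := -h) (by rwa [norm_neg]) (-h)
  rw [neg_sq, neg_mul_neg, ← pow_two] at e1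
  have e2 := qPoch_mul_neg hh2 h
  have e3 := qPoch_sq_mul_eulerQ h1
  have e4 := qPoch_sq_mul_eulerQ hh2
  rw [← pow_mul] at e2 e4
  norm_num at e2 e4
  rw [eulerQ, e1, ← e3]
  change qPoch (-h) (h ^ 2) * eulerQ (h ^ 2) * _ = _
  linear_combination (eulerQ (h ^ 2) ^ 2 * eulerQ (h ^ 4)) * e2 + eulerQ (h ^ 2) ^ 2 * e4

/-- The theta constant common to the labels `3` and `6`. -/
theorem qTheta_neg_mul_qTheta_pow_four {h : ℂ} (h0 : h ≠ 0) (h1 : ‖h‖ < 1) :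
    qTheta (-h) (h ^ 6) * qTheta (h ^ 4) (h ^ 12) * (eulerQ (h ^ 6) ^ 2 * eulerQ h) =
      eulerQ (h ^ 3) * eulerQ (h ^ 2) ^ 2 := by
  have e1 := qTheta_pow_six_mul_eulerQ h0 h1
  have e2 := qTheta_pow_six_mul_eulerQ (pow_ne_zero 2 h0) (norm_pow_lt_one' h1 two_ne_zero)
  have e3 := qTheta_mul_neg (norm_pow_lt_one' h1 (show 6 ≠ 0 by norm_num)) h
  have e4 := qTheta_pow_three_mul_eulerQ (pow_ne_zero 4 h0) (norm_pow_lt_one' h1 (by norm_num))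
  rw [← pow_mul] at e3 e4
  simp only [← pow_mul] at e2
  norm_num at e2 e3 e4
  rw [← e3] at e2
  have n4 := eulerQ_pow_ne_zero h1 (show 4 ≠ 0 by norm_num)
  have n12 := eulerQ_pow_ne_zero h1 (show 12 ≠ 0 by norm_num)
  refine mul_right_cancel₀ (mul_ne_zero n4 n12) ?_
  generalize qTheta (-h) (h ^ 6) = T at *
  generalize qTheta h (h ^ 6) = U at *
  generalize qTheta (h ^ 4) (h ^ 12) = V at *
  linear_combination (-T * V * eulerQ (h ^ 6) * eulerQ (h ^ 4) * eulerQ (h ^ 12)) * e1 +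
    (eulerQ (h ^ 2) * eulerQ (h ^ 3) * V * eulerQ (h ^ 12)) * e2 +
    (eulerQ (h ^ 2) ^ 2 * eulerQ (h ^ 3) * eulerQ (h ^ 12)) * e4

theorem cube_root_sq {ω : ℂ} (hω : 1 + ω + ω ^ 2 = 0) : 1 + ω ^ 2 + (ω ^ 2) ^ 2 = 0 := by
  linear_combination (1 - ω + ω ^ 2) * hω

/-- From `∏ (1 - ω ^ i a) = 1 - a ^ 3`, the product over the three cube roots of unity. -/
theorem qTheta_cube_root_mul_eulerQ {ω q : ℂ} (hω : 1 + ω + ω ^ 2 = 0) (hq1 : ‖q‖ < 1) :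
    qTheta ω q * eulerQ q = (1 - ω) * eulerQ (q ^ 3) := by
  obtain ⟨hω3, hω0, -, -⟩ := cube_root_facts hω
  have e := qPoch_mul_cube_roots hq1 hω q
  have e2 : q / ω = ω ^ 2 * q := by
    field_simp
    linear_combination -q * hω3
  rw [qTheta, eulerQ, eulerQ, qPoch_eq_mul hq1 ω, e2]
  linear_combination (1 - ω) * e

theorem qTheta_cube_root_mul {ω h : ℂ} (hω : 1 + ω + ω ^ 2 = 0) (h0 : h ≠ 0) (h1 : ‖h‖ < 1) :
    qTheta (ω * h) (h ^ 2) * (eulerQ h * eulerQ (h ^ 6)) = eulerQ (h ^ 3) * eulerQ (h ^ 2) := by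
  obtain ⟨hω3, hω0, -, -⟩ := cube_root_facts hω
  have hh2 := norm_pow_lt_one' h1 two_ne_zero
  have hh3 := norm_pow_lt_one' h1 three_ne_zero
  have e := qPoch_mul_cube_roots hh2 hω h
  have e1 := qPoch_sq_mul_eulerQ h1
  have e2 := qPoch_sq_mul_eulerQ hh3
  rw [← pow_mul] at e e2
  norm_num at e e2
  have e3 : h ^ 2 / (ω * h) = ω ^ 2 * h := by
    field_simp
    linear_combination -hω3
  rw [qTheta, e3, ← e1, ← e2]
  linear_combination (eulerQ (h ^ 2) * eulerQ (h ^ 6)) * e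

/-- The value of the numerator at the pole for the label `0`, as required by `lambert_zero_six`. -/
theorem thetaA_const_zero {g : ℂ} (hg : g ≠ 0) (hg1 : ‖g‖ < 1) :
    (g⁻¹)⁻¹ * thetaA g g⁻¹ =
      -(eulerQ (g ^ 12) / (eulerQ (g ^ 6) ^ 2 * eulerQ (g ^ 4))) * (g⁻¹ * eulerQ (g ^ 2) ^ 2) := by
  have hn := fun {n : ℕ} (h : n ≠ 0) => norm_pow_lt_one' hg1 h
  have e1 := qTheta_pow_three_mul_eulerQ (pow_ne_zero 2 hg) (hn two_ne_zero)
  have e2 := qTheta_pow_six_mul_eulerQ (pow_ne_zero 2 hg) (hn two_ne_zero)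
  simp only [← pow_mul] at e1 e2
  norm_num at e1 e2
  have n4 := eulerQ_pow_ne_zero hg1 (show 4 ≠ 0 by norm_num)
  have n6 := eulerQ_pow_ne_zero hg1 (show 6 ≠ 0 by norm_num)
  rw [thetaA_eq hg1, inv_inv, inv_pow, qTheta_inv (hn (by norm_num)) (pow_ne_zero 2 hg),
    show g ^ 3 * g⁻¹ = g ^ 2 by field_simp]
  generalize qTheta (g ^ 2) (g ^ 6) = T at *
  generalize qTheta (g ^ 2) (g ^ 12) = U at *
  field_simp
  linear_combination (-U * eulerQ (g ^ 4) * eulerQ (g ^ 6)) * e1 - eulerQ (g ^ 2) * e2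

/-- The value of the numerator at the pole for the label `6`, as required by `lambert_zero_six`. -/
theorem thetaB_const_six {g : ℂ} (hg : g ≠ 0) (hg1 : ‖g‖ < 1) :
    thetaB g g⁻¹ = -(eulerQ (-g ^ 3) / (eulerQ (g ^ 6) ^ 2 * eulerQ (-g))) *
      (g⁻¹ * eulerQ (g ^ 2) ^ 2) := by
  have e := qTheta_neg_mul_qTheta_pow_four (neg_ne_zero.2 hg) (by rwa [norm_neg])
  rw [neg_neg, neg_sq, show (-g) ^ 4 = g ^ 4 by ring, show (-g) ^ 6 = g ^ 6 by ring,
    show (-g) ^ 12 = g ^ 12 by ring, show (-g) ^ 3 = -g ^ 3 by ring] at e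
  have n1 : eulerQ (-g) ≠ 0 := eulerQ_ne_zero (by rwa [norm_neg])
  have n6 := eulerQ_pow_ne_zero hg1 (show 6 ≠ 0 by norm_num)
  rw [thetaB_eq hg1, qTheta_inv (norm_pow_lt_one' hg1 (by norm_num)) hg,
    show g ^ 6 * g⁻¹ ^ 2 = g ^ 4 by field_simp]
  generalize qTheta g (g ^ 6) = T at *
  generalize qTheta (g ^ 4) (g ^ 12) = U at *
  field_simp
  linear_combination -e

/-- The value of the numerator at the pole for the label `3`, as required by `lambert_three`. -/
theorem thetaA_const_three {g : ℂ} (hg : g ≠ 0) (hg1 : ‖g‖ < 1) :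
    (-(g ^ 2)⁻¹)⁻¹ * thetaA g (-(g ^ 2)⁻¹) =
      eulerQ (g ^ 3) / (eulerQ (g ^ 6) ^ 2 * eulerQ g) * ((g ^ 2)⁻¹ * eulerQ (g ^ 2) ^ 2) := by
  have e := qTheta_neg_mul_qTheta_pow_four hg hg1
  have n1 := eulerQ_ne_zero hg1
  have n6 := eulerQ_pow_ne_zero hg1 (show 6 ≠ 0 by norm_num)
  rw [thetaA_eq hg1, neg_sq, inv_pow, ← pow_mul,
    qTheta_inv (norm_pow_lt_one' hg1 (by norm_num)) (pow_ne_zero _ hg),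
    show g ^ 3 * -(g ^ 2)⁻¹ = -g by field_simp]
  norm_num
  generalize qTheta (-g) (g ^ 6) = T at *
  generalize qTheta (g ^ 4) (g ^ 12) = U at *
  field_simp
  linear_combination e

/-- The value of the numerator at the pole for the label `4`, as required by `lambert_four_two`. -/
theorem thetaA_const_four {g ω : ℂ} (hω : 1 + ω + ω ^ 2 = 0) (hg : g ≠ 0) (hg1 : ‖g‖ < 1) :
    (ω / g ^ 3)⁻¹ * thetaA g (ω / g ^ 3) =
      -(eulerQ (g ^ 12) / (eulerQ (g ^ 6) ^ 2 * eulerQ (g ^ 36))) *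
        ((g ^ 3)⁻¹ * (ω - ω ^ 2) * eulerQ (g ^ 18) ^ 2) := by
  obtain ⟨hω3, hω0, -, -⟩ := cube_root_facts hω
  have hn := fun {n : ℕ} (h : n ≠ 0) => norm_pow_lt_one' hg1 h
  have e1 := qTheta_cube_root_mul hω (pow_ne_zero 6 hg) (hn (by norm_num))
  have e2 := qTheta_cube_root_mul_eulerQ hω (hn (show 6 ≠ 0 by norm_num))
  simp only [← pow_mul] at e1 e2
  norm_num at e1 e2
  have n36 := eulerQ_pow_ne_zero hg1 (show 36 ≠ 0 by norm_num)
  have n6 := eulerQ_pow_ne_zero hg1 (show 6 ≠ 0 by norm_num)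
  have hi : (ω / g ^ 3) ^ 2 = (ω * g ^ 6)⁻¹ := by
    field_simp
    linear_combination hω3
  rw [thetaA_eq hg1, hi, qTheta_inv (hn (by norm_num)) (mul_ne_zero hω0 (pow_ne_zero 6 hg)),
    mul_div_cancel₀ ω (pow_ne_zero 3 hg)]
  generalize qTheta ω (g ^ 6) = T at *
  generalize qTheta (ω * g ^ 6) (g ^ 12) = U at *
  field_simp
  linear_combination (-U * eulerQ (g ^ 6) * eulerQ (g ^ 36)) * e2 -
    (1 - ω) * eulerQ (g ^ 18) * e1 +
      (1 - ω) * eulerQ (g ^ 18) ^ 2 * eulerQ (g ^ 12) * hω3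

/-- The value of the numerator at the pole for the label `2`, as required by `lambert_four_two`. -/
theorem thetaB_const_two {g ω : ℂ} (hω : 1 + ω + ω ^ 2 = 0) (hg : g ≠ 0) (hg1 : ‖g‖ < 1) :
    thetaB g (ω / g ^ 3) = eulerQ (-g ^ 3) / (eulerQ (g ^ 6) ^ 2 * eulerQ (-g ^ 9)) *
        ((g ^ 3)⁻¹ * (1 - ω) * eulerQ (g ^ 18) ^ 2) := by
  obtain ⟨hω3, hω0, -, -⟩ := cube_root_facts hω
  have hn := fun {n : ℕ} (h : n ≠ 0) => norm_pow_lt_one' hg1 h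
  have e1 := qTheta_cube_root_mul (cube_root_sq hω) (pow_ne_zero 3 hg) (hn three_ne_zero)
  have e2 := qTheta_cube_root_mul_eulerQ (cube_root_sq hω) (hn (show 12 ≠ 0 by norm_num))
  have e3 := eulerQ_neg_mul (hn (show 3 ≠ 0 by norm_num))
  have e4 := eulerQ_neg_mul (hn (show 9 ≠ 0 by norm_num))
  simp only [← pow_mul] at e1 e2 e3 e4
  norm_num at e1 e2 e3 e4
  have n := fun {n : ℕ} (h : n ≠ 0) => eulerQ_pow_ne_zero hg1 h
  have n3 := n (show 3 ≠ 0 by norm_num)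
  have n6 := n (show 6 ≠ 0 by norm_num)
  have n9 := n (show 9 ≠ 0 by norm_num)
  have n12 := n (show 12 ≠ 0 by norm_num)
  have n18 := n (show 18 ≠ 0 by norm_num)
  have n36 := n (show 36 ≠ 0 by norm_num)
  have n9' : eulerQ (-g ^ 9) ≠ 0 := eulerQ_ne_zero (by rw [norm_neg]; exact hn (by norm_num))
  have hi : ω / g ^ 3 = (ω ^ 2 * g ^ 3)⁻¹ := by
    field_simp
    linear_combination hω3
  have h1 : g ^ 6 * (ω / g ^ 3) ^ 2 = ω ^ 2 := by field_simp
  rw [thetaB_eq hg1, h1, hi, qTheta_inv (hn (by norm_num)) (mul_ne_zero (pow_ne_zero 2 hω0)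
    (pow_ne_zero 3 hg)), eq_div_of_mul_eq (mul_ne_zero n3 n18) e1, eq_div_of_mul_eq n12 e2,
    eq_div_of_mul_eq (mul_ne_zero n3 n12) e3, eq_div_of_mul_eq (mul_ne_zero n9 n36) e4]
  field_simp
  linear_combination hω3

/-- The value of the numerator at the pole for the label `1`, as required by `lambert_one`. -/
theorem thetaA_const_one {g ω : ℂ} (hω : 1 + ω + ω ^ 2 = 0) (hg : g ≠ 0) (hg1 : ‖g‖ < 1) :
    (-ω)⁻¹ * thetaA g (-ω) = eulerQ (g ^ 3) / (eulerQ (g ^ 6) ^ 2 * eulerQ (g ^ 9)) *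
        ((ω - ω ^ 2) * eulerQ (g ^ 18) ^ 2) := by
  obtain ⟨hω3, hω0, -, -⟩ := cube_root_facts hω
  have hn := fun {n : ℕ} (h : n ≠ 0) => norm_pow_lt_one' hg1 h
  have hneg : ‖-g ^ 3‖ < 1 := by
    rw [norm_neg]
    exact hn (by norm_num)
  have e1 := qTheta_cube_root_mul hω (neg_ne_zero.2 (pow_ne_zero 3 hg)) hneg
  have e2 := qTheta_cube_root_mul_eulerQ (cube_root_sq hω) (hn (show 12 ≠ 0 by norm_num))
  have e3 := eulerQ_neg_mul (hn (show 3 ≠ 0 by norm_num))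
  have e4 := eulerQ_neg_mul (hn (show 9 ≠ 0 by norm_num))
  rw [show (-g ^ 3) ^ 2 = g ^ 6 by ring, show (-g ^ 3) ^ 3 = -g ^ 9 by ring,
    show (-g ^ 3) ^ 6 = g ^ 18 by ring, show ω * -g ^ 3 = g ^ 3 * -ω by ring] at e1
  simp only [← pow_mul] at e2 e3 e4
  norm_num at e2 e3 e4
  have n := fun {n : ℕ} (h : n ≠ 0) => eulerQ_pow_ne_zero hg1 h
  have n3 := n (show 3 ≠ 0 by norm_num)
  have n6 := n (show 6 ≠ 0 by norm_num)
  have n9 := n (show 9 ≠ 0 by norm_num)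
  have n12 := n (show 12 ≠ 0 by norm_num)
  have n18 := n (show 18 ≠ 0 by norm_num)
  have n36 := n (show 36 ≠ 0 by norm_num)
  have n3' : eulerQ (-g ^ 3) ≠ 0 := eulerQ_ne_zero hneg
  rw [thetaA_eq hg1, neg_sq, eq_div_of_mul_eq (mul_ne_zero n3' n18) e1, eq_div_of_mul_eq n12 e2,
    eq_div_of_mul_eq (mul_ne_zero n3 n12) e3, eq_div_of_mul_eq (mul_ne_zero n9 n36) e4]
  field_simp
  linear_combination hω3

/-! ### Sine series -/

/-- The Taylor coefficients of the sine at `0`. -/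
noncomputable def sinCoeff (j : ℕ) : ℂ :=
  ((-Complex.I) ^ j - Complex.I ^ j) * Complex.I / 2 / (j.factorial : ℂ)

theorem sinCoeff_two_mul (k : ℕ) : sinCoeff (2 * k) = 0 := by
  rw [sinCoeff, Even.neg_pow (even_two_mul k), sub_self]
  simp

theorem factorial_mul_sinCoeff (k : ℕ) :
    ((2 * k + 1).factorial : ℂ) * sinCoeff (2 * k + 1) = (-1) ^ k := by
  have h : ((2 * k + 1).factorial : ℂ) ≠ 0 := Nat.cast_ne_zero.2 (Nat.factorial_ne_zero _)
  rw [sinCoeff, Odd.neg_pow ⟨k, rfl⟩, pow_succ, pow_mul, Complex.I_sq]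
  field_simp
  linear_combination -2 * Complex.I_sq

theorem norm_sinCoeff_le (j : ℕ) : ‖sinCoeff j‖ ≤ (j.factorial : ℝ)⁻¹ := by
  have h : ‖(-Complex.I) ^ j - Complex.I ^ j‖ ≤ 2 := by
    refine (norm_sub_le _ _).trans ?_
    simp only [norm_pow, norm_neg, Complex.norm_I, one_pow]
    norm_num
  rw [sinCoeff, norm_div, norm_div, norm_mul, Complex.norm_I, Complex.norm_natCast,
    div_eq_mul_inv _ (j.factorial : ℝ)]
  refine mul_le_of_le_one_left (by positivity) ?_
  norm_num
  linarith

theorem hasSum_sinCoeff (z : ℂ) : HasSum (fun j => sinCoeff j * z ^ j) (Complex.sin z) := by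
  have h1 := NormedSpace.expSeries_div_hasSum_exp (-z * Complex.I)
  have h2 := NormedSpace.expSeries_div_hasSum_exp (z * Complex.I)
  rw [← Complex.exp_eq_exp_ℂ] at h1 h2
  have h := ((h1.sub h2).mul_right Complex.I).div_const 2
  refine h.congr_fun fun j => ?_
  rw [sinCoeff, show -z * Complex.I = -Complex.I * z by ring, mul_comm z, mul_pow, mul_pow]
  ring

/-- The absolute convergence which justifies expanding a series of sines termwise. -/
theorem summable_norm_mul_exp {r : ℕ → ℂ} {θ : ℕ → ℂ} {R : ℝ} (hR : 0 ≤ R)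
    (h : Summable fun n => ‖r n‖ * Real.exp (‖θ n‖ * R)) :
    Summable fun p : ℕ × ℕ => ‖r p.1‖ * ((‖θ p.1‖ * R) ^ p.2 / (p.2.factorial : ℝ)) := by
  have he : ∀ n, HasSum (fun j : ℕ => ‖r n‖ * ((‖θ n‖ * R) ^ j / (j.factorial : ℝ)))
      (‖r n‖ * Real.exp (‖θ n‖ * R)) := fun n => by
    have := NormedSpace.expSeries_div_hasSum_exp (‖θ n‖ * R)
    rw [← Real.exp_eq_exp_ℝ] at this
    exact this.mul_left _
  refine (summable_prod_of_nonneg fun p => ?_).2 ⟨fun n => (he n).summable, ?_⟩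
  · simp only [Pi.zero_apply]
    positivity
  · exact h.congr fun n => (he n).tsum_eq.symm

theorem summable_mul_pow_of_exp {r : ℕ → ℂ} {θ : ℕ → ℂ} {R : ℝ} (hR : 0 < R)
    (h : Summable fun n => ‖r n‖ * Real.exp (‖θ n‖ * R)) (j : ℕ) :
    Summable fun n => r n * θ n ^ j := by
  have h1 := (Equiv.prodComm ℕ ℕ).summable_iff.2 (summable_norm_mul_exp hR.le h)
  have h2 := (h1.prod_factor j).mul_right ((j.factorial : ℝ) / R ^ j)
  refine Summable.of_norm (h2.congr fun n => ?_)
  have : (j.factorial : ℝ) ≠ 0 := Nat.cast_ne_zero.2 (Nat.factorial_ne_zero _)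
  simp only [Function.comp, Equiv.prodComm_apply, Prod.swap]
  rw [norm_mul, norm_pow, mul_pow]
  field_simp

/-- The power series of a series of sines, by interchanging the two summations. -/
theorem hasSum_sine_series {r : ℕ → ℂ} {θ : ℕ → ℂ} {R : ℝ} (hR : 0 < R)
    (h : Summable fun n => ‖r n‖ * Real.exp (‖θ n‖ * R)) {w : ℂ} (hw : ‖w‖ ≤ R) :
    HasSum (fun j => sinCoeff j * (∑' n, r n * θ n ^ j) * w ^ j)
      (∑' n, r n * Complex.sin (θ n * w)) := by
  have hs : Summable fun p : ℕ × ℕ => r p.1 * (sinCoeff p.2 * (θ p.1 * w) ^ p.2) := by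
    refine Summable.of_norm_bounded (summable_norm_mul_exp hR.le h) fun p => ?_
    rw [norm_mul, norm_mul, norm_pow, norm_mul, div_eq_inv_mul]
    have := norm_sinCoeff_le p.2
    gcongr
  have h1 := hs.hasSum.prod_fiberwise fun n => (hasSum_sinCoeff (θ n * w)).mul_left (r n)
  rw [h1.tsum_eq]
  refine ((Equiv.prodComm ℕ ℕ).hasSum_iff.2 hs.hasSum).prod_fiberwise fun j => ?_
  refine ((summable_mul_pow_of_exp hR h j).hasSum.mul_left (sinCoeff j)).mul_right (w ^ j)
    |>.congr_fun fun n => ?_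
  simp only [Function.comp, Equiv.prodComm_apply, Prod.swap]
  rw [mul_pow]
  ring

theorem differentiableOn_sine_series {r : ℕ → ℂ} {θ : ℕ → ℂ} {R : ℝ}
    (h : Summable fun n => ‖r n‖ * Real.exp (‖θ n‖ * R)) :
    DifferentiableOn ℂ (fun w => ∑' n, r n * Complex.sin (θ n * w)) (Metric.ball 0 R) := by
  refine Complex.differentiableOn_tsum_of_summable_norm h (fun n => by fun_prop)
    Metric.isOpen_ball fun n w hw => ?_
  rw [mem_ball_zero_iff] at hw
  rw [norm_mul]
  refine mul_le_mul_of_nonneg_left ?_ (norm_nonneg _)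
  have h2 : ∀ z : ℂ, ‖Complex.sin z‖ ≤ Real.exp ‖z‖ := fun z => by
    have e : Complex.sin z = (Complex.exp (-z * Complex.I) - Complex.exp (z * Complex.I)) *
        Complex.I / 2 := rfl
    have h1 := Complex.norm_exp_le_exp_norm (-z * Complex.I)
    have h2 := Complex.norm_exp_le_exp_norm (z * Complex.I)
    rw [norm_mul, norm_neg, Complex.norm_I, mul_one] at h1
    rw [norm_mul, Complex.norm_I, mul_one] at h2
    have h3 := norm_sub_le (Complex.exp (-z * Complex.I)) (Complex.exp (z * Complex.I))
    rw [e, norm_div, norm_mul, Complex.norm_I, mul_one, show ‖(2 : ℂ)‖ = 2 by norm_num]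
    linarith
  refine (h2 _).trans (Real.exp_le_exp.2 ?_)
  rw [norm_mul]
  exact mul_le_mul_of_nonneg_left hw.le (norm_nonneg _)

theorem expVar_ne_zero (w : ℂ) : expVar w ≠ 0 := Complex.exp_ne_zero _

theorem expVar_zpow (w : ℂ) (k : ℤ) : expVar w ^ k = Complex.exp (k * Real.pi * w * Complex.I) := by
  rw [expVar, ← Complex.exp_int_mul]
  ring_nf

/-- The frequencies `(2 k - ε) π`, `k ≥ 1`, numbered from `0`. -/
noncomputable def sineFreq (ε : ℤ) (n : ℕ) : ℂ := (2 * (n + 1) - ε) * Real.pi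

/-- Geometric decay of the coefficients dominates the growth of the sines in a small disc. -/
theorem summable_sineFreq {ε : ℤ} (hε : ε = 0 ∨ ε = 1) {r : ℤ → ℂ} {M β : ℝ} (hβ0 : 0 < β)
    (hβ1 : β < 1) (hr : ∀ k : ℤ, 1 ≤ k → ‖r k‖ ≤ M * β ^ k) :
    ∃ R : ℝ, 0 < R ∧ Summable fun n : ℕ => ‖r (n + 1)‖ * Real.exp (‖sineFreq ε n‖ * R) := by
  have hl := Real.log_neg hβ0 hβ1
  have hpi := Real.pi_pos
  -- With this radius the exponential is at most `β ^ (-(n + 1) / 2)`.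
  refine ⟨-Real.log β / (4 * Real.pi), by
    have : 0 < -Real.log β := by linarith
    positivity, ?_⟩
  have hb : β * Real.exp (-Real.log β / 2) < 1 := by
    nth_rewrite 1 [← Real.exp_log hβ0]
    rw [← Real.exp_add, Real.exp_lt_one_iff]
    linarith
  have h0 : 0 ≤ β * Real.exp (-Real.log β / 2) := by positivity
  have hg := ((summable_nat_add_iff 1).2 (summable_geometric_of_lt_one h0 hb)).mul_left M
  refine Summable.of_nonneg_of_le (fun n => by positivity) (fun n => ?_) hg
  have h1 := hr (n + 1) (by omega)
  have hθ : ‖sineFreq ε n‖ ≤ 2 * (n + 1) * Real.pi := by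
    have e : sineFreq ε n = (((2 * (n + 1) - ε) * Real.pi : ℝ) : ℂ) := by
      rw [sineFreq]
      push_cast
      ring
    have hn : (0 : ℝ) ≤ n := Nat.cast_nonneg n
    rw [e, Complex.norm_real, Real.norm_eq_abs, abs_mul, abs_of_pos hpi]
    refine mul_le_mul_of_nonneg_right ?_ hpi.le
    rw [abs_le]
    rcases hε with rfl | rfl
    · push_cast
      constructor <;> linarith
    · push_cast
      constructor <;> linarith
  have h2 : Real.exp (‖sineFreq ε n‖ * (-Real.log β / (4 * Real.pi))) ≤
      Real.exp (-Real.log β / 2) ^ (n + 1) := by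
    rw [← Real.exp_nat_mul]
    refine Real.exp_le_exp.2 ?_
    have h3 : 0 ≤ -Real.log β / (4 * Real.pi) := by
      have : 0 < -Real.log β := by linarith
      positivity
    refine (mul_le_mul_of_nonneg_right hθ h3).trans (le_of_eq ?_)
    push_cast
    field_simp
    ring
  rw [mul_pow, ← mul_assoc]
  refine mul_le_mul ?_ h2 (by positivity) ((norm_nonneg (r (n + 1))).trans ?_)
  · exact_mod_cast h1
  · exact_mod_cast h1

/-- A Laurent series which is odd under `k ↦ ε - k` is a sine series. -/
theorem tsum_laurent_expVar {ε : ℤ} (hε : ε = 0 ∨ ε = 1) {r : ℤ → ℂ}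
    (hrr : ∀ k, r (ε - k) = -r k) {R : ℝ}
    (hs : Summable fun n : ℕ => ‖r (n + 1)‖ * Real.exp (‖sineFreq ε n‖ * R)) {w : ℂ}
    (hw : ‖w‖ ≤ R) :
    expVar w ^ (-ε) * ∑' k : ℤ, r k * (expVar w ^ 2) ^ k =
      2 * Complex.I * ∑' n : ℕ, r (n + 1) * Complex.sin (sineFreq ε n * w) := by
  have hsum : ∀ σ : ℂ, ‖σ‖ = 1 →
      Summable fun n : ℕ => r (n + 1) * Complex.exp (σ * (sineFreq ε n * w)) := by
    intro σ hσ
    refine Summable.of_norm_bounded hs fun n => ?_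
    rw [norm_mul]
    refine mul_le_mul_of_nonneg_left ((Complex.norm_exp_le_exp_norm _).trans
      (Real.exp_le_exp.2 ?_)) (norm_nonneg _)
    rw [norm_mul, hσ, one_mul, norm_mul]
    exact mul_le_mul_of_nonneg_left hw (norm_nonneg _)
  have h1 := hsum Complex.I Complex.norm_I
  have h2 := hsum (-Complex.I) (by rw [norm_neg, Complex.norm_I])
  set f : ℤ → ℂ := fun k => r k * Complex.exp ((2 * k - ε) * Real.pi * w * Complex.I) with hf
  have hfr : ∀ k, f (ε - k) = -(r k * Complex.exp (-((2 * k - ε) * Real.pi * w * Complex.I))) := by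
    intro k
    rw [hf]
    simp only [hrr]
    push_cast
    rw [neg_mul]
    congr 3
    ring
  have h1' : HasSum (fun n : ℕ => f (n + 1))
      (∑' n : ℕ, r (n + 1) * Complex.exp (Complex.I * (sineFreq ε n * w))) := by
    refine h1.hasSum.congr_fun fun n => ?_
    rw [hf, sineFreq]
    push_cast
    ring_nf
  have h2' : HasSum (fun n : ℕ => f (ε - (n + 1)))
      (-∑' n : ℕ, r (n + 1) * Complex.exp (-Complex.I * (sineFreq ε n * w))) := by
    refine h2.hasSum.neg.congr_fun fun n => ?_
    rw [hfr, sineFreq]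
    push_cast
    ring_nf
  have hF : HasSum f ((∑' n : ℕ, r (n + 1) * Complex.exp (Complex.I * (sineFreq ε n * w))) +
      (-∑' n : ℕ, r (n + 1) * Complex.exp (-Complex.I * (sineFreq ε n * w)))) := by
    rcases hε with rfl | rfl
    · have h0 : f 0 = 0 := by
        have : r 0 = 0 := by
          have := hrr 0
          rw [sub_zero] at this
          linear_combination this / 2
        rw [hf]
        simp only [this, zero_mul]
      have := HasSum.of_add_one_of_neg_add_one h1' (by simpa only [zero_sub] using h2')
      rwa [h0, add_zero] at this
    · rw [add_comm]
      rw [← (Equiv.subLeft (0 : ℤ)).hasSum_iff]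
      refine HasSum.of_nat_of_neg_add_one (h2'.congr_fun fun n => ?_) (h1'.congr_fun fun n => ?_)
      · simp only [Function.comp, Equiv.subLeft_apply]
        congr 1
        ring
      · simp only [Function.comp, Equiv.subLeft_apply]
        congr 1
        ring
  rw [← tsum_mul_left, ← tsum_mul_left]
  have e1 : ∀ k : ℤ, expVar w ^ (-ε) * (r k * (expVar w ^ 2) ^ k) = f k := by
    intro k
    rw [hf, ← zpow_natCast, ← zpow_mul, mul_left_comm, ← zpow_add₀ (expVar_ne_zero w), expVar_zpow]
    push_cast
    ring_nf
  rw [tsum_congr e1, hF.tsum_eq, ← sub_eq_add_neg, ← h1.tsum_sub h2]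
  refine tsum_congr fun n => ?_
  rw [Complex.sin, show Complex.I * (sineFreq ε n * w) = sineFreq ε n * w * Complex.I by ring,
    show -Complex.I * (sineFreq ε n * w) = -(sineFreq ε n * w) * Complex.I by ring]
  linear_combination (-r (n + 1) * (Complex.exp (-(sineFreq ε n * w) * Complex.I) -
    Complex.exp (sineFreq ε n * w * Complex.I))) * Complex.I_sq

/-! ### Power series of the pfaffian entries -/

/-- The Taylor expansion at `0` of `f` which the theorem asserts, up to the prefactor, for the
pfaffian entry with label `σ`. -/
def HasLambertExpansion (σ : PfLabel) (τ : ℂ) (f : ℂ → ℂ) : Prop :=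
  ∃ (b : ℕ → ℂ) (R : ℝ), 0 < R ∧ (∀ w, ‖w‖ < R → HasSum (fun k => b k * w ^ k) (f w)) ∧
    (∀ k, b (2 * k) = 0) ∧ ∀ m, ((2 * m + 1).factorial : ℂ) * b (2 * m + 1) =
      2 * Complex.I * constC σ τ * ((-1) ^ m * (Real.pi : ℂ) ^ (2 * m + 1) * lambertL σ τ m)

/-- The moments of the coefficients `r` at the frequencies `(2 k - ε) π` are the Lambert sums
`∑ lambertTerm`, up to powers of `π`. -/
theorem summable_lambertTerm_and_tsum {σ : PfLabel} {τ : ℂ} {ε : ℤ} {r : ℤ → ℂ} {R : ℝ}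
    (hR : 0 < R)
    (hs : Summable fun n : ℕ => ‖r (n + 1)‖ * Real.exp (‖sineFreq ε n‖ * R))
    (hterm : ∀ j n : ℕ,
      lambertTerm σ τ j (n + 1) = r (n + 1) * (2 * (n + 1) - ε) ^ (2 * j + 1)) :
    (∀ j : ℕ, Summable fun k : ℕ => lambertTerm σ τ j (k + 1)) ∧
    ∀ j : ℕ, ∑' n : ℕ, r (n + 1) * sineFreq ε n ^ (2 * j + 1) =
      (Real.pi : ℂ) ^ (2 * j + 1) * ∑' k : ℕ, lambertTerm σ τ j (k + 1) := by
  have hpi : (Real.pi : ℂ) ≠ 0 := Complex.ofReal_ne_zero.2 Real.pi_ne_zero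
  have e : ∀ j n : ℕ, r (n + 1) * sineFreq ε n ^ (2 * j + 1) =
      (Real.pi : ℂ) ^ (2 * j + 1) * lambertTerm σ τ j (n + 1) := fun j n => by
    rw [hterm, sineFreq, mul_pow]
    ring
  refine ⟨fun j => ?_, fun j => ?_⟩
  · have h := summable_mul_pow_of_exp hR hs (2 * j + 1)
    exact (summable_mul_left_iff (pow_ne_zero (2 * j + 1) hpi)).1 (h.congr (e j))
  · rw [← tsum_mul_left]
    exact tsum_congr (e j)

/-- The Taylor expansion of an entry which is represented, in a full neighbourhood of `0`, by an odd
Laurent series in `x = expVar w ^ 2`. This covers all labels except `1`. -/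
theorem hasLambertExpansion_of_laurent {σ : PfLabel} {τ : ℂ} {ε : ℤ} (hε : ε = 0 ∨ ε = 1)
    {r : ℤ → ℂ} {M β : ℝ} (hrr : ∀ k, r (ε - k) = -r k) (hβ0 : 0 < β) (hβ1 : β < 1)
    (hr : ∀ k : ℤ, 1 ≤ k → ‖r k‖ ≤ M * β ^ k)
    (hterm : ∀ j n : ℕ,
      lambertTerm σ τ j (n + 1) = r (n + 1) * (2 * (n + 1) - ε) ^ (2 * j + 1))
    (hL : ∀ j, lambertL σ τ j = ∑' k : ℕ, lambertTerm σ τ j (k + 1)) {f : ℂ → ℂ}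
    (hf : ∀ᶠ w in 𝓝 0, f w =
      constC σ τ * (expVar w ^ (-ε) * ∑' k : ℤ, r k * (expVar w ^ 2) ^ k)) :
    (∀ j : ℕ, Summable fun k : ℕ => lambertTerm σ τ j (k + 1)) ∧ HasLambertExpansion σ τ f := by
  obtain ⟨R, hR, hs⟩ := summable_sineFreq hε hβ0 hβ1 hr
  obtain ⟨h1, h2⟩ := summable_lambertTerm_and_tsum hR hs hterm
  obtain ⟨R', hR', hf'⟩ := Metric.eventually_nhds_iff_ball.1 hf
  refine ⟨h1, fun j => 2 * Complex.I * constC σ τ *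
    (sinCoeff j * ∑' n : ℕ, r (n + 1) * sineFreq ε n ^ j), min R R', lt_min hR hR',
    fun w hw => ?_, fun k => ?_, fun m => ?_⟩
  · rw [lt_min_iff] at hw
    rw [hf' w (by rw [mem_ball_zero_iff]; exact hw.2),
      tsum_laurent_expVar hε hrr hs hw.1.le]
    have h := (hasSum_sine_series (r := fun n => r (n + 1)) hR hs hw.1.le).mul_left
      (2 * Complex.I * constC σ τ)
    rw [show constC σ τ * (2 * Complex.I *
      ∑' n : ℕ, r (n + 1) * Complex.sin (sineFreq ε n * w)) = 2 * Complex.I * constC σ τ *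
      ∑' n : ℕ, r (n + 1) * Complex.sin (sineFreq ε n * w) by ring]
    refine h.congr_fun fun j => ?_
    ring
  · simp only [sinCoeff_two_mul]
    ring
  · rw [hL]
    simp only [h2]
    linear_combination (2 * Complex.I * constC σ τ * ((Real.pi : ℂ) ^ (2 * m + 1) *
      ∑' k : ℕ, lambertTerm σ τ m (k + 1))) * factorial_mul_sinCoeff m

/-- The generating function of Glaisher's `T`-numbers. -/
noncomputable def glaisherFn (z : ℂ) : ℂ := Complex.sin (2 * z) / (2 * Complex.cos (3 * z))

theorem iteratedDeriv_glaisherFn_even (k : ℕ) : iteratedDeriv (2 * k) glaisherFn 0 = 0 := by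
  have h1 := iteratedDeriv_comp_neg (2 * k) glaisherFn 0
  have h2 : (fun z => glaisherFn (-z)) = -glaisherFn := by
    funext z
    rw [Pi.neg_apply, glaisherFn, glaisherFn, mul_neg, mul_neg, Complex.sin_neg, Complex.cos_neg,
      neg_div]
  rw [h2, iteratedDeriv_neg, neg_zero, Even.neg_one_pow (even_two_mul k), one_smul] at h1
  linear_combination -h1 / 2

theorem exists_glaisherFn_series : ∃ R : ℝ, 0 < R ∧
    DifferentiableOn ℂ glaisherFn (Metric.ball 0 R) ∧ ∀ z ∈ Metric.ball (0 : ℂ) R,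
      HasSum (fun n => (n.factorial : ℂ)⁻¹ * iteratedDeriv n glaisherFn 0 * z ^ n)
        (glaisherFn z) := by
  have hc : ContinuousAt (fun z : ℂ => Complex.cos (3 * z)) 0 := by fun_prop
  obtain ⟨R, hR, h⟩ := Metric.eventually_nhds_iff_ball.1
    (hc.eventually_ne (y := 0) (by simp))
  have hd : DifferentiableOn ℂ glaisherFn (Metric.ball 0 R) := by
    intro z hz
    have h1 : DifferentiableAt ℂ (fun z : ℂ => Complex.sin (2 * z)) z := by fun_prop
    have h2 : DifferentiableAt ℂ (fun z : ℂ => 2 * Complex.cos (3 * z)) z := by fun_prop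
    exact (h1.fun_div h2 (mul_ne_zero two_ne_zero (h z hz))).differentiableWithinAt
  refine ⟨R, hR, hd, fun z hz => ?_⟩
  refine (Complex.hasSum_taylorSeries_on_ball hd hz).congr_fun fun n => ?_
  rw [sub_zero, smul_eq_mul, smul_eq_mul]
  ring

/-- The Taylor expansion of the entry with label `1`. Its Laurent series is only available for
`|x| < 1`, that is for `w` in the upper half-plane; both sides being analytic at `0`, the identity
theorem applies. -/
theorem hasLambertExpansion_one {τ : ℂ} {r : ℤ → ℂ} {M β : ℝ} (hrr : ∀ k, r (1 - k) = -r k)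
    (hβ0 : 0 < β) (hβ1 : β < 1) (hr : ∀ k : ℤ, 1 ≤ k → ‖r k‖ ≤ M * β ^ k)
    (hterm : ∀ j n : ℕ,
      lambertTerm .one τ j (n + 1) = r (n + 1) * (2 * (n + 1) - (1 : ℤ)) ^ (2 * j + 1))
    {f : ℂ → ℂ} (hfd : ∀ᶠ w in 𝓝 0, DifferentiableAt ℂ f w)
    (hf : ∀ᶠ w in 𝓝 0, 0 < w.im → f w = constC .one τ *
      (-2 * Complex.I * glaisherFn (Real.pi * w) +
        expVar w ^ (-1 : ℤ) * ∑' k : ℤ, r k * (expVar w ^ 2) ^ k)) :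
    (∀ j : ℕ, Summable fun k : ℕ => lambertTerm .one τ j (k + 1)) ∧
      HasLambertExpansion .one τ f := by
  have hpi := Real.pi_pos
  obtain ⟨R₁, hR₁, hs⟩ := summable_sineFreq (Or.inr rfl) hβ0 hβ1 hr
  obtain ⟨h1, h2⟩ := summable_lambertTerm_and_tsum hR₁ hs hterm
  obtain ⟨R₂, hR₂, hfd'⟩ := Metric.eventually_nhds_iff_ball.1 (hfd.and hf)
  obtain ⟨R₃, hR₃, hgd, hgs⟩ := exists_glaisherFn_series
  set R := min R₁ (min R₂ (R₃ / Real.pi)) with hRdef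
  have hR : 0 < R := lt_min hR₁ (lt_min hR₂ (div_pos hR₃ hpi))
  have hR1 : R ≤ R₁ := min_le_left _ _
  have hR2 : R ≤ R₂ := (min_le_right _ _).trans (min_le_left _ _)
  have hR3 : R ≤ R₃ / Real.pi := (min_le_right _ _).trans (min_le_right _ _)
  have hball : ∀ w ∈ Metric.ball (0 : ℂ) R, (Real.pi : ℂ) * w ∈ Metric.ball (0 : ℂ) R₃ := by
    intro w hw
    rw [mem_ball_zero_iff] at hw ⊢
    rw [norm_ofReal_mul_of_pos hpi, mul_comm]
    exact (lt_div_iff₀ hpi).1 (hw.trans_le hR3)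
  set G : ℂ → ℂ := fun w => constC .one τ * (-2 * Complex.I * glaisherFn (Real.pi * w) +
    2 * Complex.I * ∑' n : ℕ, r (n + 1) * Complex.sin (sineFreq 1 n * w)) with hG
  have hGd : DifferentiableOn ℂ G (Metric.ball 0 R) := by
    have hd1 : DifferentiableOn ℂ (fun w : ℂ => glaisherFn (Real.pi * w)) (Metric.ball 0 R) :=
      hgd.comp (by fun_prop) hball
    have hd2 : DifferentiableOn ℂ (fun w => ∑' n : ℕ, r (n + 1) * Complex.sin (sineFreq 1 n * w))
        (Metric.ball 0 R) :=
      (differentiableOn_sine_series (r := fun n => r (n + 1)) hs).mono (Metric.ball_subset_ball hR1)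
    exact ((hd1.const_mul _).add (hd2.const_mul _)).const_mul _
  have hfd1 : DifferentiableOn ℂ f (Metric.ball 0 R) := fun w hw =>
    (hfd' w (Metric.ball_subset_ball hR2 hw)).1.differentiableWithinAt
  have hupper : ∀ w ∈ Metric.ball (0 : ℂ) R, 0 < w.im → f w = G w := by
    intro w hw hwi
    have hw1 : ‖w‖ ≤ R₁ := (mem_ball_zero_iff.1 hw).le.trans hR1
    rw [(hfd' w (Metric.ball_subset_ball hR2 hw)).2 hwi,
      tsum_laurent_expVar (Or.inr rfl) hrr hs hw1]
  -- The Laurent series represents `f` in the upper half of the disc only.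
  have hEq : Set.EqOn f G (Metric.ball 0 R) := by
    set z₀ : ℂ := ((R / 2 : ℝ) : ℂ) * Complex.I with hz₀
    have hz₀b : z₀ ∈ Metric.ball (0 : ℂ) R := by
      rw [mem_ball_zero_iff, hz₀, norm_mul, Complex.norm_I, mul_one, Complex.norm_real,
        Real.norm_eq_abs, abs_of_pos (half_pos hR)]
      exact half_lt_self hR
    have hz₀i : 0 < z₀.im := by
      rw [hz₀, Complex.im_ofReal_mul, Complex.I_im, mul_one]
      exact half_pos hR
    refine AnalyticOnNhd.eqOn_of_preconnected_of_eventuallyEq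
      (hfd1.analyticOnNhd Metric.isOpen_ball) (hGd.analyticOnNhd Metric.isOpen_ball)
      (convex_ball 0 R).isPreconnected hz₀b ?_
    filter_upwards [Metric.isOpen_ball.mem_nhds hz₀b,
      (isOpen_lt continuous_const Complex.continuous_im).mem_nhds hz₀i] with w hw hwi
    exact hupper w hw hwi
  refine ⟨h1, fun j => 2 * Complex.I * constC .one τ *
    (-((j.factorial : ℂ)⁻¹ * iteratedDeriv j glaisherFn 0 * (Real.pi : ℂ) ^ j) +
      sinCoeff j * ∑' n : ℕ, r (n + 1) * sineFreq 1 n ^ j), R, hR,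
    fun w hw => ?_, fun k => ?_, fun m => ?_⟩
  · have hw' : w ∈ Metric.ball (0 : ℂ) R := mem_ball_zero_iff.2 hw
    have e1 := hgs _ (hball w hw')
    have e2 := hasSum_sine_series (r := fun n => r (n + 1)) hR₁ hs (hw.le.trans hR1)
    rw [hEq hw', hG]
    refine (((e1.mul_left (-2 * Complex.I)).add (e2.mul_left (2 * Complex.I))).mul_left
      (constC .one τ)).congr_fun fun j => ?_
    rw [mul_pow]
    ring
  · simp only [sinCoeff_two_mul, iteratedDeriv_glaisherFn_even]
    ring
  · have hm : ((2 * m + 1).factorial : ℂ) ≠ 0 := Nat.cast_ne_zero.2 (Nat.factorial_ne_zero _)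
    have hsq : ((-1 : ℂ) ^ m) * (-1) ^ m = 1 := by
      rw [← mul_pow]
      simp
    have hT : iteratedDeriv (2 * m + 1) glaisherFn 0 = glaisherT m := rfl
    have hL : lambertL .one τ m =
        (-1) ^ (m + 1) * glaisherT m + ∑' k : ℕ, lambertTerm .one τ m (k + 1) := rfl
    simp only [h2, hT, hL]
    have hfac := factorial_mul_sinCoeff m
    have hinv := mul_inv_cancel₀ hm
    linear_combination (2 * Complex.I * constC .one τ * ((Real.pi : ℂ) ^ (2 * m + 1) *
      ∑' k : ℕ, lambertTerm .one τ m (k + 1))) * hfac -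
      (2 * Complex.I * constC .one τ * glaisherT m * (Real.pi : ℂ) ^ (2 * m + 1)) * hinv +
      (2 * Complex.I * constC .one τ * glaisherT m * (Real.pi : ℂ) ^ (2 * m + 1)) * hsq

/-! ### The six labels -/

theorem nomePow_eq_zpow {τ l : ℂ} (m : ℤ) (h : l = m / 3) :
    nomePow τ l = nomePow τ (1 / 3) ^ m := by
  rw [nomePow, nomePow, ← Complex.exp_int_mul, h]
  congr 1
  ring

theorem nomePow_eq_pow {τ l : ℂ} (m : ℕ) (h : l = m / 3) :
    nomePow τ l = nomePow τ (1 / 3) ^ m := by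
  rw [nomePow_eq_zpow m (by simpa using h), zpow_natCast]

theorem norm_nomePow_third_lt_one {τ : ℂ} (hτ : 0 < τ.im) : ‖nomePow τ (1 / 3)‖ < 1 := by
  rw [nomePow, Complex.norm_exp, Real.exp_lt_one_iff]
  have e : Complex.I * Real.pi * τ * (1 / 3) = ((Real.pi / 3 : ℝ) : ℂ) * (τ * Complex.I) := by
    push_cast
    ring
  rw [e, Complex.re_ofReal_mul, Complex.mul_I_re]
  have := mul_pos (div_pos Real.pi_pos three_pos) hτ
  linarith

theorem nomePow_ne_zero (τ l : ℂ) : nomePow τ l ≠ 0 := Complex.exp_ne_zero _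

/-- The theta function in the denominator of the pfaffian entries, as a function of
`x = (x_i / x_j) ^ 2`, with `p = g ^ 3`. -/
noncomputable def pairDen (σ : PfLabel) (g x : ℂ) : ℂ :=
  match σ with
  | .zero => qTheta (g * x) (g ^ 2)
  | .one => qTheta (-x ^ 3) (g ^ 18)
  | .two => qTheta (g ^ 9 * x ^ 3) (g ^ 18)
  | .three => qTheta (-x) (g ^ 2)
  | .four => qTheta (g ^ 9 * x ^ 3) (g ^ 18)
  | .six => qTheta (g * x) (g ^ 2)

/-- The pfaffian entry as a function of `X = x_i / x_j`, with `p = g ^ 3`. -/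
noncomputable def pairEntry (σ : PfLabel) (g X : ℂ) : ℂ :=
  match σ with
  | .zero => (X ^ 2)⁻¹ * thetaA g (X ^ 2) / pairDen .zero g (X ^ 2)
  | .one => X * thetaA g (X ^ 2) / pairDen .one g (X ^ 2)
  | .two => X⁻¹ * thetaB g (X ^ 2) / pairDen .two g (X ^ 2)
  | .three => X⁻¹ * thetaA g (X ^ 2) / pairDen .three g (X ^ 2)
  | .four => (X ^ 2)⁻¹ * thetaA g (X ^ 2) / pairDen .four g (X ^ 2)
  | .six => X⁻¹ * thetaB g (X ^ 2) / pairDen .six g (X ^ 2)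

/-- The factor in front of the pfaffian as a function of `X = x_i / x_j`, with `p = g ^ 3`. -/
noncomputable def pairFactor (σ : PfLabel) (g X : ℂ) : ℂ :=
  match σ with
  | .zero => pairDen .zero g (X ^ 2)
  | .one => (X ^ 3)⁻¹ * pairDen .one g (X ^ 2)
  | .two => pairDen .two g (X ^ 2)
  | .three => X⁻¹ * pairDen .three g (X ^ 2)
  | .four => pairDen .four g (X ^ 2)
  | .six => pairDen .six g (X ^ 2)

theorem expVar_sub (z z' : ℂ) : expVar (z - z') = expVar z / expVar z' := by
  rw [expVar, expVar, expVar, ← Complex.exp_sub]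
  ring_nf

theorem nomePow_two_thirds (τ : ℂ) : nomePow τ (2 / 3) = nomePow τ (1 / 3) ^ 2 :=
  nomePow_eq_pow 2 (by norm_num)

theorem nomePow_one (τ : ℂ) : nomePow τ 1 = nomePow τ (1 / 3) ^ 3 :=
  nomePow_eq_pow 3 (by norm_num)

theorem nomePow_two (τ : ℂ) : nomePow τ 2 = nomePow τ (1 / 3) ^ 6 :=
  nomePow_eq_pow 6 (by norm_num)

theorem nomePow_three (τ : ℂ) : nomePow τ 3 = nomePow τ (1 / 3) ^ 9 :=
  nomePow_eq_pow 9 (by norm_num)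

theorem nomePow_six (τ : ℂ) : nomePow τ 6 = nomePow τ (1 / 3) ^ 18 :=
  nomePow_eq_pow 18 (by norm_num)

theorem thetaNumA_eq (τ x y : ℂ) : thetaNumA τ x y = thetaA (nomePow τ (1 / 3)) ((x / y) ^ 2) := by
  rw [thetaNumA, thetaA, nomePow_two, nomePow_one, div_pow]

theorem thetaNumB_eq (τ x y : ℂ) : thetaNumB τ x y = thetaB (nomePow τ (1 / 3)) ((x / y) ^ 2) := by
  rw [thetaNumB, thetaB, nomePow_two, nomePow_one, div_pow]

theorem pfEntry_eq (σ : PfLabel) (τ z z' : ℂ) :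
    pfEntry σ τ (expVar z) (expVar z') = pairEntry σ (nomePow τ (1 / 3)) (expVar (z - z')) := by
  rw [expVar_sub]
  have hx := expVar_ne_zero z
  have hy := expVar_ne_zero z'
  generalize expVar z = x at *
  generalize expVar z' = y at *
  have h6 : (x ^ 2 / y ^ 2) ^ 3 = x ^ 6 / y ^ 6 := by
    rw [div_pow, ← pow_mul, ← pow_mul]
  cases σ <;>
  · simp only [pfEntry, pairEntry, pairDen, thetaNumA_eq, thetaNumB_eq, nomePow_two_thirds,
      nomePow_three, nomePow_six, div_pow x y 2, h6]
    rw [mul_comm _ (qTheta _ _), ← div_div, div_right_comm]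
    congr 1
    field_simp

theorem prodFactor_eq (σ : PfLabel) (τ z z' : ℂ) :
    prodFactor σ τ (expVar z) (expVar z') =
      pairFactor σ (nomePow τ (1 / 3)) (expVar (z - z')) := by
  rw [expVar_sub]
  have h6 : (expVar z ^ 2 / expVar z' ^ 2) ^ 3 = expVar z ^ 6 / expVar z' ^ 6 := by
    rw [div_pow, ← pow_mul, ← pow_mul]
  cases σ <;>
  simp only [prodFactor, pairFactor, pairDen, nomePow_two_thirds, nomePow_three, nomePow_six, h6,
    div_pow (expVar z) (expVar z') 2, div_pow (expVar z) (expVar z') 3, inv_div]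

theorem qTheta_neg_one {q : ℂ} (hq : ‖q‖ < 1) : qTheta (-1) q = 2 * qPoch (-q) q ^ 2 := by
  rw [qTheta, qPoch_eq_mul hq (-1), div_neg, div_one, neg_one_mul]
  ring

theorem qTheta_sqrt {h : ℂ} (h0 : h ≠ 0) : qTheta h (h ^ 2) = qPoch h (h ^ 2) ^ 2 := by
  rw [qTheta, show h ^ 2 / h = h by field_simp]
  ring

/-- The factor in front of the pfaffian contributes `D_σ / π` for each pair in the limit. -/
theorem pi_mul_pairDen_one (σ : PfLabel) {τ : ℂ} (hτ : 0 < τ.im) :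
    (Real.pi : ℂ) * pairDen σ (nomePow τ (1 / 3)) 1 = constD σ τ := by
  have hg1 := norm_nomePow_third_lt_one hτ
  have hg := nomePow_ne_zero τ (1 / 3)
  have h9 := qTheta_sqrt (pow_ne_zero 9 hg)
  rw [← pow_mul] at h9
  norm_num at h9
  cases σ <;>
  simp only [pairDen, constD, nomePow_two_thirds, nomePow_three, nomePow_six, one_pow, mul_one,
    qTheta_sqrt hg, h9, qTheta_neg_one (norm_pow_lt_one' hg1 two_ne_zero),
    qTheta_neg_one (norm_pow_lt_one' hg1 (show 18 ≠ 0 by norm_num))] <;>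
  ring

theorem pairDen_one_ne_zero (σ : PfLabel) {τ : ℂ} (hτ : 0 < τ.im) :
    pairDen σ (nomePow τ (1 / 3)) 1 ≠ 0 := by
  have hg1 := norm_nomePow_third_lt_one hτ
  have hg := nomePow_ne_zero τ (1 / 3)
  have hn := fun {n : ℕ} (h : n ≠ 0) => norm_pow_lt_one' hg1 h
  have h9 := qTheta_sqrt (pow_ne_zero 9 hg)
  rw [← pow_mul] at h9
  norm_num at h9
  have k0 : qPoch (nomePow τ (1 / 3)) (nomePow τ (1 / 3) ^ 2) ≠ 0 :=
    qPoch_ne_zero_of_norm_lt (hn two_ne_zero) hg1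
  have k9 : qPoch (nomePow τ (1 / 3) ^ 9) (nomePow τ (1 / 3) ^ 18) ≠ 0 :=
    qPoch_ne_zero_of_norm_lt (hn (by norm_num)) (hn (by norm_num))
  have k2 : qPoch (-nomePow τ (1 / 3) ^ 2) (nomePow τ (1 / 3) ^ 2) ≠ 0 :=
    qPoch_ne_zero_of_norm_lt (hn (by norm_num)) (by rw [norm_neg]; exact hn (by norm_num))
  have k18 : qPoch (-nomePow τ (1 / 3) ^ 18) (nomePow τ (1 / 3) ^ 18) ≠ 0 :=
    qPoch_ne_zero_of_norm_lt (hn (by norm_num)) (by rw [norm_neg]; exact hn (by norm_num))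
  cases σ <;>
  simp only [pairDen, one_pow, mul_one, qTheta_sqrt hg, h9, qTheta_neg_one (hn two_ne_zero),
    qTheta_neg_one (hn (show 18 ≠ 0 by norm_num))] <;>
  first
  | exact pow_ne_zero 2 k0
  | exact pow_ne_zero 2 k9
  | exact mul_ne_zero two_ne_zero (pow_ne_zero 2 k2)
  | exact mul_ne_zero two_ne_zero (pow_ne_zero 2 k18)

theorem DifferentiableAt.qTheta {q : ℂ} (hq : ‖q‖ < 1) {f : ℂ → ℂ} {x : ℂ}
    (hf : DifferentiableAt ℂ f x) (hx : f x ≠ 0) :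
    DifferentiableAt ℂ (fun x => qTheta (f x) q) x := by
  unfold _root_.qTheta
  have h1 : DifferentiableAt ℂ (fun x => qPoch (f x) q) x :=
    DifferentiableAt.comp (g := fun a => qPoch a q) x (differentiable_qPoch hq).differentiableAt hf
  have h2 : DifferentiableAt ℂ (fun x => qPoch (q / f x) q) x :=
    DifferentiableAt.comp (g := fun a => qPoch a q) x (differentiable_qPoch hq).differentiableAt
      ((differentiableAt_const q).fun_div hf hx)
  exact h1.fun_mul h2

theorem differentiableAt_pairDen (σ : PfLabel) {g : ℂ} (hg : g ≠ 0) (hg1 : ‖g‖ < 1) {x : ℂ}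
    (hx : x ≠ 0) : DifferentiableAt ℂ (pairDen σ g) x := by
  have hn := fun {n : ℕ} (h : n ≠ 0) => norm_pow_lt_one' hg1 h
  have h2 := hn two_ne_zero
  have h18 := hn (show 18 ≠ 0 by norm_num)
  cases σ
  · exact DifferentiableAt.qTheta h2 (f := fun x => g * x) (by fun_prop) (mul_ne_zero hg hx)
  · exact DifferentiableAt.qTheta h18 (f := fun x => -x ^ 3) (by fun_prop)
      (neg_ne_zero.2 (pow_ne_zero 3 hx))
  · exact DifferentiableAt.qTheta h18 (f := fun x => g ^ 9 * x ^ 3) (by fun_prop)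
      (mul_ne_zero (pow_ne_zero 9 hg) (pow_ne_zero 3 hx))
  · exact DifferentiableAt.qTheta h2 (f := fun x => -x) (by fun_prop) (neg_ne_zero.2 hx)
  · exact DifferentiableAt.qTheta h18 (f := fun x => g ^ 9 * x ^ 3) (by fun_prop)
      (mul_ne_zero (pow_ne_zero 9 hg) (pow_ne_zero 3 hx))
  · exact DifferentiableAt.qTheta h2 (f := fun x => g * x) (by fun_prop) (mul_ne_zero hg hx)

theorem differentiableAt_thetaA {g : ℂ} (hg : g ≠ 0) (hg1 : ‖g‖ < 1) {x : ℂ} (hx : x ≠ 0) :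
    DifferentiableAt ℂ (thetaA g) x := by
  have h6 := norm_pow_lt_one' hg1 (show 6 ≠ 0 by norm_num)
  exact ((DifferentiableAt.qTheta h6 (f := fun x => x) (by fun_prop) hx).fun_mul
    (DifferentiableAt.qTheta h6 (f := fun x => -x) (by fun_prop) (neg_ne_zero.2 hx))).fun_mul
    (DifferentiableAt.qTheta h6 (f := fun x => g ^ 3 * x) (by fun_prop)
      (mul_ne_zero (pow_ne_zero 3 hg) hx))

theorem differentiableAt_thetaB {g : ℂ} (hg : g ≠ 0) (hg1 : ‖g‖ < 1) {x : ℂ} (hx : x ≠ 0) :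
    DifferentiableAt ℂ (thetaB g) x := by
  have h6 := norm_pow_lt_one' hg1 (show 6 ≠ 0 by norm_num)
  have h3 := mul_ne_zero (pow_ne_zero 3 hg) hx
  exact ((DifferentiableAt.qTheta h6 (f := fun x => x) (by fun_prop) hx).fun_mul
    (DifferentiableAt.qTheta h6 (f := fun x => g ^ 3 * x) (by fun_prop) h3)).fun_mul
    (DifferentiableAt.qTheta h6 (f := fun x => -(g ^ 3 * x)) (by fun_prop) (neg_ne_zero.2 h3))

theorem expVar_zero : expVar 0 = 1 := by simp [expVar]

theorem differentiable_expVar : Differentiable ℂ expVar := by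
  unfold expVar
  fun_prop

theorem continuousAt_pairFactor (σ : PfLabel) {g : ℂ} (hg : g ≠ 0) (hg1 : ‖g‖ < 1) :
    ContinuousAt (pairFactor σ g) 1 := by
  have h : ∀ σ, ContinuousAt (fun X => pairDen σ g (X ^ 2)) 1 := fun σ =>
    (differentiableAt_pairDen σ hg hg1 one_ne_zero).continuousAt.comp_of_eq (by fun_prop)
      (one_pow 2)
  cases σ
  · exact h .zero
  · exact ((continuousAt_id.pow 3).inv₀ (by simp)).mul (h .one)
  · exact h .two
  · exact (continuousAt_inv₀ one_ne_zero).mul (h .three)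
  · exact h .four
  · exact h .six

theorem pairFactor_one (σ : PfLabel) (g : ℂ) : pairFactor σ g 1 = pairDen σ g 1 := by
  cases σ <;> simp [pairFactor]

/-- Near `w = 0` the variable `x = exp (2 π i w)` lies in a given annulus about the unit circle,
and the denominator does not vanish. -/
theorem eventually_expVar_sq (σ : PfLabel) {τ : ℂ} (hτ : 0 < τ.im) {α : ℝ} (hα : α < 1) :
    ∀ᶠ w in 𝓝 (0 : ℂ), α < ‖expVar w ^ 2‖ ∧ α * ‖expVar w ^ 2‖ < 1 ∧
      pairDen σ (nomePow τ (1 / 3)) (expVar w ^ 2) ≠ 0 := by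
  have hc : Tendsto (fun w => expVar w ^ 2) (𝓝 0) (𝓝 1) := by
    have : ContinuousAt (fun w => expVar w ^ 2) 0 :=
      (differentiable_expVar.continuous.pow 2).continuousAt
    have h := this.tendsto
    rwa [expVar_zero, one_pow] at h
  have hd := (differentiableAt_pairDen σ (nomePow_ne_zero τ (1 / 3)) (norm_nomePow_third_lt_one hτ)
    one_ne_zero).continuousAt.eventually_ne (pairDen_one_ne_zero σ hτ)
  have h1 : ∀ᶠ x in 𝓝 (1 : ℂ), α < ‖x‖ :=
    continuous_norm.continuousAt.eventually_const_lt (by simpa using hα)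
  have h2 : ∀ᶠ x in 𝓝 (1 : ℂ), α * ‖x‖ < 1 :=
    (continuous_const.mul continuous_norm).continuousAt.eventually_lt_const
      (by simpa using hα)
  exact hc.eventually (h1.and (h2.and hd))

/-! ### Lambert terms and constants -/

theorem lambertTerm_zero (τ : ℂ) (j n : ℕ) : lambertTerm .zero τ j (n + 1) =
    lambertCoeff (nomePow τ (1 / 3)) (-1) 0
      (fun k => nomePow τ (1 / 3) ^ (k - 1) - nomePow τ (1 / 3) ^ (5 * k - 1 - 2 * 0)) (n + 1) *
      (2 * (n + 1) - ((0 : ℤ) : ℂ)) ^ (2 * j + 1) := by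
  have hg := nomePow_ne_zero τ (1 / 3)
  have key := fun (m : ℤ) (l : ℂ) => nomePow_eq_zpow (τ := τ) (l := l) m
  simp only [lambertTerm, lambertCoeff]
  generalize nomePow τ (1 / 3) = g at *
  rw [key (4 * (n + 1)) (4 * ((n + 1 : ℕ) : ℂ) / 3) (by push_cast; ring),
    key (6 * (n + 1) - 3 * 0) (2 * ((n + 1 : ℕ) : ℂ)) (by push_cast; ring),
    key ((n + 1) - 1) ((((n + 1 : ℕ) : ℂ) - 1) / 3) (by push_cast; ring),
    zpow_expand hg (5 * ((n : ℤ) + 1) - 1 - 2 * 0)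
      (show _ = 4 * ((n : ℤ) + 1) + ((n + 1) - 1) by ring)]
  push_cast
  ring

theorem lambertTerm_six (τ : ℂ) (j n : ℕ) : lambertTerm .six τ j (n + 1) =
    lambertCoeff (nomePow τ (1 / 3)) (-1) 1
      (fun k => nomePow τ (1 / 3) ^ (k - 1) - nomePow τ (1 / 3) ^ (5 * k - 1 - 2 * 1)) (n + 1) *
      (2 * (n + 1) - ((1 : ℤ) : ℂ)) ^ (2 * j + 1) := by
  have hg := nomePow_ne_zero τ (1 / 3)
  have key := fun (m : ℤ) (l : ℂ) => nomePow_eq_zpow (τ := τ) (l := l) m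
  simp only [lambertTerm, lambertCoeff]
  generalize nomePow τ (1 / 3) = g at *
  rw [key (4 * (n + 1) - 2) ((4 * ((n + 1 : ℕ) : ℂ) - 2) / 3) (by push_cast; ring),
    key (6 * (n + 1) - 3 * 1) (2 * ((n + 1 : ℕ) : ℂ) - 1) (by push_cast; ring),
    key ((n + 1) - 1) ((((n + 1 : ℕ) : ℂ) - 1) / 3) (by push_cast; ring),
    zpow_expand hg (5 * ((n : ℤ) + 1) - 1 - 2 * 1)
      (show _ = (4 * ((n : ℤ) + 1) - 2) + ((n + 1) - 1) by ring)]
  push_cast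
  ring

theorem lambertTerm_four (τ : ℂ) (j n : ℕ) : lambertTerm .four τ j (n + 1) =
    lambertCoeff (nomePow τ (1 / 3)) (-1) 0
      (fun k => chi (k + 0) * nomePow τ (1 / 3) ^ (3 * k - 3)) (n + 1) *
      (2 * (n + 1) - ((0 : ℤ) : ℂ)) ^ (2 * j + 1) := by
  have key := fun (m : ℤ) (l : ℂ) => nomePow_eq_zpow (τ := τ) (l := l) m
  simp only [lambertTerm, lambertCoeff, chi]
  generalize nomePow τ (1 / 3) = g at *
  rw [key (3 * (n + 1) - 3) (((n + 1 : ℕ) : ℂ) - 1) (by push_cast; ring),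
    key (6 * (n + 1) - 3 * 0) (2 * ((n + 1 : ℕ) : ℂ)) (by push_cast; ring),
    add_zero ((n : ℤ) + 1)]
  push_cast
  ring

theorem lambertTerm_two (τ : ℂ) (j n : ℕ) : lambertTerm .two τ j (n + 1) =
    lambertCoeff (nomePow τ (1 / 3)) (-1) 1
      (fun k => chi (k + 1) * nomePow τ (1 / 3) ^ (3 * k - 3)) (n + 1) *
      (2 * (n + 1) - ((1 : ℤ) : ℂ)) ^ (2 * j + 1) := by
  have key := fun (m : ℤ) (l : ℂ) => nomePow_eq_zpow (τ := τ) (l := l) m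
  simp only [lambertTerm, lambertCoeff, chi]
  generalize nomePow τ (1 / 3) = g at *
  rw [key (3 * (n + 1) - 3) (((n + 1 : ℕ) : ℂ) - 1) (by push_cast; ring),
    key (6 * (n + 1) - 3 * 1) (2 * ((n + 1 : ℕ) : ℂ) - 1) (by push_cast; ring)]
  push_cast
  ring

theorem lambertTerm_three (τ : ℂ) (j n : ℕ) : lambertTerm .three τ j (n + 1) =
    lambertCoeff (nomePow τ (1 / 3)) 1 1
      (fun k => (-1) ^ k *
        (nomePow τ (1 / 3) ^ (2 * k - 2) - nomePow τ (1 / 3) ^ (4 * k - 3))) (n + 1) *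
      (2 * (n + 1) - ((1 : ℤ) : ℂ)) ^ (2 * j + 1) := by
  have hg := nomePow_ne_zero τ (1 / 3)
  have key := fun (m : ℤ) (l : ℂ) => nomePow_eq_zpow (τ := τ) (l := l) m
  simp only [lambertTerm, lambertCoeff]
  generalize nomePow τ (1 / 3) = g at *
  rw [key (2 * (n + 1) - 1) ((2 * ((n + 1 : ℕ) : ℂ) - 1) / 3) (by push_cast; ring),
    key (6 * (n + 1) - 3 * 1) (2 * ((n + 1 : ℕ) : ℂ) - 1) (by push_cast; ring),
    key (2 * (n + 1) - 2) ((2 * ((n + 1 : ℕ) : ℂ) - 2) / 3) (by push_cast; ring),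
    zpow_expand hg (4 * ((n : ℤ) + 1) - 3)
      (show _ = (2 * ((n : ℤ) + 1) - 1) + (2 * (n + 1) - 2) by ring),
    show (-1 : ℂ) ^ ((n : ℤ) + 1) = (-1) ^ (n + 1) from zpow_natCast _ (n + 1)]
  push_cast
  ring

theorem lambertTerm_one {τ : ℂ} (hτ : 0 < τ.im) (j n : ℕ) : lambertTerm .one τ j (n + 1) =
    (lambertCoeff (nomePow τ (1 / 3)) 1 1 (fun k => chi (k + 1) * (-1) ^ k) (n + 1) -
      if 1 ≤ (n : ℤ) + 1 then chi ((n + 1 : ℤ) + 1) * (-1) ^ (n + 1 : ℤ) else 0) *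
      (2 * (n + 1) - ((1 : ℤ) : ℂ)) ^ (2 * j + 1) := by
  have hg := nomePow_ne_zero τ (1 / 3)
  have hg1 := norm_nomePow_third_lt_one hτ
  have key := fun (m : ℤ) (l : ℂ) => nomePow_eq_zpow (τ := τ) (l := l) m
  rw [if_pos (by omega)]
  simp only [lambertTerm, lambertCoeff, chi]
  generalize nomePow τ (1 / 3) = g at *
  have h := one_sub_mul_zpow_ne_zero hg hg1 (Or.inl rfl)
    (m := 6 * ((n : ℤ) + 1) - 3 * 1) (Or.inl (by omega))
  rw [key (6 * (n + 1) - 3 * 1) (2 * ((n + 1 : ℕ) : ℂ) - 1) (by push_cast; ring),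
    show (-1 : ℂ) ^ ((n : ℤ) + 1) = (-1) ^ (n + 1) from zpow_natCast _ (n + 1)]
  generalize g ^ (6 * ((n : ℤ) + 1) - 3 * 1) = t at *
  rw [one_mul] at *
  push_cast
  field_simp
  ring

theorem constC_zero (τ : ℂ) : constC .zero τ = -(eulerQ (nomePow τ (1 / 3) ^ 12) /
    (eulerQ (nomePow τ (1 / 3) ^ 6) ^ 2 * eulerQ (nomePow τ (1 / 3) ^ 4))) := by
  simp only [constC, eulerQ]
  rw [nomePow_two, nomePow_eq_pow (τ := τ) (l := 4) 12 (by norm_num),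
    nomePow_eq_pow (τ := τ) (l := 4 / 3) 4 (by norm_num)]

theorem constC_one (τ : ℂ) : constC .one τ = eulerQ (nomePow τ (1 / 3) ^ 3) /
    (eulerQ (nomePow τ (1 / 3) ^ 6) ^ 2 * eulerQ (nomePow τ (1 / 3) ^ 9)) := by
  simp only [constC, eulerQ]
  rw [nomePow_two, nomePow_one, nomePow_three]

theorem constC_two (τ : ℂ) : constC .two τ = eulerQ (-nomePow τ (1 / 3) ^ 3) /
    (eulerQ (nomePow τ (1 / 3) ^ 6) ^ 2 * eulerQ (-nomePow τ (1 / 3) ^ 9)) := by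
  simp only [constC, eulerQ]
  rw [nomePow_two, nomePow_one, nomePow_three]

theorem constC_three (τ : ℂ) : constC .three τ = eulerQ (nomePow τ (1 / 3) ^ 3) /
    (eulerQ (nomePow τ (1 / 3) ^ 6) ^ 2 * eulerQ (nomePow τ (1 / 3))) := by
  simp only [constC, eulerQ]
  rw [nomePow_two, nomePow_one]

theorem constC_four (τ : ℂ) : constC .four τ = -(eulerQ (nomePow τ (1 / 3) ^ 12) /
    (eulerQ (nomePow τ (1 / 3) ^ 6) ^ 2 * eulerQ (nomePow τ (1 / 3) ^ 36))) := by
  simp only [constC, eulerQ]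
  rw [nomePow_two, nomePow_eq_pow (τ := τ) (l := 4) 12 (by norm_num),
    nomePow_eq_pow (τ := τ) (l := 12) 36 (by norm_num)]

theorem constC_six (τ : ℂ) : constC .six τ = -(eulerQ (-nomePow τ (1 / 3) ^ 3) /
    (eulerQ (nomePow τ (1 / 3) ^ 6) ^ 2 * eulerQ (-nomePow τ (1 / 3)))) := by
  simp only [constC, eulerQ]
  rw [nomePow_two, nomePow_one]

theorem exists_cube_root : ∃ ω : ℂ, 1 + ω + ω ^ 2 = 0 := by
  have h := (Complex.isPrimitiveRoot_exp 3 (by norm_num)).geom_sum_eq_zero (by norm_num)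
  refine ⟨Complex.exp (2 * Real.pi * Complex.I / (3 : ℕ)), ?_⟩
  simpa only [Finset.sum_range_succ, Finset.sum_range_zero, pow_zero, pow_one, zero_add] using h

theorem chi_sum_zero_eq {y : ℂ} : chi (1 + 0) + chi (2 + 0) * y + chi (3 + 0) * y ^ 2 = 1 - y := by
  have e0 : chi 3 = 0 := by rw [chi_congr (l := 0) (by norm_num), chi_zero]
  norm_num [chi_one, chi_two, e0]
  ring

/-- The rational function `x (1 - x ^ 2) / (1 + x ^ 3)`, `x = exp (2 π i w)`, in terms of the
generating function of Glaisher's numbers. -/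
theorem glaisherFn_eq_expVar (w : ℂ) : -2 * Complex.I * glaisherFn (Real.pi * w) =
    expVar w * (1 - (expVar w ^ 2) ^ 2) / (1 + (expVar w ^ 2) ^ 3) := by
  have hX := expVar_ne_zero w
  have h : ∀ k : ℕ, Complex.exp (k * (Real.pi * w) * Complex.I) = expVar w ^ k := fun k => by
    rw [expVar, ← Complex.exp_nat_mul]
    ring_nf
  have h2 := h 2
  have h3 := h 3
  push_cast at h2 h3
  have e2 : Complex.sin (2 * (Real.pi * w)) =
      ((expVar w ^ 2)⁻¹ - expVar w ^ 2) * Complex.I / 2 := by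
    rw [Complex.sin, neg_mul, Complex.exp_neg, h2]
  have e3 : Complex.cos (3 * (Real.pi * w)) = (expVar w ^ 3 + (expVar w ^ 3)⁻¹) / 2 := by
    rw [Complex.cos, neg_mul, Complex.exp_neg, h3]
  have e4 : expVar w ^ 3 + (expVar w ^ 3)⁻¹ = (1 + (expVar w ^ 2) ^ 3) * (expVar w ^ 3)⁻¹ := by
    field_simp
    ring
  rw [glaisherFn, e2, e3, e4]
  generalize 1 + (expVar w ^ 2) ^ 3 = E
  -- At the poles both sides are `0` by the convention for division by `0`.
  rcases eq_or_ne E 0 with rfl | hE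
  · simp
  field_simp
  linear_combination (-(1 - expVar w ^ 4)) * Complex.I_sq

/-- The power series expansion of the pfaffian entry for each label. -/
theorem summable_and_hasLambertExpansion (σ : PfLabel) {τ : ℂ} (hτ : 0 < τ.im) :
    (∀ j : ℕ, Summable fun k : ℕ => lambertTerm σ τ j (k + 1)) ∧
      HasLambertExpansion σ τ fun w => pairEntry σ (nomePow τ (1 / 3)) (expVar w) := by
  obtain ⟨ω, hω⟩ := exists_cube_root
  obtain ⟨hω3, hω0, -, -⟩ := cube_root_facts hω
  have hg1 := norm_nomePow_third_lt_one hτ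
  have hg := nomePow_ne_zero τ (1 / 3)
  have t0 := lambertTerm_zero τ
  have t1 := lambertTerm_one hτ
  have t2 := lambertTerm_two τ
  have t3 := lambertTerm_three τ
  have t4 := lambertTerm_four τ
  have t6 := lambertTerm_six τ
  have c0 := constC_zero τ
  have c1 := constC_one τ
  have c2 := constC_two τ
  have c3 := constC_three τ
  have c4 := constC_four τ
  have c6 := constC_six τ
  have hev := fun σ {α : ℝ} (hα : α < 1) => eventually_expVar_sq σ hτ hα
  obtain ⟨a, ha, haF⟩ := exists_isOddTheta_thetaA hg hg1
  obtain ⟨b, hb, hbF⟩ := exists_isOddTheta_thetaB hg hg1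
  have hA : ∀ x : ℂ, x ≠ 0 → DifferentiableAt ℂ (thetaA (nomePow τ (1 / 3))) x :=
    fun x => differentiableAt_thetaA hg hg1
  have hAc : ∀ x : ℂ, x ≠ 0 → ContinuousAt (fun x => x⁻¹ * thetaA (nomePow τ (1 / 3)) x) x :=
    fun x hx => (continuousAt_inv₀ hx).mul (hA x hx).continuousAt
  have hBc : ∀ x : ℂ, x ≠ 0 → ContinuousAt (thetaB (nomePow τ (1 / 3))) x :=
    fun x hx => (differentiableAt_thetaB hg hg1 hx).continuousAt
  have hDen1 := fun x (hx : x ≠ 0) => differentiableAt_pairDen .one hg hg1 (x := x) hx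
  generalize nomePow τ (1 / 3) = g at *
  have hG : 0 < ‖g‖ := norm_pos_iff.2 hg
  have hGn : ∀ n : ℕ, n ≠ 0 → ‖g‖ ^ n < 1 := fun n hn => pow_lt_one₀ hG.le hg1 hn
  have hX : ∀ w, expVar w ^ 2 ≠ 0 := fun w => pow_ne_zero 2 (expVar_ne_zero w)
  cases σ
  case zero =>
    obtain ⟨h1, ⟨M, h2⟩, h3⟩ := lambert_zero_six hg hg1 (Or.inl rfl) ha haF
      (hAc _ (inv_ne_zero hg)) (C := constC .zero τ) (by
        rw [c0]
        exact thetaA_const_zero hg hg1) rfl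
    refine hasLambertExpansion_of_laurent (Or.inl rfl) h1 hG hg1 h2 t0 (fun j => zero_add _) ?_
    filter_upwards [hev .zero hg1] with w ⟨e1, e2, e3⟩
    have h := (h3 _ e1 e2).2
    rw [pairEntry, div_eq_iff e3, h, neg_zero, zpow_zero]
    simp only [pairDen]
    ring
  case one =>
    obtain ⟨h1, ⟨M, h2⟩, h3⟩ := lambert_one hg hg1 hω ha haF (hAc _ (neg_ne_zero.2 hω0))
      (C := constC .one τ) (by
        rw [c1]
        exact thetaA_const_one hω hg hg1) rfl rfl
    refine hasLambertExpansion_one h1 (pow_pos hG 6) (hGn 6 (by norm_num)) h2 t1 ?_ ?_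
    · filter_upwards [hev .one (hGn 6 (by norm_num))] with w ⟨e1, e2, e3⟩
      have d : DifferentiableAt ℂ (fun w => expVar w ^ 2) w :=
        differentiable_expVar.differentiableAt.fun_pow 2
      have d1 : DifferentiableAt ℂ (fun w => thetaA g (expVar w ^ 2)) w :=
        DifferentiableAt.comp (g := thetaA g) w (hA _ (hX w)) d
      have d2 : DifferentiableAt ℂ (fun w => pairDen .one g (expVar w ^ 2)) w :=
        DifferentiableAt.comp (g := pairDen .one g) w (hDen1 _ (hX w)) d
      exact (differentiable_expVar.differentiableAt.fun_mul d1).fun_div d2 e3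
    · filter_upwards [hev .one (hGn 6 (by norm_num))] with w ⟨e1, e2, e3⟩ hw
      have hlt : ‖expVar w ^ 2‖ < 1 := by
        rw [norm_pow]
        refine pow_lt_one₀ (norm_nonneg _) ?_ two_ne_zero
        rw [expVar, Complex.norm_exp, Real.exp_lt_one_iff,
          show Complex.I * Real.pi * w = ((Real.pi : ℝ) : ℂ) * (w * Complex.I) by ring,
          Complex.re_ofReal_mul, Complex.mul_I_re]
        have := mul_pos Real.pi_pos hw
        linarith
      have h := h3 _ e1 hlt
      rw [glaisherFn_eq_expVar, pairEntry, div_eq_iff e3, zpow_neg_one]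
      simp only [pairDen]
      have hx := expVar_ne_zero w
      rw [inv_mul_eq_iff_eq_mul₀ (hX w)] at h
      rw [h]
      generalize 1 + (expVar w ^ 2) ^ 3 = E
      generalize qTheta _ _ = T
      field_simp
  case two =>
    obtain ⟨h1, ⟨M, h2⟩, h3⟩ := lambert_four_two hg hg1 hω (Or.inr rfl) hb hbF
      (hBc _ (div_ne_zero hω0 (pow_ne_zero 3 hg))) (C := constC .two τ) (by
        rw [c2, chi_sum_one_eq, show ω * (ω ^ 2 - 1) = 1 - ω by linear_combination hω3]
        exact thetaB_const_two hω hg hg1) rfl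
    refine hasLambertExpansion_of_laurent (Or.inr rfl) h1 (pow_pos hG 3) (hGn 3 (by norm_num)) h2 t2
      (fun j => zero_add _) ?_
    filter_upwards [hev .two (hGn 3 (by norm_num))] with w ⟨e1, e2, e3⟩
    have h := (h3 _ e1 e2).2
    rw [pairEntry, div_eq_iff e3, h, zpow_neg_one]
    simp only [pairDen]
    ring
  case three =>
    obtain ⟨h1, ⟨M, h2⟩, h3⟩ := lambert_three hg hg1 ha haF
      (hAc _ (neg_ne_zero.2 (inv_ne_zero (pow_ne_zero 2 hg)))) (C := constC .three τ) (by
        rw [c3]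
        exact thetaA_const_three hg hg1) rfl
    refine hasLambertExpansion_of_laurent (Or.inr rfl) h1 (pow_pos hG 2) (hGn 2 (by norm_num)) h2 t3
      (fun j => zero_add _) ?_
    filter_upwards [hev .three (hGn 2 (by norm_num))] with w ⟨e1, e2, e3⟩
    have h := (h3 _ e1 e2).2
    have h' := mul_left_cancel₀ (inv_ne_zero (hX w)) (h.trans (show _ = (expVar w ^ 2)⁻¹ *
      (constC .three τ * (qTheta (-expVar w ^ 2) (g ^ 2) * ∑' k : ℤ, lambertCoeff g 1 1
        (fun k => (-1) ^ k * (g ^ (2 * k - 2) - g ^ (4 * k - 3))) k * (expVar w ^ 2) ^ k)) by ring))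
    rw [pairEntry, div_eq_iff e3, h', zpow_neg_one]
    simp only [pairDen]
    ring
  case four =>
    obtain ⟨h1, ⟨M, h2⟩, h3⟩ := lambert_four_two hg hg1 hω (Or.inl rfl) ha haF
      (hAc _ (div_ne_zero hω0 (pow_ne_zero 3 hg))) (C := constC .four τ) (by
        rw [c4, chi_sum_zero_eq, show ω * (1 - ω) = ω - ω ^ 2 by ring]
        exact thetaA_const_four hω hg hg1) rfl
    refine hasLambertExpansion_of_laurent (Or.inl rfl) h1 (pow_pos hG 3) (hGn 3 (by norm_num)) h2 t4
      (fun j => zero_add _) ?_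
    filter_upwards [hev .four (hGn 3 (by norm_num))] with w ⟨e1, e2, e3⟩
    have h := (h3 _ e1 e2).2
    rw [pairEntry, div_eq_iff e3, h, neg_zero, zpow_zero]
    simp only [pairDen]
    ring
  case six =>
    obtain ⟨h1, ⟨M, h2⟩, h3⟩ := lambert_zero_six hg hg1 (Or.inr rfl) hb hbF
      (hBc _ (inv_ne_zero hg)) (C := constC .six τ) (by
        rw [c6]
        exact thetaB_const_six hg hg1) rfl
    refine hasLambertExpansion_of_laurent (Or.inr rfl) h1 hG hg1 h2 t6 (fun j => zero_add _) ?_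
    filter_upwards [hev .six hg1] with w ⟨e1, e2, e3⟩
    have h := (h3 _ e1 e2).2
    rw [pairEntry, div_eq_iff e3, h, zpow_neg_one]
    simp only [pairDen]
    ring

/-! ### The limit -/

theorem sum_fin_card_Ioi (m : ℕ) : ∑ i : Fin m, (Finset.Ioi i).card = m * (m - 1) / 2 := by
  simp only [Fin.card_Ioi]
  rw [Fin.sum_univ_eq_sum_range fun i => m - 1 - i, Finset.sum_range_reflect (fun i => i) m,
    Finset.sum_range_id]

theorem prod_pairs_const (n : ℕ) (c : ℂ) :
    ∏ i : Fin (2 * n), ∏ _j ∈ Finset.Ioi i, c = c ^ (n * (2 * n - 1)) := by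
  simp only [Finset.prod_const]
  rw [Finset.prod_pow_eq_pow_sum, sum_fin_card_Ioi, mul_assoc, Nat.mul_div_cancel_left _ two_pos]

theorem prod_factorial_Icc (m : ℕ) :
    ∏ j ∈ Finset.Icc 1 m, ((j - 1).factorial : ℂ) = ∏ a : Fin m, (a.1.factorial : ℂ) := by
  rw [Fin.prod_univ_eq_prod_range fun a => ((a.factorial : ℕ) : ℂ)]
  refine Finset.prod_bij' (fun j _ => j - 1) (fun j _ => j + 1) ?_ ?_ ?_ ?_ ?_
  · intro j hj
    rw [Finset.mem_Icc] at hj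
    rw [Finset.mem_range]
    omega
  · intro j hj
    rw [Finset.mem_range] at hj
    rw [Finset.mem_Icc]
    omega
  · intro j hj
    rw [Finset.mem_Icc] at hj
    omega
  · intro j _
    omega
  · intro j _
    rfl

/-- The entries `q ^ (2 (i + j) + 1)` contribute `q` to the power `∑ (4 i + 1) = n (2 n - 1)`, which
equals the number of pairs; the signs cancel. -/
theorem det_hankel_rescale (n : ℕ) (c q : ℂ) (L : ℕ → ℂ) :
    (Matrix.of fun i j : Fin n => c * ((-1) ^ (i.1 + j.1) * q ^ (2 * (i.1 + j.1) + 1) *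
      L (i.1 + j.1))).det =
      c ^ n * q ^ (n * (2 * n - 1)) * (Matrix.of fun i j : Fin n => L (i.1 + j.1)).det := by
  have h1 := Matrix.det_mul_row (fun j : Fin n => (-1) ^ j.1 * q ^ (2 * j.1))
    (Matrix.of fun i j : Fin n => L (i.1 + j.1))
  have h2 := Matrix.det_mul_column (fun i : Fin n => c * q * ((-1) ^ i.1 * q ^ (2 * i.1)))
    (Matrix.of fun i j : Fin n => (-1) ^ j.1 * q ^ (2 * j.1) *
      (Matrix.of fun i j : Fin n => L (i.1 + j.1)) i j)
  have e : (Matrix.of fun i j : Fin n => c * ((-1) ^ (i.1 + j.1) * q ^ (2 * (i.1 + j.1) + 1) *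
      L (i.1 + j.1))) = Matrix.of fun i j : Fin n => c * q * ((-1) ^ i.1 * q ^ (2 * i.1)) *
      (Matrix.of fun i j : Fin n => (-1) ^ j.1 * q ^ (2 * j.1) *
      (Matrix.of fun i j : Fin n => L (i.1 + j.1)) i j) i j := by
    ext i j
    simp only [Matrix.of_apply]
    ring
  have h3 : (∏ i : Fin n, (c * q * ((-1) ^ i.1 * q ^ (2 * i.1)))) *
      ∏ j : Fin n, ((-1) ^ j.1 * q ^ (2 * j.1)) = c ^ n * q ^ (n * (2 * n - 1)) := by
    have h4 : ∀ i : Fin n, c * q * ((-1) ^ i.1 * q ^ (2 * i.1)) * ((-1) ^ i.1 * q ^ (2 * i.1)) =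
        c * q ^ (4 * i.1 + 1) := fun i => by
      have : ((-1 : ℂ) ^ i.1) * (-1) ^ i.1 = 1 := by
        rw [← mul_pow]
        simp
      linear_combination (c * q * q ^ (4 * i.1)) * this
    rw [← Finset.prod_mul_distrib, Finset.prod_congr rfl fun i _ => h4 i, Finset.prod_mul_distrib,
      Finset.prod_const, Finset.card_univ, Fintype.card_fin, Finset.prod_pow_eq_pow_sum]
    congr 2
    rw [Finset.sum_add_distrib, ← Finset.mul_sum, Fin.sum_univ_eq_sum_range fun i => i]
    have := Finset.sum_range_id_mul_two n
    simp only [Finset.sum_const, Finset.card_univ, Fintype.card_fin, smul_eq_mul, mul_one]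
    rcases n with _ | n
    · rfl
    rw [Nat.add_sub_cancel] at this
    rw [show 2 * (n + 1) - 1 = 2 * n + 1 by omega]
    linarith
  rw [e, h2, h1, ← mul_assoc, h3]

theorem tendsto_prod_pairFactor (σ : PfLabel) (n : ℕ) {τ : ℂ} (hτ : 0 < τ.im) :
    Tendsto (fun z : Fin (2 * n) → ℂ => ∏ i : Fin (2 * n), ∏ j ∈ Finset.Ioi i,
      prodFactor σ τ (expVar (z i)) (expVar (z j))) (𝓝 0)
      (𝓝 (pairDen σ (nomePow τ (1 / 3)) 1 ^ (n * (2 * n - 1)))) := by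
  rw [← prod_pairs_const]
  refine tendsto_finsetProd _ fun i _ => tendsto_finsetProd _ fun j _ => ?_
  simp only [prodFactor_eq]
  have h1 : Continuous fun z : Fin (2 * n) → ℂ => expVar (z i - z j) :=
    differentiable_expVar.continuous.comp (by fun_prop)
  have h2 : Tendsto (fun z : Fin (2 * n) → ℂ => expVar (z i - z j)) (𝓝 0) (𝓝 1) := by
    have := h1.tendsto 0
    rwa [Pi.zero_apply, Pi.zero_apply, sub_zero, expVar_zero] at this
  have h3 := (continuousAt_pairFactor σ (nomePow_ne_zero τ (1 / 3))
    (norm_nomePow_third_lt_one hτ)).tendsto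
  rw [pairFactor_one] at h3
  exact h3.comp h2

theorem mainTheorem5 (σ : PfLabel) (n : ℕ) (hn : 1 ≤ n) (τ : ℂ) (hτ : 0 < τ.im) :
    (∀ j : ℕ, Summable fun k : ℕ => lambertTerm σ τ j (k + 1)) ∧
    Tendsto (fun z : Fin (2 * n) → ℂ => ellipticPfaffian σ n τ z / vandermondeProd z)
      (𝓝[{z : Fin (2 * n) → ℂ | Function.Injective z}] 0)
      (𝓝 ((2 * Complex.I * constC σ τ) ^ n * constD σ τ ^ (n * (2 * n - 1)) /
          (∏ j ∈ Finset.Icc 1 (2 * n), ((j - 1).factorial : ℂ)) * hankelH σ n τ)) := by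
  obtain ⟨hsum, b, R, hR, hf, hb0, hb1⟩ := summable_and_hasLambertExpansion σ hτ
  refine ⟨hsum, ?_⟩
  have h1 := (tendsto_prod_pairFactor σ n hτ).mono_left
    (nhdsWithin_le_nhds (s := {z : Fin (2 * n) → ℂ | Function.Injective z}))
  have h2 := tendsto_pfaffian_div_vandermondeProd n hR hf hb0
  have h3 := h1.mul h2
  have hlim : pairDen σ (nomePow τ (1 / 3)) 1 ^ (n * (2 * n - 1)) *
      ((∏ a : Fin (2 * n), (a.1.factorial : ℂ))⁻¹ * (Matrix.of fun i j : Fin n =>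
        ((2 * (i.1 + j.1) + 1).factorial : ℂ) * b (2 * (i.1 + j.1) + 1)).det) =
      (2 * Complex.I * constC σ τ) ^ n * constD σ τ ^ (n * (2 * n - 1)) /
        (∏ j ∈ Finset.Icc 1 (2 * n), ((j - 1).factorial : ℂ)) * hankelH σ n τ := by
    simp only [hb1]
    rw [det_hankel_rescale, prod_factorial_Icc, ← pi_mul_pairDen_one σ hτ, mul_pow, hankelH]
    ring
  rw [hlim] at h3
  refine h3.congr fun z => ?_
  rw [ellipticPfaffian, mul_div_assoc]
  simp only [pfEntry_eq]
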